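/- Let $\{c(t,x):\ t\ge 0,\ x\in\mathbb R\}$ be a measurable, strictly stationary random field on a probability space $(\mathcal S,\mathcal A,P)$ which is centered, $E\,c(t,x)=0$, and uniformly bounded, $\sup_{t,x,s}|c(t,x,s)|<\infty$. Let $\Phi(t,x)=E[c(s,y)\,c(s+t,y+x)]$ (where $s\ge 0$, $s+t\ge 0$; by stationarity this does not depend on $s,y$), and let $$R(x)=\int_{\mathbb R}\Phi(r,x)\,dr .$$ For a set $A$ of points $(t,x)$ let $\mathcal F_A=\sigma\{c(t,x):(t,x)\in A\}$, and let the uniform mixing coefficient be $$\alpha_{\rm um}(r)=\sup_{\mathrm{dist}(A_1,A_2)\ge r}\ \ \sup_{S_1\in\mathcal F_{A_1},\,S_2\in\mathcal F_{A_2},\,P(S_2)\ne 0}|P(S_1\mid S_2)-P(S_1)|,$$ where $\mathrm{dist}$ is the Euclidean distance. Let $\theta>0$, and put $q(\theta)=3$ if $\theta>1/3$ and $q(\theta)=k+1$ if $\theta\in(1/(k+1),1/k]$, $k\ge 3$, $k\in\mathbb N$. For $\varepsilon>0$ let $$W^\varepsilon(t,x)=\frac1{\sqrt\varepsilon}\int_0^t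 c\Big(\frac s\varepsilon,x\Big)\,ds,\qquad t\ge 0,\ x\in\mathbb R .$$ Suppose that at least one of the following two sets of assumptions holds. (a) There is a deterministic constant $K$ such that for each $s$, almost surely, $|c(s,y_1)-c(s,y_2)|\le K|y_1-y_2|^\theta$ for all $y_1,y_2\in\mathbb R$; and there are $C$ and $\delta>0$ with $\alpha_{\rm um}(r)\le C(1+r)^{-(q(\theta)+\delta)}$ for all $r\ge 0$. (b) There are random variables $K(s,\cdot)$, $s\ge0$, with $E\,|K(s,\cdot)|^{2(2q(\theta)-1)}<\infty$, such that for each $s$, almost surely, $\|c(s,\cdot)\|_{C^\theta([0,1])}\le K(s,\cdot)$, where $\|f\|_{C^\theta([0,1])}=\sup_{[0,1]}|f|+\sup_{y_1\ne y_2}|f(y_1)-f(y_2)|/|y_1-y_2|^\theta$; and there are $C$ and $\delta>0$ with $\alpha_{\rm um}(r)\le C(1+r)^{-(2q(\theta)+\delta)}$ for all $r\ge 0$. Then the integral defining $R(x)$ converges absolutely for every $x$, each $W^\varepsilon$ has a version with continuous paths (for each $x$, almost surely, the two coincide for all $t$), and, as $\varepsilon\to0^+$, $W^\varepsilon$ converges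 in law, as a random element of $C(\mathbb R_+\times\mathbb R)$ with the topology of locally uniform convergence, to a centered Gaussian field $W$ with covariance $$E\big(W(t,x)\,W(t',x')\big)=(t\wedge t')\,R(x-x').$$ -/

import Mathlib

open MeasureTheory ProbabilityTheory Filter Topology Set
open scoped NNReal ENNReal

/-- The space `C(ℝ₊ × ℝ)` with the topology of locally uniform convergence
(Mathlib's compact-open topology on `C(X, Y)`). -/
abbrev FieldPath : Type := C(ℝ≥0 × ℝ, ℝ)

/-- `C(ℝ₊ × ℝ)` carries its Borel `σ`-algebra. -/
instance instMeasurableSpaceFieldPath : MeasurableSpace FieldPath := borel FieldPath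

instance instBorelSpaceFieldPath : BorelSpace FieldPath := ⟨rfl⟩

noncomputable section

variable {Ω : Type*} [MeasurableSpace Ω]

/-- A uniformly bounded, centered, (strictly) stationary, measurable random field `c(t, x)`,
`t ≥ 0`, `x ∈ ℝ`, on the probability space `(Ω, P)`. -/
structure IsBoundedStationaryField (P : Measure Ω) (c : ℝ≥0 → ℝ → Ω → ℝ) : Prop where
  /-- for each `x`, the process `t ↦ c(t, x)` is measurable -/
  measurable : ∀ x : ℝ, Measurable (fun p : ℝ≥0 × Ω => c p.1 x p.2)
  /-- `c` is uniformly bounded in `(t, x, ω)` -/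
  bounded : ∃ M : ℝ, ∀ (t : ℝ≥0) (x : ℝ) (ω : Ω), |c t x ω| ≤ M
  /-- `E c(t, x) = 0` -/
  centered : ∀ (t : ℝ≥0) (x : ℝ), ∫ ω, c t x ω ∂P = 0
  /-- the finite dimensional distributions are invariant under all shifts in time and space -/
  stationary : ∀ (n : ℕ) (t : Fin n → ℝ≥0) (x : Fin n → ℝ) (h : ℝ≥0) (k : ℝ),
    P.map (fun ω i => c (t i + h) (x i + k) ω) = P.map (fun ω i => c (t i) (x i) ω)

/-- The correlation function `Φ(t, x) = E[c(s, y) c(s + t, y + x)]`, `(t, x) ∈ ℝ × ℝ`.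
By stationarity the choice of `y` and of `s ≥ 0` with `s + t ≥ 0` is immaterial; here `y = 0`
and `s = max(-t, 0)`, so that `s + t = max(t, 0)`. -/
def correlation (P : Measure Ω) (c : ℝ≥0 → ℝ → Ω → ℝ) (t x : ℝ) : ℝ :=
  ∫ ω, c (-t).toNNReal 0 ω * c t.toNNReal x ω ∂P

/-- `R(x) = ∫_ℝ Φ(r, x) dr`. -/
def integratedCorrelation (P : Measure Ω) (c : ℝ≥0 → ℝ → Ω → ℝ) (x : ℝ) : ℝ :=
  ∫ r : ℝ, correlation P c r x

/-- The `σ`-algebra `F_A` generated by the variables `c(t, x)`, `(t, x) ∈ A`. -/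
def sigmaField (c : ℝ≥0 → ℝ → Ω → ℝ) (A : Set (ℝ≥0 × ℝ)) : MeasurableSpace Ω :=
  ⨆ p ∈ A, MeasurableSpace.comap (c p.1 p.2) inferInstance

/-- The uniform mixing coefficient `α_um(r)`: the supremum of `|P(S₁ | S₂) - P(S₁)|` over
`S₁ ∈ F_{A₁}` and `S₂ ∈ F_{A₂}` with `P(S₂) ≠ 0` and over all sets `A₁`, `A₂` whose Euclidean
distance is at least `r`. -/
def uniformMixing (P : Measure Ω) (c : ℝ≥0 → ℝ → Ω → ℝ) (r : ℝ) : ℝ :=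
  sSup {a : ℝ | ∃ A₁ A₂ : Set (ℝ≥0 × ℝ),
    (∀ p ∈ A₁, ∀ q ∈ A₂, r ≤ √(((p.1 : ℝ) - q.1) ^ 2 + (p.2 - q.2) ^ 2)) ∧
    ∃ S₁ S₂ : Set Ω, MeasurableSet[sigmaField c A₁] S₁ ∧ MeasurableSet[sigmaField c A₂] S₂ ∧
      P S₂ ≠ 0 ∧ a = |(P[|S₂]).real S₁ - P.real S₁|}

/-- Polynomial uniform mixing of order better than `q`:
`α_um(r) ≤ C (1 + r)^{-(q + δ)}` for some `C` and some `δ > 0`. -/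
def HasMixingOrder (P : Measure Ω) (c : ℝ≥0 → ℝ → Ω → ℝ) (q : ℕ) : Prop :=
  ∃ δ : ℝ, 0 < δ ∧ ∃ C : ℝ, ∀ r : ℝ, 0 ≤ r →
    uniformMixing P c r ≤ C * (1 + r) ^ (-((q : ℝ) + δ))

/-- The exponent `q(θ)`: it is `3` if `θ > 1/3`, and `k + 1` if `1/(k+1) < θ ≤ 1/k`, `k ≥ 3`. -/
def mixingExponent (θ : ℝ≥0) : ℕ :=
  if 1 / 3 < θ then 3 else ⌊1 / θ⌋₊ + 1

/-- Hölder regularity in space with a deterministic exponent and a deterministic constant: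
for each `s`, almost surely, `|c(s, y₁) - c(s, y₂)| ≤ K |y₁ - y₂|^θ` for all `y₁, y₂`. -/
def HasHolderRealizations (P : Measure Ω) (c : ℝ≥0 → ℝ → Ω → ℝ) (θ : ℝ≥0) : Prop :=
  ∃ K : ℝ≥0, ∀ s : ℝ≥0, ∀ᵐ ω ∂P, HolderWith K θ (fun y : ℝ => c s y ω)

/-- The norm of `f` in `C^θ([0,1])` (infinite if `f` is not `θ`-Hölder on `[0,1]`). -/
def holderNormUnitInterval (θ : ℝ≥0) (f : ℝ → ℝ) : ℝ≥0∞ :=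
  (⨆ y : Icc (0 : ℝ) 1, ‖f y‖ₑ) + eHolderNorm θ (fun y : Icc (0 : ℝ) 1 => f y)

/-- Hölder regularity in space with a random constant: for each `s`, almost surely
`‖c(s, ·)‖_{C^θ([0,1])} ≤ K(s, ω)`, where `E |K(s, ·)|^m < ∞`. -/
def HasHolderMoments (P : Measure Ω) (c : ℝ≥0 → ℝ → Ω → ℝ) (θ : ℝ≥0) (m : ℕ) : Prop :=
  ∃ K : ℝ≥0 → Ω → ℝ, ∀ s : ℝ≥0, MemLp (K s) m P ∧
    ∀ᵐ ω ∂P, holderNormUnitInterval θ (fun y => c s y ω) ≤ ENNReal.ofReal (K s ω)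

/-- `W^ε(t, x) = ε^{-1/2} ∫_0^t c(s/ε, x) ds`. -/
def scaledIntegral (c : ℝ≥0 → ℝ → Ω → ℝ) (ε : ℝ) (t : ℝ≥0) (x : ℝ) (ω : Ω) : ℝ :=
  (√ε)⁻¹ * ∫ s in (0 : ℝ)..t, c (s / ε).toNNReal x ω

/-- `V` is the random field `W^ε` as a map into `C(ℝ₊ × ℝ)`, i.e. a version of `W^ε` all of
whose paths are continuous. -/
def IsContinuousVersion (P : Measure Ω) (c : ℝ≥0 → ℝ → Ω → ℝ) (ε : ℝ) (V : Ω → FieldPath) :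
    Prop :=
  ∀ x : ℝ, ∀ᵐ ω ∂P, ∀ t : ℝ≥0, V ω (t, x) = scaledIntegral c ε t x ω

/-- `ν` is the law on `C(ℝ₊ × ℝ)` of a centered Gaussian field `W` with
`E[W(t, x) W(t', x')] = (t ∧ t') R(x - x')`. -/
structure IsGaussianFieldLaw (R : ℝ → ℝ) (ν : Measure FieldPath) : Prop where
  gaussian : IsGaussianProcess (fun (p : ℝ≥0 × ℝ) (w : FieldPath) => w p) ν
  centered : ∀ p : ℝ≥0 × ℝ, ∫ w : FieldPath, w p ∂ν = 0
  covariance : ∀ (t t' : ℝ≥0) (x x' : ℝ),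
    ∫ w : FieldPath, w (t, x) * w (t', x') ∂ν = (min t t' : ℝ≥0) * R (x - x')

/-- As `ε → 0+`, the fields `W^ε` converge in law, as random elements of `C(ℝ₊ × ℝ)`, to the
centered Gaussian field with covariance `(t ∧ t') R(x - x')`, where the integral defining
`R(x)` is absolutely convergent. -/
def ConvergesToGaussianField (P : Measure Ω) [IsProbabilityMeasure P]
    (c : ℝ≥0 → ℝ → Ω → ℝ) : Prop :=
  (∀ x : ℝ, Integrable (fun r : ℝ => correlation P c r x)) ∧
  ∃ V : ℝ → Ω → FieldPath, (∀ ε : ℝ, 0 < ε → IsContinuousVersion P c ε (V ε)) ∧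
    ∃ (ν : Measure FieldPath) (_ : IsProbabilityMeasure ν),
      IsGaussianFieldLaw (integratedCorrelation P c) ν ∧
      TendstoInDistribution V (𝓝[>] (0 : ℝ)) (id : FieldPath → FieldPath) (fun _ => P) ν

end

/-! The proof shows convergence of finite-dimensional characteristic functions, proves tightness by
Kolmogorov's criterion, and combines the two by Prokhorov's theorem. Mixing enters through a decay
`α_um(r) ≤ K / (1 + r)^2` and through one covariance inequality (`UniformlyMixing.covariance_le`):
if `|α(x) β(y)| ≤ f(x) + g(y)`, then the covariance of `α(X)` and `β(Y)` is at most `2φ (E f(X) + E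
g(Y))`. Because the error is measured by moments and not by suprema, it has the homogeneity of the
quantity being estimated.

Moments (`exists_moment_bound`): if `E|ξ_s|^j ≤ b^j`, then `E|∫_a^{a+T} ξ|^p ≤ C b^p T^{p/2}`. The
case `p = 2` is the integrability of correlations. For `p ≥ 3` an interval is cut into two halves
separated by a gap of fixed length. Mixed powers nearly factor and are controlled by induction on
`p`, so doubling the length multiplies the moment by a factor close to `2`, whereas `T^{p/2}` grows
by at least `2^{3/2}`; this closes an induction on the length.

Central limit theorem (`norm_charFun_increment_le`): an increment of a linear combination is cut
into `n` short blocks. Each is decoupled from its past by a gap that is negligible after scaling,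
and its characteristic function is expanded to second order with a third-moment remainder. The
estimate is uniform over bounded past variables, so peeling off the latest time gives all
finite-dimensional limits (`tendsto_charFun_scaledIntegral`).

Tightness: applied to spatial differences, where `b` is a multiple of `|x - x'|^θ`, the moment bound
of order `2q` gives increments of order `|t - t'|^q` in time and `|x - x'|^{2qθ}` in space,
uniformly in `ε`. Both exponents exceed `2`, the dimension of the parameter space, since `q ≥ 3` and
`qθ > 1`. Dyadic chaining then yields continuous versions (`HasFieldMomentBound.exists_version`)
and, with Arzelà–Ascoli, tightness (`isTightMeasureSet_of_hasFieldMomentBound`).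

The Gaussian law is not constructed separately: it is a cluster point of the tight family,
identified by its characteristic functions (`exists_tendsto_of_isTightMeasureSet`,
`HasLimitCharFun.isGaussianFieldLaw`). -/

/-! ### Covariance inequality under uniform mixing. -/

section Covariance

variable {Ω : Type*}

/-- Two `σ`-algebras are uniformly mixing with coefficient `φ` if
`|P(A ∩ B) - P(A) P(B)| ≤ φ min(P(A), P(B))`. -/
structure UniformlyMixing {mΩ : MeasurableSpace Ω} (P : Measure Ω) (F G : MeasurableSpace Ω) (φ : ℝ) : Prop where
  left : ∀ A B : Set Ω, MeasurableSet[F] A → MeasurableSet[G] B →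
    |P.real (A ∩ B) - P.real A * P.real B| ≤ φ * P.real A
  right : ∀ A B : Set Ω, MeasurableSet[F] A → MeasurableSet[G] B →
    |P.real (A ∩ B) - P.real A * P.real B| ≤ φ * P.real B

lemma UniformlyMixing.symm {F G mΩ : MeasurableSpace Ω} {P : Measure Ω} {φ : ℝ}
    (h : UniformlyMixing P F G φ) : UniformlyMixing P G F φ :=
  ⟨fun A B hA hB => by rw [inter_comm, mul_comm (P.real A)]; exact h.right B A hB hA,
    fun A B hA hB => by rw [inter_comm, mul_comm (P.real A)]; exact h.left B A hB hA⟩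

lemma Finset.sum_abs_eq_filter {ι : Type*} (s : Finset ι) (a : ι → ℝ) :
    ∑ i ∈ s, |a i| = ∑ i ∈ s with 0 ≤ a i, a i - ∑ i ∈ s with ¬ 0 ≤ a i, a i := by
  rw [← Finset.sum_filter_add_sum_filter_not s (fun i => 0 ≤ a i), sub_eq_add_neg,
    ← Finset.sum_neg_distrib]
  congr 1
  · exact Finset.sum_congr rfl fun i hi => abs_of_nonneg (Finset.mem_filter.1 hi).2
  · exact Finset.sum_congr rfl fun i hi => abs_of_neg (not_le.1 (Finset.mem_filter.1 hi).2)

/-- The values `y` with nonnegative difference form one event of `G` and those with negative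
difference another. Mixing bounds the signed sum over each by `φ P(A)`, which accounts for the
factor `2`. -/
lemma sum_abs_le_of_uniformlyMixing {F G mΩ : MeasurableSpace Ω} {P : Measure Ω} [IsProbabilityMeasure P] (hF : F ≤ mΩ) (hG : G ≤ mΩ) {φ : ℝ}
    (h : ∀ A B : Set Ω, MeasurableSet[F] A → MeasurableSet[G] B →
      |P.real (A ∩ B) - P.real A * P.real B| ≤ φ * P.real A)
    {A : Set Ω} (hA : MeasurableSet[F] A) {Y : Ω → ℝ} (hY : Measurable[G] Y) (s : Finset ℝ) :
    ∑ y ∈ s, |P.real (A ∩ Y ⁻¹' {y}) - P.real A * P.real (Y ⁻¹' {y})| ≤ 2 * φ * P.real A := by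
  have key : ∀ t : Finset ℝ,
      |∑ y ∈ t, (P.real (A ∩ Y ⁻¹' {y}) - P.real A * P.real (Y ⁻¹' {y}))| ≤ φ * P.real A := by
    intro t
    have hm : ∀ y : ℝ, MeasurableSet (Y ⁻¹' {y}) := fun y =>
      hG _ (hY (measurableSet_singleton y))
    have hd : (t : Set ℝ).PairwiseDisjoint (fun y => Y ⁻¹' {y}) := by
      intro y _ z _ hyz
      exact Disjoint.preimage _ (by simpa using hyz)
    have hd' : (t : Set ℝ).PairwiseDisjoint (fun y => A ∩ Y ⁻¹' {y}) := fun y hy z hz hyz =>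
      (hd hy hz hyz).mono inter_subset_right inter_subset_right
    have e1 : ∑ y ∈ t, P.real (A ∩ Y ⁻¹' {y}) = P.real (A ∩ Y ⁻¹' (t : Set ℝ)) := by
      rw [← measureReal_biUnion_finset hd' (fun y _ => (hF _ hA).inter (hm y))]
      congr 1
      ext ω
      simp
    have e2 : ∑ y ∈ t, P.real (Y ⁻¹' {y}) = P.real (Y ⁻¹' (t : Set ℝ)) := by
      rw [← measureReal_biUnion_finset hd (fun y _ => hm y)]
      congr 1
      ext ω
      simp
    rw [Finset.sum_sub_distrib, ← Finset.mul_sum, e1, e2]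
    exact h _ _ hA (hY t.measurableSet)
  rw [Finset.sum_abs_eq_filter]
  have h1 := (abs_le.1 (key {y ∈ s | 0 ≤ P.real (A ∩ Y ⁻¹' {y}) - P.real A * P.real (Y ⁻¹' {y})})).2
  have h2 := (abs_le.1
    (key {y ∈ s | ¬ 0 ≤ P.real (A ∩ Y ⁻¹' {y}) - P.real A * P.real (Y ⁻¹' {y})})).1
  linarith

lemma integral_comp_of_finite_range {mΩ : MeasurableSpace Ω} {P : Measure Ω} [IsProbabilityMeasure P] {E : Type*}
    [NormedAddCommGroup E] [NormedSpace ℝ E] [CompleteSpace E] {X : Ω → ℝ} (hX : Measurable X) {s : Finset ℝ}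
    (hs : ∀ ω, X ω ∈ s) (α : ℝ → E) :
    ∫ ω, α (X ω) ∂P = ∑ x ∈ s, P.real (X ⁻¹' {x}) • α x := by
  have e : ∀ ω, α (X ω) = ∑ x ∈ s, (X ⁻¹' {x}).indicator (fun _ => α x) ω := by
    intro ω
    rw [Finset.sum_eq_single_of_mem (X ω) (hs ω)]
    · simp
    · intro b _ hb
      simp [Ne.symm hb]
  simp_rw [e]
  rw [integral_finsetSum]
  · refine Finset.sum_congr rfl fun x _ => ?_
    rw [integral_indicator_const _ (hX (measurableSet_singleton x))]
  · intro x _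
    exact (integrable_const _).indicator (hX (measurableSet_singleton x))

lemma integral_mul_comp_of_finite_range {mΩ : MeasurableSpace Ω} {P : Measure Ω} [IsProbabilityMeasure P]
    {X Y : Ω → ℝ} (hX : Measurable X) (hY : Measurable Y) {s t : Finset ℝ}
    (hs : ∀ ω, X ω ∈ s) (ht : ∀ ω, Y ω ∈ t) (α β : ℝ → ℂ) :
    ∫ ω, α (X ω) * β (Y ω) ∂P
      = ∑ x ∈ s, ∑ y ∈ t, P.real (X ⁻¹' {x} ∩ Y ⁻¹' {y}) • (α x * β y) := by
  have e : ∀ ω, α (X ω) * β (Y ω)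
      = ∑ x ∈ s, ∑ y ∈ t, (X ⁻¹' {x} ∩ Y ⁻¹' {y}).indicator (fun _ => α x * β y) ω := by
    intro ω
    rw [Finset.sum_eq_single_of_mem (X ω) (hs ω), Finset.sum_eq_single_of_mem (Y ω) (ht ω)]
    · simp
    · intro b _ hb
      simp [Ne.symm hb]
    · intro b _ hb
      refine Finset.sum_eq_zero fun y _ => ?_
      simp [Ne.symm hb]
  simp_rw [e]
  have hm : ∀ x y : ℝ, MeasurableSet (X ⁻¹' {x} ∩ Y ⁻¹' {y}) := fun x y =>
    (hX (measurableSet_singleton x)).inter (hY (measurableSet_singleton y))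
  rw [integral_finsetSum]
  · refine Finset.sum_congr rfl fun x _ => ?_
    rw [integral_finsetSum]
    · refine Finset.sum_congr rfl fun y _ => ?_
      rw [integral_indicator_const _ (hm x y)]
    · intro y _
      exact (integrable_const _).indicator (hm x y)
  · intro x _
    exact integrable_finsetSum _ fun y _ => (integrable_const _).indicator (hm x y)

/-- The covariance is a sum over atoms of `D(x, y) α(x) β(y)`. Splitting the bound on `|α β|` as
`f(x) + g(y)` leaves one free summation in each half, and the total variation of a row or column of
`D` is at most `2φ` times the mass of its atom. -/
lemma UniformlyMixing.covariance_le_of_finite_range {F G mΩ : MeasurableSpace Ω} {P : Measure Ω} [IsProbabilityMeasure P] (hF : F ≤ mΩ) (hG : G ≤ mΩ) {φ : ℝ}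
    (h : UniformlyMixing P F G φ) {X Y : Ω → ℝ} (hX : Measurable[F] X) (hY : Measurable[G] Y)
    {s t : Finset ℝ} (hs : ∀ ω, X ω ∈ s) (ht : ∀ ω, Y ω ∈ t) {α β : ℝ → ℂ} {f g : ℝ → ℝ}
    (hf : ∀ x, 0 ≤ f x) (hg : ∀ y, 0 ≤ g y) (hfg : ∀ x y, ‖α x * β y‖ ≤ f x + g y) :
    ‖∫ ω, α (X ω) * β (Y ω) ∂P - (∫ ω, α (X ω) ∂P) * ∫ ω, β (Y ω) ∂P‖
      ≤ 2 * φ * (∫ ω, f (X ω) ∂P + ∫ ω, g (Y ω) ∂P) := by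
  have hX' : Measurable X := hX.mono hF le_rfl
  have hY' : Measurable Y := hY.mono hG le_rfl
  rw [integral_mul_comp_of_finite_range hX' hY' hs ht, integral_comp_of_finite_range hX' hs α,
    integral_comp_of_finite_range hY' ht β, integral_comp_of_finite_range hX' hs f,
    integral_comp_of_finite_range hY' ht g, Finset.sum_mul_sum, ← Finset.sum_sub_distrib]
  simp_rw [← Finset.sum_sub_distrib]
  set D : ℝ → ℝ → ℝ := fun x y =>
    P.real (X ⁻¹' {x} ∩ Y ⁻¹' {y}) - P.real (X ⁻¹' {x}) * P.real (Y ⁻¹' {y}) with hD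
  have e : ∀ x y, P.real (X ⁻¹' {x} ∩ Y ⁻¹' {y}) • (α x * β y)
      - P.real (X ⁻¹' {x}) • α x * P.real (Y ⁻¹' {y}) • β y = (D x y : ℂ) * (α x * β y) := by
    intro x y
    simp only [hD, Complex.real_smul]
    push_cast
    ring
  simp_rw [e]
  calc ‖∑ x ∈ s, ∑ y ∈ t, (D x y : ℂ) * (α x * β y)‖
      ≤ ∑ x ∈ s, ∑ y ∈ t, |D x y| * (f x + g y) := by
        refine (norm_sum_le _ _).trans (Finset.sum_le_sum fun x _ => ?_)
        refine (norm_sum_le _ _).trans (Finset.sum_le_sum fun y _ => ?_)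
        rw [norm_mul, Complex.norm_real, Real.norm_eq_abs]
        exact mul_le_mul_of_nonneg_left (hfg x y) (abs_nonneg _)
    _ = ∑ x ∈ s, f x * ∑ y ∈ t, |D x y| + ∑ y ∈ t, g y * ∑ x ∈ s, |D x y| := by
        simp_rw [mul_add, Finset.sum_add_distrib, Finset.mul_sum]
        congr 1
        · exact Finset.sum_congr rfl fun x _ => Finset.sum_congr rfl fun y _ => mul_comm _ _
        · rw [Finset.sum_comm]
          exact Finset.sum_congr rfl fun x _ => Finset.sum_congr rfl fun y _ => mul_comm _ _
    _ ≤ ∑ x ∈ s, f x * (2 * φ * P.real (X ⁻¹' {x}))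
        + ∑ y ∈ t, g y * (2 * φ * P.real (Y ⁻¹' {y})) := by
        gcongr with x hx y hy
        · exact hf x
        · exact sum_abs_le_of_uniformlyMixing hF hG h.left (hX (measurableSet_singleton x)) hY t
        · exact hg y
        · have := sum_abs_le_of_uniformlyMixing hG hF h.symm.left
            (hY (measurableSet_singleton y)) hX s
          simpa only [hD, inter_comm, mul_comm] using this
    _ = _ := by
        simp only [smul_eq_mul, mul_add, Finset.mul_sum]
        congr 1 <;> exact Finset.sum_congr rfl fun _ _ => by ring

/-- The approximants are measurable for the small `σ`-algebra itself, so that mixing applies to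
them, and they keep the bound `C`, so that limits can be taken by dominated convergence. -/
lemma exists_finite_range_approx {F mΩ : MeasurableSpace Ω} {P : Measure Ω} [IsProbabilityMeasure P] {X : Ω → ℝ} (hX : AEStronglyMeasurable[F] X P) {C : ℝ}
    (hC : ∀ᵐ ω ∂P, |X ω| ≤ C) :
    ∃ Z : ℕ → Ω → ℝ, (∀ n, Measurable[F] (Z n)) ∧ (∀ n, ∃ s : Finset ℝ, ∀ ω, Z n ω ∈ s) ∧
      (∀ n ω, |Z n ω| ≤ C) ∧ ∀ᵐ ω ∂P, Tendsto (fun n => Z n ω) atTop (𝓝 (X ω)) := by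
  have hC0 : 0 ≤ C := by
    obtain ⟨ω, hω⟩ := hC.exists
    exact (abs_nonneg _).trans hω
  set Y := hX.mk X with hY
  have hYm : StronglyMeasurable[F] Y := hX.stronglyMeasurable_mk
  refine ⟨fun n => hYm.approxBounded C n,
    fun n => @SimpleFunc.measurable Ω ℝ F _ (hYm.approxBounded C n),
    fun n => ⟨@SimpleFunc.range Ω ℝ F (hYm.approxBounded C n),
      fun ω => @SimpleFunc.mem_range_self Ω ℝ F _ ω⟩,
    fun n ω => ?_, ?_⟩
  · simpa using hYm.norm_approxBounded_le hC0 n ω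
  · filter_upwards [hX.ae_eq_mk, hC] with ω h1 h2
    rw [h1] at h2 ⊢
    exact hYm.tendsto_approxBounded_of_norm_le (by simpa using h2)

/-- Covariance inequality for uniformly mixing `σ`-algebras. -/
lemma UniformlyMixing.covariance_le {F G mΩ : MeasurableSpace Ω} {P : Measure Ω} [IsProbabilityMeasure P] (hF : F ≤ mΩ) (hG : G ≤ mΩ) {φ : ℝ}
    (h : UniformlyMixing P F G φ) {X Y : Ω → ℝ} (hX : AEStronglyMeasurable[F] X P)
    (hY : AEStronglyMeasurable[G] Y P) {C : ℝ} (hXC : ∀ᵐ ω ∂P, |X ω| ≤ C)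
    (hYC : ∀ᵐ ω ∂P, |Y ω| ≤ C) {α β : ℝ → ℂ} {f g : ℝ → ℝ}
    (hα : Continuous α) (hβ : Continuous β) (hfc : Continuous f) (hgc : Continuous g)
    (hf : ∀ x, 0 ≤ f x) (hg : ∀ y, 0 ≤ g y) (hfg : ∀ x y, ‖α x * β y‖ ≤ f x + g y) :
    ‖∫ ω, α (X ω) * β (Y ω) ∂P - (∫ ω, α (X ω) ∂P) * ∫ ω, β (Y ω) ∂P‖
      ≤ 2 * φ * (∫ ω, f (X ω) ∂P + ∫ ω, g (Y ω) ∂P) := by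
  obtain ⟨U, hUm, hUr, hUC, hUt⟩ := exists_finite_range_approx hX hXC
  obtain ⟨V, hVm, hVr, hVC, hVt⟩ := exists_finite_range_approx hY hYC
  have hUm' : ∀ n, Measurable (U n) := fun n => (hUm n).mono hF le_rfl
  have hVm' : ∀ n, Measurable (V n) := fun n => (hVm n).mono hG le_rfl
  -- All approximants stay in the square `[-C, C]²`, on which a continuous `k` is bounded. The
  -- target `E` is left general because `α`, `β` are complex and `f`, `g` real.
  have lim : ∀ {E : Type} [NormedAddCommGroup E] [NormedSpace ℝ E] [MeasurableSpace E]
      [BorelSpace E] [SecondCountableTopology E] {k : ℝ × ℝ → E}, Continuous k →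
      Tendsto (fun n => ∫ ω, k (U n ω, V n ω) ∂P) atTop (𝓝 (∫ ω, k (X ω, Y ω) ∂P)) := by
    intro E _ _ _ _ _ k hk
    obtain ⟨B, hB⟩ := ((isCompact_Icc (a := -C) (b := C)).prod
      (isCompact_Icc (a := -C) (b := C))).exists_bound_of_continuousOn hk.continuousOn
    refine tendsto_integral_of_dominated_convergence (fun _ => B) ?_ (integrable_const _) ?_ ?_
    · exact fun n => (hk.measurable.comp ((hUm' n).prodMk (hVm' n))).aestronglyMeasurable
    · exact fun n => Eventually.of_forall fun ω =>
        hB _ ⟨abs_le.1 (hUC n ω), abs_le.1 (hVC n ω)⟩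
    · filter_upwards [hUt, hVt] with ω h1 h2
      exact (hk.tendsto _).comp (h1.prodMk_nhds h2)
  refine le_of_tendsto_of_tendsto
    (((lim (k := fun p => α p.1 * β p.2) (by fun_prop)).sub
      ((lim (k := fun p => α p.1) (by fun_prop)).mul
        (lim (k := fun p => β p.2) (by fun_prop)))).norm)
    (((lim (k := fun p => f p.1) (by fun_prop)).add
        (lim (k := fun p => g p.2) (by fun_prop))).const_mul (2 * φ))
    (Eventually.of_forall fun n => ?_)
  obtain ⟨s, hs⟩ := hUr n
  obtain ⟨t, ht⟩ := hVr n
  exact h.covariance_le_of_finite_range hF hG (hUm n) (hVm n) hs ht hf hg hfg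

/-- Real-valued form of the covariance inequality. -/
lemma UniformlyMixing.covariance_le_real {F G mΩ : MeasurableSpace Ω} {P : Measure Ω} [IsProbabilityMeasure P] (hF : F ≤ mΩ) (hG : G ≤ mΩ) {φ : ℝ}
    (h : UniformlyMixing P F G φ) {X Y : Ω → ℝ} (hX : AEStronglyMeasurable[F] X P)
    (hY : AEStronglyMeasurable[G] Y P) {C : ℝ} (hXC : ∀ᵐ ω ∂P, |X ω| ≤ C)
    (hYC : ∀ᵐ ω ∂P, |Y ω| ≤ C) {α β : ℝ → ℝ} {f g : ℝ → ℝ}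
    (hα : Continuous α) (hβ : Continuous β) (hfc : Continuous f) (hgc : Continuous g)
    (hf : ∀ x, 0 ≤ f x) (hg : ∀ y, 0 ≤ g y) (hfg : ∀ x y, |α x * β y| ≤ f x + g y) :
    |∫ ω, α (X ω) * β (Y ω) ∂P - (∫ ω, α (X ω) ∂P) * ∫ ω, β (Y ω) ∂P|
      ≤ 2 * φ * (∫ ω, f (X ω) ∂P + ∫ ω, g (Y ω) ∂P) := by
  have := h.covariance_le hF hG hX hY hXC hYC (α := fun x => (α x : ℂ)) (β := fun y => (β y : ℂ))
    (by fun_prop) (by fun_prop) hfc hgc hf hg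
    (fun x y => by rw [← Complex.ofReal_mul, Complex.norm_real]; exact hfg x y)
  simp_rw [← Complex.ofReal_mul] at this
  rw [integral_complex_ofReal, integral_complex_ofReal, integral_complex_ofReal, ← Complex.ofReal_mul,
    ← Complex.ofReal_sub, Complex.norm_real] at this
  exact this

end Covariance

/-! ### Mixing of the field between separated time intervals. -/

section SigmaField

variable {Ω : Type*} [mΩ : MeasurableSpace Ω] {P : Measure Ω} [IsProbabilityMeasure P]
  {c : ℝ≥0 → ℝ → Ω → ℝ}

lemma IsBoundedStationaryField.measurable_apply (hc : IsBoundedStationaryField P c) (t : ℝ≥0)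
    (x : ℝ) : Measurable (c t x) :=
  (hc.measurable x).comp (measurable_const.prodMk measurable_id)

lemma IsBoundedStationaryField.sigmaField_le (hc : IsBoundedStationaryField P c)
    (A : Set (ℝ≥0 × ℝ)) : sigmaField c A ≤ mΩ :=
  iSup₂_le fun p _ => (hc.measurable_apply p.1 p.2).comap_le

lemma measurable_sigmaField {A : Set (ℝ≥0 × ℝ)} {p : ℝ≥0 × ℝ} (hp : p ∈ A) :
    Measurable[sigmaField c A] (c p.1 p.2) := by
  rw [measurable_iff_comap_le]
  exact le_iSup₂_of_le (f := fun (p : ℝ≥0 × ℝ) (_ : p ∈ A) =>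
    MeasurableSpace.comap (c p.1 p.2) inferInstance) p hp le_rfl

lemma sigmaField_mono {A B : Set (ℝ≥0 × ℝ)} (h : A ⊆ B) : sigmaField c A ≤ sigmaField c B :=
  iSup₂_le fun _ hp => (measurable_sigmaField (h hp)).comap_le

lemma le_uniformMixing {A₁ A₂ : Set (ℝ≥0 × ℝ)} {r : ℝ}
    (hd : ∀ p ∈ A₁, ∀ q ∈ A₂, r ≤ √(((p.1 : ℝ) - q.1) ^ 2 + (p.2 - q.2) ^ 2)) {S₁ S₂ : Set Ω}
    (h1 : MeasurableSet[sigmaField c A₁] S₁) (h2 : MeasurableSet[sigmaField c A₂] S₂)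
    (h0 : P S₂ ≠ 0) : |(P[|S₂]).real S₁ - P.real S₁| ≤ uniformMixing P c r := by
  -- A real supremum dominates its members only if the set is bounded above; here `1` is a bound,
  -- both terms being probabilities.
  refine le_csSup ⟨1, ?_⟩ ⟨A₁, A₂, hd, S₁, S₂, h1, h2, h0, rfl⟩
  rintro a ⟨_, _, _, S, T, _, _, hT, rfl⟩
  have : IsProbabilityMeasure (P[|T]) := cond_isProbabilityMeasure hT
  have a1 : (P[|T]).real S ≤ 1 := measureReal_le_one
  have a2 : P.real S ≤ 1 := measureReal_le_one
  have a3 : 0 ≤ (P[|T]).real S := measureReal_nonneg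
  have a4 : 0 ≤ P.real S := measureReal_nonneg
  rw [abs_le]
  constructor <;> linarith

lemma uniformMixing_nonneg (r : ℝ) : 0 ≤ uniformMixing P c r := by
  refine Real.sSup_nonneg ?_
  rintro a ⟨_, _, _, _, _, _, _, _, rfl⟩
  exact abs_nonneg _

lemma abs_measure_inter_sub_le (hc : IsBoundedStationaryField P c) {A₁ A₂ : Set (ℝ≥0 × ℝ)} {r : ℝ}
    (hd : ∀ p ∈ A₁, ∀ q ∈ A₂, r ≤ √(((p.1 : ℝ) - q.1) ^ 2 + (p.2 - q.2) ^ 2)) {S₁ S₂ : Set Ω}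
    (h1 : MeasurableSet[sigmaField c A₁] S₁) (h2 : MeasurableSet[sigmaField c A₂] S₂) :
    |P.real (S₁ ∩ S₂) - P.real S₁ * P.real S₂| ≤ uniformMixing P c r * P.real S₂ := by
  by_cases h0 : P S₂ = 0
  · have e1 : P.real S₂ = 0 := by simp [Measure.real, h0]
    have e2 : P.real (S₁ ∩ S₂) = 0 := by
      simp [Measure.real, measure_mono_null inter_subset_right h0]
    simp [e1, e2]
  · have hpos : 0 < P.real S₂ := by
      rw [Measure.real]
      exact ENNReal.toReal_pos h0 (measure_ne_top _ _)
    have h := le_uniformMixing (P := P) hd h1 h2 h0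
    have e : (P[|S₂]).real S₁ = P.real (S₁ ∩ S₂) / P.real S₂ := by
      rw [Measure.real, cond_apply (hc.sigmaField_le _ _ h2), inter_comm, ENNReal.toReal_mul,
        ENNReal.toReal_inv, div_eq_inv_mul]
      rfl
    rw [e] at h
    have e2 : P.real (S₁ ∩ S₂) - P.real S₁ * P.real S₂
        = (P.real (S₁ ∩ S₂) / P.real S₂ - P.real S₁) * P.real S₂ := by
      field_simp
    rw [e2, abs_mul, abs_of_pos hpos]
    gcongr

/-- The `σ`-algebra generated by the field at times in `[a, b]`. -/
def timeSigma (c : ℝ≥0 → ℝ → Ω → ℝ) (a b : ℝ) : MeasurableSpace Ω :=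
  sigmaField c {p | a ≤ p.1 ∧ (p.1 : ℝ) ≤ b}

lemma IsBoundedStationaryField.timeSigma_le (hc : IsBoundedStationaryField P c) (a b : ℝ) :
    timeSigma c a b ≤ mΩ := hc.sigmaField_le _

lemma timeSigma_mono {a b a' b' : ℝ} (ha : a' ≤ a) (hb : b ≤ b') :
    timeSigma c a b ≤ timeSigma c a' b' :=
  sigmaField_mono fun _ hp => ⟨ha.trans hp.1, hp.2.trans hb⟩

lemma IsBoundedStationaryField.uniformlyMixing_timeSigma (hc : IsBoundedStationaryField P c)
    {a b a' b' : ℝ} (hb : b ≤ a') :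
    UniformlyMixing P (timeSigma c a b) (timeSigma c a' b') (uniformMixing P c (a' - b)) := by
  have hd : ∀ p ∈ {p : ℝ≥0 × ℝ | a ≤ p.1 ∧ (p.1 : ℝ) ≤ b},
      ∀ q ∈ {p : ℝ≥0 × ℝ | a' ≤ p.1 ∧ (p.1 : ℝ) ≤ b'},
      a' - b ≤ √(((p.1 : ℝ) - q.1) ^ 2 + (p.2 - q.2) ^ 2) := by
    rintro p ⟨_, hp⟩ q ⟨hq, _⟩
    refine Real.le_sqrt_of_sq_le ?_
    nlinarith [sq_nonneg (p.2 - q.2)]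
  refine ⟨fun A B hA hB => ?_, fun A B hA hB => abs_measure_inter_sub_le hc hd hA hB⟩
  -- The coefficient is a supremum over ordered pairs of sets, so exchanging the past and the future
  -- gives the bound with the other probability.
  rw [inter_comm, mul_comm (P.real A)]
  refine abs_measure_inter_sub_le hc (fun p hp q hq => ?_) hB hA
  convert hd q hq p hp using 2
  ring

end SigmaField

/-! ### Time integrals of adapted processes and their second moments. -/

section AdaptedProcess

instance isFiniteMeasure_restrict_uIoc (a b : ℝ) :
    IsFiniteMeasure ((volume : Measure ℝ).restrict (uIoc a b)) :=
  inferInstanceAs (IsFiniteMeasure ((volume : Measure ℝ).restrict (Ioc _ _)))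

variable {Ω : Type*} [mΩ : MeasurableSpace Ω]

/-- A bounded, centered, measurable process whose value at time `s` is a function of the field
`c` at time `s`. -/
structure IsFieldProcess (P : Measure Ω) (c : ℝ≥0 → ℝ → Ω → ℝ) (ξ : ℝ → Ω → ℝ) : Prop where
  measurable : Measurable (Function.uncurry ξ)
  bounded : ∃ M, ∀ s ω, |ξ s ω| ≤ M
  adapted : ∀ s, 0 ≤ s → Measurable[timeSigma c s s] (ξ s)
  centered : ∀ s, ∫ ω, ξ s ω ∂P = 0

variable {P : Measure Ω} [IsProbabilityMeasure P] {c : ℝ≥0 → ℝ → Ω → ℝ} {ξ : ℝ → Ω → ℝ}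

lemma IsFieldProcess.measurable_apply (h : IsFieldProcess P c ξ) (s : ℝ) : Measurable (ξ s) :=
  h.measurable.comp (measurable_const.prodMk measurable_id)

lemma IsFieldProcess.measurable_path (h : IsFieldProcess P c ξ) (ω : Ω) :
    Measurable (fun s => ξ s ω) :=
  h.measurable.comp (measurable_id.prodMk measurable_const)

lemma IsFieldProcess.intervalIntegrable (h : IsFieldProcess P c ξ) (ω : Ω) (a b : ℝ) :
    IntervalIntegrable (fun s => ξ s ω) volume a b := by
  obtain ⟨M, hM⟩ := h.bounded
  refine (intervalIntegrable_const (c := M)).mono_fun' (h.measurable_path ω).aestronglyMeasurable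
    (Eventually.of_forall fun s => hM s ω)

lemma IsFieldProcess.measurable_integral (h : IsFieldProcess P c ξ) (a b : ℝ) :
    Measurable (fun ω => ∫ s in a..b, ξ s ω) := by
  have : ∀ S : Set ℝ, Measurable (fun ω => ∫ s in S, ξ s ω) := fun S =>
    (StronglyMeasurable.integral_prod_left (μ := volume.restrict S)
      h.measurable.stronglyMeasurable).measurable
  exact (this _).sub (this _)

lemma IsFieldProcess.abs_integral_le {M : ℝ} (hM : ∀ s ω, |ξ s ω| ≤ M) (ω : Ω) (a b : ℝ) :
    |∫ s in a..b, ξ s ω| ≤ M * |b - a| := by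
  rw [← Real.norm_eq_abs]
  exact intervalIntegral.norm_integral_le_of_norm_le_const fun s _ => hM s ω

lemma IsFieldProcess.integrable_pow (h : IsFieldProcess P c ξ) (a b : ℝ) (p : ℕ) :
    Integrable (fun ω => |∫ s in a..b, ξ s ω| ^ p) P := by
  obtain ⟨M, hM⟩ := h.bounded
  refine Integrable.of_bound (C := (M * |b - a|) ^ p)
    ((h.measurable_integral a b).norm.pow_const p).aestronglyMeasurable ?_
  refine Eventually.of_forall fun ω => ?_
  rw [Real.norm_eq_abs, abs_of_nonneg (by positivity)]
  gcongr
  exact IsFieldProcess.abs_integral_le hM ω a b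

lemma IsFieldProcess.integrable_mul (h : IsFieldProcess P c ξ) (a b : ℝ) {Z : Ω → ℝ}
    (hZ : Integrable Z P) : Integrable (fun p : ℝ × Ω => ξ p.1 p.2 * Z p.2)
      ((volume.restrict (uIoc a b)).prod P) := by
  obtain ⟨M, hM⟩ := h.bounded
  refine Integrable.bdd_mul (c := M) (hZ.comp_snd _) h.measurable.aestronglyMeasurable
    (Eventually.of_forall fun p => hM p.1 p.2)

lemma IsFieldProcess.integral_integral_mul (h : IsFieldProcess P c ξ) (a b : ℝ) {Z : Ω → ℝ}
    (hZ : Integrable Z P) :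
    ∫ ω, (∫ s in a..b, ξ s ω) * Z ω ∂P = ∫ s in a..b, (∫ ω, ξ s ω * Z ω ∂P) := by
  rw [intervalIntegral_integral_swap (h.integrable_mul a b hZ)]
  simp_rw [intervalIntegral.integral_mul_const]

lemma IsFieldProcess.integral_integral (h : IsFieldProcess P c ξ) (a b : ℝ) :
    ∫ ω, (∫ s in a..b, ξ s ω) ∂P = 0 := by
  have := h.integral_integral_mul a b (Z := fun _ => (1 : ℝ)) (integrable_const _)
  simpa [h.centered] using this

lemma IsFieldProcess.integrable_integral (h : IsFieldProcess P c ξ) (a b : ℝ) :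
    Integrable (fun ω => ∫ s in a..b, ξ s ω) P := by
  obtain ⟨M, hM⟩ := h.bounded
  exact Integrable.of_bound (h.measurable_integral a b).aestronglyMeasurable _
    (Eventually.of_forall fun ω => IsFieldProcess.abs_integral_le hM ω a b)

/-- Time integrals over `[a, b]` are, up to null sets, functions of the field on `[a, b]`. -/
lemma IsFieldProcess.aestronglyMeasurable_integral (hc : IsBoundedStationaryField P c)
    (h : IsFieldProcess P c ξ) {a b : ℝ} (ha : 0 ≤ a) (hab : a ≤ b) :
    AEStronglyMeasurable[timeSigma c a b] (fun ω => ∫ s in a..b, ξ s ω) P := by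
  have hm : timeSigma c a b ≤ mΩ := hc.timeSigma_le a b
  obtain ⟨M, hM⟩ := h.bounded
  set X : Ω → ℝ := fun ω => ∫ s in a..b, ξ s ω with hX
  have hXi : Integrable X P := h.integrable_integral a b
  -- Joint measurability of `ξ` is known only for the full `σ`-algebra, so `X` is compared with its
  -- conditional expectation `Y`. The difference `X - Y` is orthogonal to `Y` and to every `ξ s`
  -- with `s ∈ [a, b]`, hence by Fubini to `X`. Therefore `E (X - Y)² = 0`.
  set Y : Ω → ℝ := P[X | timeSigma c a b] with hY
  have hYi : Integrable Y P := integrable_condExp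
  have hYb : ∀ᵐ ω ∂P, ‖Y ω‖ ≤ M * |b - a| := by
    have := ae_bdd_abs_condExp_of_ae_bdd_abs (m := timeSigma c a b) (μ := P) (f := X) (R := M * |b - a|)
      (Eventually.of_forall fun ω => IsFieldProcess.abs_integral_le hM ω a b)
    exact this
  have hZi : Integrable (X - Y) P := hXi.sub hYi
  have hZ : P[X - Y | timeSigma c a b] =ᵐ[P] 0 := by
    filter_upwards [condExp_sub hXi hYi (timeSigma c a b), condExp_condExp_of_le (le_refl (timeSigma c a b)) hm (f := X) (μ := P)]
      with ω h1 h2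
    rw [h1, Pi.sub_apply, hY, h2, sub_self, Pi.zero_apply]
  have orth : ∀ V : Ω → ℝ, AEStronglyMeasurable[timeSigma c a b] V P → Integrable (V * (X - Y)) P →
      ∫ ω, V ω * (X - Y) ω ∂P = 0 := by
    intro V hV hVi
    have h1 : P[V * (X - Y) | timeSigma c a b] =ᵐ[P] 0 := by
      filter_upwards [condExp_mul_of_aestronglyMeasurable_left hV hVi hZi, hZ] with ω h1 h2
      rw [h1, Pi.mul_apply, h2, Pi.zero_apply, mul_zero]
    have h2 := integral_condExp hm (f := V * (X - Y)) (μ := P)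
    rw [integral_congr_ae h1] at h2
    simpa using h2.symm
  have hX0 : ∫ ω, X ω * (X - Y) ω ∂P = 0 := by
    rw [hX, h.integral_integral_mul a b hZi]
    refine (intervalIntegral.integral_congr (g := fun _ => (0 : ℝ)) fun s hs => ?_).trans (by simp)
    rw [uIcc_of_le hab] at hs
    refine orth (ξ s) ?_ ?_
    · exact ((h.adapted s (ha.trans hs.1)).mono (timeSigma_mono hs.1 hs.2)
        le_rfl).stronglyMeasurable.aestronglyMeasurable
    · exact hZi.bdd_mul (h.measurable_apply s).aestronglyMeasurable
        (Eventually.of_forall fun ω => hM s ω)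
  have hY0 : ∫ ω, Y ω * (X - Y) ω ∂P = 0 :=
    orth Y stronglyMeasurable_condExp.aestronglyMeasurable
      (hZi.bdd_mul hYi.aestronglyMeasurable hYb)
  have hsq : ∫ ω, (X - Y) ω ^ 2 ∂P = 0 := by
    have e : ∀ ω, (X - Y) ω ^ 2 = X ω * (X - Y) ω - Y ω * (X - Y) ω := fun ω => by
      simp only [Pi.sub_apply]; ring
    simp_rw [e]
    rw [integral_sub, hX0, hY0, sub_zero]
    · exact hZi.bdd_mul hXi.aestronglyMeasurable
        (Eventually.of_forall fun ω => IsFieldProcess.abs_integral_le hM ω a b)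
    · exact hZi.bdd_mul hYi.aestronglyMeasurable hYb
  have hsi : Integrable (fun ω => (X - Y) ω ^ 2) P := by
    simp_rw [sq]
    refine hZi.bdd_mul (c := M * |b - a| + M * |b - a|) hZi.aestronglyMeasurable ?_
    filter_upwards [hYb] with ω hω
    exact (norm_sub_le _ _).trans (add_le_add (IsFieldProcess.abs_integral_le hM ω a b) hω)
  rw [integral_eq_zero_iff_of_nonneg (fun ω => sq_nonneg _) hsi] at hsq
  refine ⟨Y, stronglyMeasurable_condExp, ?_⟩
  filter_upwards [hsq] with ω hω
  have : (X - Y) ω = 0 := by simpa using hω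
  simpa [sub_eq_zero] using this

lemma integrable_inv_one_add_abs_sq : Integrable (fun r : ℝ => 1 / (1 + |r|) ^ 2) := by
  have := integrable_one_add_norm (E := ℝ) (μ := volume) (r := 2) (by simp)
  refine this.congr (Eventually.of_forall fun r => ?_)
  simp only [Real.norm_eq_abs]
  rw [Real.rpow_neg (by positivity), one_div]
  norm_cast

/-- Jensen's inequality for the normalized Lebesgue measure on `(a, b]`. -/
lemma abs_integral_pow_le {f : ℝ → ℝ} {a b : ℝ} (hab : a ≤ b)
    (hf : IntervalIntegrable f volume a b) {p : ℕ} (hp : 1 ≤ p)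
    (hfp : IntervalIntegrable (fun s => |f s| ^ p) volume a b) :
    |∫ s in a..b, f s| ^ p ≤ (b - a) ^ (p - 1) * ∫ s in a..b, |f s| ^ p := by
  rcases hab.eq_or_lt with rfl | hlt
  · simp [show p ≠ 0 by omega]
  have hpos : 0 < b - a := sub_pos.2 hlt
  have hv : (volume (Ioc a b)).toReal = b - a := by
    rw [Real.volume_Ioc, ENNReal.toReal_ofReal hpos.le]
  have hne : volume (Ioc a b) ≠ 0 := by rw [Real.volume_Ioc]; simpa using hpos
  have hnt : volume (Ioc a b) ≠ ∞ := by rw [Real.volume_Ioc]; simp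
  rw [intervalIntegrable_iff_integrableOn_Ioc_of_le hab] at hf hfp
  have key := (convexOn_pow p (𝕜 := ℝ)).map_set_average_le (μ := volume) (t := Ioc a b)
    (f := fun s => |f s|) (by fun_prop) isClosed_Ici hne hnt
    (Eventually.of_forall fun s => abs_nonneg (f s)) hf.abs hfp
  simp only [setAverage_eq, smul_eq_mul, measureReal_def, hv] at key
  rw [← intervalIntegral.integral_of_le hab] at key
  have h1 : |∫ s in a..b, f s| ≤ ∫ s in a..b, |f s| :=
    intervalIntegral.abs_integral_le_integral_abs hab
  have h2 : ∫ s in Ioc a b, |f s| ^ p = ∫ s in a..b, |f s| ^ p := by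
    rw [intervalIntegral.integral_of_le hab]
  simp only [h2] at key
  rw [mul_pow, inv_pow, inv_mul_le_iff₀ (by positivity)] at key
  calc |∫ s in a..b, f s| ^ p ≤ (∫ s in a..b, |f s|) ^ p := by gcongr
    _ ≤ _ := key
    _ = _ := by
      obtain ⟨k, rfl⟩ : ∃ k, p = k + 1 := ⟨p - 1, by omega⟩
      rw [Nat.add_sub_cancel, pow_succ]
      field_simp

/-- Jensen and Fubini, without mixing. The crude growth `T^p` is good enough for gaps and for
intervals of bounded length. -/
lemma IsFieldProcess.moment_le_length_pow (h : IsFieldProcess P c ξ) {p : ℕ} (hp : 1 ≤ p)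
    {β : ℝ} (hβ : ∀ s, 0 ≤ s → ∫ ω, |ξ s ω| ^ p ∂P ≤ β) {a T : ℝ} (ha : 0 ≤ a) (hT : 0 ≤ T) :
    ∫ ω, |∫ s in a..a + T, ξ s ω| ^ p ∂P ≤ T ^ p * β := by
  obtain ⟨M, hM⟩ := h.bounded
  have hbd : ∀ q : ℝ × Ω, ‖|ξ q.1 q.2| ^ p‖ ≤ M ^ p := fun q => by
    rw [Real.norm_eq_abs, abs_of_nonneg (by positivity)]
    gcongr
    exact hM _ _
  have hmeas : Measurable (fun q : ℝ × Ω => |ξ q.1 q.2| ^ p) := h.measurable.norm.pow_const p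
  have hint : Integrable (fun q : ℝ × Ω => |ξ q.1 q.2| ^ p)
      ((volume.restrict (uIoc a (a + T))).prod P) := by
    refine Integrable.of_bound hmeas.aestronglyMeasurable (M ^ p) (Eventually.of_forall hbd)
  have hfp : ∀ ω, IntervalIntegrable (fun s => |ξ s ω| ^ p) volume a (a + T) := fun ω =>
    (intervalIntegrable_const (c := M ^ p)).mono_fun'
      (hmeas.comp (measurable_id.prodMk measurable_const)).aestronglyMeasurable
      (Eventually.of_forall fun s => hbd (s, ω))
  have hle : a ≤ a + T := by linarith
  calc ∫ ω, |∫ s in a..a + T, ξ s ω| ^ p ∂P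
      ≤ ∫ ω, T ^ (p - 1) * (∫ s in a..a + T, |ξ s ω| ^ p) ∂P := by
        refine integral_mono (h.integrable_pow a (a + T) p) ?_ fun ω => ?_
        · refine Integrable.const_mul ?_ _
          have := hint.integral_prod_right
          simp only [intervalIntegral.integral_of_le hle]
          rwa [uIoc_of_le hle] at this
        · have := abs_integral_pow_le hle (h.intervalIntegrable ω a (a + T)) hp (hfp ω)
          simpa using this
    _ = T ^ (p - 1) * ∫ s in a..a + T, (∫ ω, |ξ s ω| ^ p ∂P) := by
        rw [integral_const_mul, intervalIntegral_integral_swap hint]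
    _ ≤ T ^ (p - 1) * ∫ s in a..a + T, β := by
        gcongr
        refine intervalIntegral.integral_mono_on hle ?_ intervalIntegrable_const
          fun s hs => hβ s (ha.trans hs.1)
        rw [intervalIntegrable_iff_integrableOn_Ioc_of_le hle]
        have := hint.integral_prod_left
        rwa [uIoc_of_le hle] at this
    _ = T ^ p * β := by
        obtain ⟨k, rfl⟩ : ∃ k, p = k + 1 := ⟨p - 1, by omega⟩
        simp [pow_succ, mul_assoc]

/-- The covariance inequality with `|xy| ≤ x²/2 + y²/2`; centering removes the product of the means.
-/
lemma IsFieldProcess.abs_correlation_le (hc : IsBoundedStationaryField P c)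
    {η : ℝ → Ω → ℝ} (h : IsFieldProcess P c ξ) (h' : IsFieldProcess P c η) {β : ℝ}
    (hβ : ∀ s, 0 ≤ s → ∫ ω, |ξ s ω| ^ 2 ∂P ≤ β) (hβ' : ∀ s, 0 ≤ s → ∫ ω, |η s ω| ^ 2 ∂P ≤ β)
    {s t : ℝ} (hs : 0 ≤ s) (ht : 0 ≤ t) :
    |∫ ω, ξ s ω * η t ω ∂P| ≤ 2 * uniformMixing P c |s - t| * β := by
  obtain ⟨M, hM⟩ := h.bounded
  obtain ⟨M', hM'⟩ := h'.bounded
  have key : ∀ {φ : ℝ}, 0 ≤ φ → UniformlyMixing P (timeSigma c s s) (timeSigma c t t) φ →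
      |∫ ω, ξ s ω * η t ω ∂P| ≤ 2 * φ * β := by
    intro φ hφ hmix
    have := hmix.covariance_le_real (hc.timeSigma_le _ _) (hc.timeSigma_le _ _)
      (h.adapted s hs).stronglyMeasurable.aestronglyMeasurable
      (h'.adapted t ht).stronglyMeasurable.aestronglyMeasurable (C := max M M')
      (Eventually.of_forall fun ω => (hM s ω).trans (le_max_left _ _))
      (Eventually.of_forall fun ω => (hM' t ω).trans (le_max_right _ _))
      (α := id) (β := id) (f := fun x => |x| ^ 2 / 2) (g := fun x => |x| ^ 2 / 2)
      continuous_id continuous_id (by fun_prop) (by fun_prop) (fun x => by positivity)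
      (fun x => by positivity) (fun x y => by
        rw [abs_mul, id, id]
        nlinarith [sq_nonneg (|x| - |y|)])
    simp only [id, h.centered, zero_mul, sub_zero] at this
    refine this.trans ?_
    rw [integral_div, integral_div]
    have h1 := hβ s hs
    have h2 := hβ' t ht
    gcongr
    linarith
  rcases le_total s t with hst | hst
  · have e : |s - t| = t - s := by rw [abs_sub_comm]; exact abs_of_nonneg (sub_nonneg.2 hst)
    rw [e]
    exact key (uniformMixing_nonneg (P := P) _) (hc.uniformlyMixing_timeSigma hst)
  · have e : |s - t| = s - t := abs_of_nonneg (sub_nonneg.2 hst)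
    rw [e]
    exact key (uniformMixing_nonneg (P := P) _) (hc.uniformlyMixing_timeSigma hst).symm

/-- With `X` the time integral, `E X² = ∫ E[ξ_s X] ds`, and each `E[ξ_s X]` is an integral of
correlations dominated by a multiple of `(1 + |t - s|)⁻²`. Its bound is independent of `T`, so the
second moment grows linearly. -/
lemma IsFieldProcess.second_moment_le (hc : IsBoundedStationaryField P c)
    (h : IsFieldProcess P c ξ) {K : ℝ}
    (hK : ∀ r, 0 ≤ r → uniformMixing P c r ≤ K / (1 + r) ^ 2) {β : ℝ}
    (hβ : ∀ s, 0 ≤ s → ∫ ω, |ξ s ω| ^ 2 ∂P ≤ β) {a T : ℝ} (ha : 0 ≤ a) (hT : 0 ≤ T) :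
    ∫ ω, |∫ s in a..a + T, ξ s ω| ^ 2 ∂P ≤ 2 * K * (∫ r : ℝ, 1 / (1 + |r|) ^ 2) * β * T := by
  have hle : a ≤ a + T := by linarith
  have hβ0 : 0 ≤ β := le_trans (by positivity) (hβ 0 le_rfl)
  have hK0 : 0 ≤ K := by
    have := (uniformMixing_nonneg (P := P) (c := c) 0).trans (hK 0 le_rfl)
    simpa using this
  set J := ∫ r : ℝ, 1 / (1 + |r|) ^ 2 with hJ
  have hcor : ∀ s, 0 ≤ s → ∀ t, 0 ≤ t →
      |∫ ω, ξ t ω * ξ s ω ∂P| ≤ 2 * K * β * (1 / (1 + |t - s|) ^ 2) := fun s hs t ht => by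
    refine (h.abs_correlation_le hc h hβ hβ ht hs).trans ?_
    have := hK |t - s| (abs_nonneg _)
    calc 2 * uniformMixing P c |t - s| * β ≤ 2 * (K / (1 + |t - s|) ^ 2) * β := by gcongr
      _ = _ := by ring
  have hinner : ∀ s ∈ Icc a (a + T), |∫ ω, ξ s ω * (∫ t in a..a + T, ξ t ω) ∂P|
      ≤ 2 * K * β * J := by
    intro s hs
    have hs0 := ha.trans hs.1
    have e : ∫ ω, ξ s ω * (∫ t in a..a + T, ξ t ω) ∂P
        = ∫ t in a..a + T, ∫ ω, ξ t ω * ξ s ω ∂P := by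
      obtain ⟨M, hM⟩ := h.bounded
      rw [← h.integral_integral_mul a (a + T) (Z := ξ s)
        (Integrable.of_bound (h.measurable_apply s).aestronglyMeasurable M
          (Eventually.of_forall fun ω => hM s ω))]
      exact integral_congr_ae (Eventually.of_forall fun ω => mul_comm _ _)
    have hi : Integrable (fun t : ℝ => 2 * K * β * (1 / (1 + |t - s|) ^ 2)) :=
      (integrable_inv_one_add_abs_sq.comp_sub_right s).const_mul _
    rw [e]
    calc |∫ t in a..a + T, ∫ ω, ξ t ω * ξ s ω ∂P|
        ≤ ∫ t in a..a + T, 2 * K * β * (1 / (1 + |t - s|) ^ 2) := by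
          rw [← Real.norm_eq_abs]
          refine intervalIntegral.norm_integral_le_of_norm_le hle
            (Eventually.of_forall fun t ht => ?_) hi.intervalIntegrable
          exact hcor s hs0 t (ha.trans ht.1.le)
      _ ≤ ∫ t : ℝ, 2 * K * β * (1 / (1 + |t - s|) ^ 2) := by
          rw [intervalIntegral.integral_of_le hle]
          exact setIntegral_le_integral hi (Eventually.of_forall fun t => by positivity)
      _ = 2 * K * β * J := by
          rw [integral_const_mul, integral_sub_right_eq_self (fun r : ℝ => 1 / (1 + |r|) ^ 2) s]
  have e : ∫ ω, |∫ s in a..a + T, ξ s ω| ^ 2 ∂P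
      = ∫ s in a..a + T, ∫ ω, ξ s ω * (∫ t in a..a + T, ξ t ω) ∂P := by
    rw [← h.integral_integral_mul a (a + T) (h.integrable_integral a (a + T))]
    exact integral_congr_ae (Eventually.of_forall fun ω => by simp only [sq_abs]; ring)
  rw [e]
  refine (le_abs_self _).trans ?_
  have := intervalIntegral.norm_integral_le_of_norm_le_const (a := a) (b := a + T)
    (C := 2 * K * β * J) (f := fun s => ∫ ω, ξ s ω * (∫ t in a..a + T, ξ t ω) ∂P)
    (fun s hs => hinner s (by rw [uIoc_of_le hle] at hs; exact ⟨hs.1.le, hs.2⟩))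
  rw [add_sub_cancel_left, abs_of_nonneg hT] at this
  calc _ ≤ _ := this
    _ = _ := by ring

end AdaptedProcess

/-! ### Moment inequality of arbitrary order by interval doubling. -/

section Moments

variable {Ω : Type*} [mΩ : MeasurableSpace Ω] {P : Measure Ω} [IsProbabilityMeasure P]
  {c : ℝ≥0 → ℝ → Ω → ℝ} {ξ : ℝ → Ω → ℝ}

lemma pow_mul_pow_sub_le_add {x y : ℝ} (hx : 0 ≤ x) (hy : 0 ≤ y) {p j : ℕ} (hj : j ≤ p) :
    x ^ j * y ^ (p - j) ≤ x ^ p + y ^ p := by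
  rcases le_total x y with h | h
  · calc x ^ j * y ^ (p - j) ≤ y ^ j * y ^ (p - j) := by gcongr
      _ = y ^ p := by rw [← pow_add]; congr 1; omega
      _ ≤ _ := le_add_of_nonneg_left (by positivity)
  · calc x ^ j * y ^ (p - j) ≤ x ^ j * x ^ (p - j) := by gcongr
      _ = x ^ p := by rw [← pow_add]; congr 1; omega
      _ ≤ _ := le_add_of_nonneg_right (by positivity)

/-- The coefficient of `x^p` can be made as close to `1` as desired, at the expense of that of
`y^p`. In the doubling step `x` is the main part and `y` the gap. -/
lemma add_pow_le_of_pos {x y δ : ℝ} (hx : 0 ≤ x) (hy : 0 ≤ y) (hδ : 0 < δ) (p : ℕ) :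
    (x + y) ^ p ≤ (1 + δ) ^ p * x ^ p + (1 + 1 / δ) ^ p * y ^ p := by
  rcases le_total y (δ * x) with h | h
  · calc (x + y) ^ p ≤ ((1 + δ) * x) ^ p := by gcongr; linarith
      _ = (1 + δ) ^ p * x ^ p := mul_pow _ _ _
      _ ≤ _ := le_add_of_nonneg_right (by positivity)
  · calc (x + y) ^ p ≤ ((1 + 1 / δ) * y) ^ p := by
          have : x ≤ 1 / δ * y := by rw [one_div, inv_mul_eq_div, le_div_iff₀ hδ]; linarith
          gcongr; linarith
      _ = (1 + 1 / δ) ^ p * y ^ p := mul_pow _ _ _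
      _ ≤ _ := le_add_of_nonneg_left (by positivity)

/-- One doubling step for the sum of two separated integrals. -/
lemma IsFieldProcess.moment_add_le (hc : IsBoundedStationaryField P c)
    (h : IsFieldProcess P c ξ) {p : ℕ} (hp : 1 ≤ p) {a T L m R : ℝ} (ha : 0 ≤ a) (hT : 0 ≤ T)
    (hL : 0 ≤ L) (hR : 0 ≤ R)
    (h1 : ∫ ω, |∫ s in a..a + T, ξ s ω| ^ p ∂P ≤ m)
    (h2 : ∫ ω, |∫ s in (a + T + L)..(a + T + L + T), ξ s ω| ^ p ∂P ≤ m)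
    (h3 : ∀ j, 1 ≤ j → j < p → (∫ ω, |∫ s in a..a + T, ξ s ω| ^ j ∂P) *
      ∫ ω, |∫ s in (a + T + L)..(a + T + L + T), ξ s ω| ^ (p - j) ∂P ≤ R) :
    ∫ ω, (|∫ s in a..a + T, ξ s ω| + |∫ s in (a + T + L)..(a + T + L + T), ξ s ω|) ^ p ∂P
      ≤ (2 + 2 ^ (p + 2) * uniformMixing P c L) * m + 2 ^ p * R := by
  set X : Ω → ℝ := fun ω => ∫ s in a..a + T, ξ s ω with hX
  set Y : Ω → ℝ := fun ω => ∫ s in (a + T + L)..(a + T + L + T), ξ s ω with hY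
  set φ := uniformMixing P c L with hφ
  have hφ0 : 0 ≤ φ := uniformMixing_nonneg (P := P) L
  have hm0 : 0 ≤ m := le_trans (by positivity) h1
  obtain ⟨M, hM⟩ := h.bounded
  have hXb : ∀ ω, |X ω| ≤ M * |T| := fun ω => by
    have := IsFieldProcess.abs_integral_le hM ω a (a + T)
    rwa [add_sub_cancel_left] at this
  have hYb : ∀ ω, |Y ω| ≤ M * |T| := fun ω => by
    have := IsFieldProcess.abs_integral_le hM ω (a + T + L) (a + T + L + T)
    rwa [add_sub_cancel_left] at this
  have hXm : Measurable X := h.measurable_integral _ _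
  have hYm : Measurable Y := h.measurable_integral _ _
  have hmix : UniformlyMixing P (timeSigma c a (a + T)) (timeSigma c (a + T + L) (a + T + L + T))
      φ := by
    have := hc.uniformlyMixing_timeSigma (a := a) (b := a + T) (a' := a + T + L)
      (b' := a + T + L + T) (by linarith)
    rwa [add_sub_cancel_left] at this
  -- Since `|x|^j |y|^(p-j) ≤ |x|^p + |y|^p`, the decoupling error is itself a multiple of the
  -- `p`-th moment bound `m`.
  have hcov : ∀ j, j ≤ p → ∫ ω, |X ω| ^ j * |Y ω| ^ (p - j) ∂P
      ≤ (∫ ω, |X ω| ^ j ∂P) * (∫ ω, |Y ω| ^ (p - j) ∂P) + 4 * φ * m := by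
    intro j hj
    have := hmix.covariance_le_real (hc.timeSigma_le _ _) (hc.timeSigma_le _ _)
      (h.aestronglyMeasurable_integral hc ha (by linarith))
      (h.aestronglyMeasurable_integral hc (by linarith) (by linarith))
      (Eventually.of_forall hXb) (Eventually.of_forall hYb)
      (α := fun x => |x| ^ j) (β := fun x => |x| ^ (p - j)) (f := fun x => |x| ^ p)
      (g := fun x => |x| ^ p) (by fun_prop) (by fun_prop) (by fun_prop) (by fun_prop)
      (fun x => by positivity) (fun x => by positivity) (fun x y => by
        rw [abs_of_nonneg (by positivity)]
        exact pow_mul_pow_sub_le_add (abs_nonneg _) (abs_nonneg _) hj)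
    have h4 := (abs_le.1 this).2
    have h5 : 2 * φ * (∫ ω, |X ω| ^ p ∂P + ∫ ω, |Y ω| ^ p ∂P) ≤ 2 * φ * (m + m) := by gcongr
    linarith
  have hint : ∀ j, Integrable (fun ω => |X ω| ^ j * |Y ω| ^ (p - j) * (p.choose j : ℝ)) P := by
    intro j
    refine Integrable.mul_const ?_ _
    refine Integrable.of_bound (C := (M * |T|) ^ j * (M * |T|) ^ (p - j))
      ((hXm.norm.pow_const _).mul (hYm.norm.pow_const _)).aestronglyMeasurable
      (Eventually.of_forall fun ω => ?_)
    have h6 : 0 ≤ M * |T| := (abs_nonneg _).trans (hXb ω)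
    rw [Real.norm_eq_abs, abs_of_nonneg (by positivity)]
    gcongr
    · exact hXb ω
    · exact hYb ω
  -- The two pure powers `j = 0` and `j = p` give `2m`; the mixed terms are weighted by binomial
  -- coefficients, whose sum is at most `2 ^ p`.
  have hterm : ∀ j ∈ Finset.range (p + 1), ∫ ω, |X ω| ^ j * |Y ω| ^ (p - j) * (p.choose j : ℝ) ∂P
      ≤ ((if j = 0 then m else 0) + (if j = p then m else 0)) + (R + 4 * φ * m) * p.choose j := by
    intro j hj
    have hj' : j ≤ p := by simpa [Nat.lt_succ_iff] using hj
    rw [integral_mul_const]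
    rcases Nat.eq_zero_or_pos j with rfl | hj0
    · have : ∫ ω, |Y ω| ^ p ∂P ≤ m := h2
      simp only [pow_zero, one_mul, Nat.sub_zero, Nat.choose_zero_right, Nat.cast_one, mul_one,
        if_true]
      have h0 : 0 ≤ (if 0 = p then m else 0) := by split_ifs <;> simp [hm0]
      have : 0 ≤ 4 * φ * m := by positivity
      linarith
    · rcases hj'.eq_or_lt with rfl | hlt
      · have : ∫ ω, |X ω| ^ j ∂P ≤ m := h1
        simp only [pow_zero, mul_one, Nat.sub_self, Nat.choose_self, Nat.cast_one,
          if_true, hj0.ne', if_false, zero_add]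
        have : 0 ≤ 4 * φ * m := by positivity
        linarith
      · simp only [hj0.ne', hlt.ne, if_false, zero_add]
        gcongr
        exact (hcov j hj').trans (by gcongr; exact h3 j hj0 hlt)
  calc ∫ ω, (|X ω| + |Y ω|) ^ p ∂P
      = ∑ j ∈ Finset.range (p + 1), ∫ ω, |X ω| ^ j * |Y ω| ^ (p - j) * (p.choose j : ℝ) ∂P := by
        simp_rw [add_pow]
        exact integral_finsetSum _ fun j _ => hint j
    _ ≤ _ := Finset.sum_le_sum hterm
    _ = 2 * m + (R + 4 * φ * m) * 2 ^ p := by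
        rw [Finset.sum_add_distrib, Finset.sum_add_distrib, ← Finset.mul_sum, ← Nat.cast_sum,
          Nat.sum_range_choose]
        simp
        ring
    _ = _ := by ring

/-- The integral over a long interval, compared with the integrals over its two halves. -/
lemma IsFieldProcess.moment_doubling (hc : IsBoundedStationaryField P c)
    (h : IsFieldProcess P c ξ) {p : ℕ} (hp : 1 ≤ p) {a T L m R β δ : ℝ} (ha : 0 ≤ a) (hT : 0 ≤ T)
    (hL : 0 ≤ L) (hR : 0 ≤ R) (hδ : 0 < δ)
    (hβ : ∀ s, 0 ≤ s → ∫ ω, |ξ s ω| ^ p ∂P ≤ β)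
    (hm : ∀ a, 0 ≤ a → ∫ ω, |∫ s in a..a + T, ξ s ω| ^ p ∂P ≤ m)
    (h3 : ∀ j, 1 ≤ j → j < p → ∀ a, 0 ≤ a → ∀ a', 0 ≤ a' →
      (∫ ω, |∫ s in a..a + T, ξ s ω| ^ j ∂P) * ∫ ω, |∫ s in a'..a' + T, ξ s ω| ^ (p - j) ∂P ≤ R) :
    ∫ ω, |∫ s in a..a + (2 * T + L), ξ s ω| ^ p ∂P
      ≤ (1 + δ) ^ p * ((2 + 2 ^ (p + 2) * uniformMixing P c L) * m + 2 ^ p * R)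
        + (1 + 1 / δ) ^ p * (L ^ p * β) := by
  have hsplit : ∀ ω, |∫ s in a..a + (2 * T + L), ξ s ω| ^ p
      ≤ (1 + δ) ^ p * (|∫ s in a..a + T, ξ s ω| + |∫ s in (a + T + L)..(a + T + L + T), ξ s ω|) ^ p
        + (1 + 1 / δ) ^ p * |∫ s in (a + T)..(a + T + L), ξ s ω| ^ p := by
    intro ω
    refine le_trans ?_ (add_pow_le_of_pos (by positivity) (by positivity) hδ p)
    have e : ∫ s in a..a + (2 * T + L), ξ s ω = (∫ s in a..a + T, ξ s ω)
        + (∫ s in (a + T)..(a + T + L), ξ s ω) + ∫ s in (a + T + L)..(a + T + L + T), ξ s ω := by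
      rw [intervalIntegral.integral_add_adjacent_intervals (h.intervalIntegrable ω _ _)
        (h.intervalIntegrable ω _ _), intervalIntegral.integral_add_adjacent_intervals
        (h.intervalIntegrable ω _ _) (h.intervalIntegrable ω _ _)]
      congr 1
      ring
    rw [e]
    gcongr
    refine (abs_add_le _ _).trans ?_
    have := abs_add_le (∫ s in a..a + T, ξ s ω) (∫ s in (a + T)..(a + T + L), ξ s ω)
    linarith
  obtain ⟨M, hM⟩ := h.bounded
  have hi : Integrable (fun ω => (|∫ s in a..a + T, ξ s ω|
      + |∫ s in (a + T + L)..(a + T + L + T), ξ s ω|) ^ p) P := by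
    refine Integrable.of_bound (C := (M * |a + T - a| + M * |a + T + L + T - (a + T + L)|) ^ p)
      (((h.measurable_integral _ _).norm.add
        (h.measurable_integral _ _).norm).pow_const p).aestronglyMeasurable
      (Eventually.of_forall fun ω => ?_)
    rw [Real.norm_eq_abs, abs_of_nonneg (by positivity)]
    gcongr
    · exact IsFieldProcess.abs_integral_le hM ω _ _
    · exact IsFieldProcess.abs_integral_le hM ω _ _
  calc ∫ ω, |∫ s in a..a + (2 * T + L), ξ s ω| ^ p ∂P
      ≤ ∫ ω, ((1 + δ) ^ p * (|∫ s in a..a + T, ξ s ω|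
          + |∫ s in (a + T + L)..(a + T + L + T), ξ s ω|) ^ p
        + (1 + 1 / δ) ^ p * |∫ s in (a + T)..(a + T + L), ξ s ω| ^ p) ∂P :=
        integral_mono (h.integrable_pow _ _ p)
          ((hi.const_mul _).add ((h.integrable_pow _ _ p).const_mul _)) hsplit
    _ = (1 + δ) ^ p * (∫ ω, (|∫ s in a..a + T, ξ s ω|
          + |∫ s in (a + T + L)..(a + T + L + T), ξ s ω|) ^ p ∂P)
        + (1 + 1 / δ) ^ p * ∫ ω, |∫ s in (a + T)..(a + T + L), ξ s ω| ^ p ∂P := by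
        rw [integral_add (hi.const_mul _) ((h.integrable_pow _ _ p).const_mul _),
          integral_const_mul, integral_const_mul]
    _ ≤ _ := by
        gcongr
        · exact h.moment_add_le hc hp ha hT hL hR (hm a ha) (hm _ (by positivity))
            fun j hj hjp => h3 j hj hjp a ha _ (by positivity)
        · exact h.moment_le_length_pow hp hβ (by positivity) hL

lemma integral_abs_le_of_sq_le {X : Ω → ℝ} (hX : Integrable X P)
    (hX2 : Integrable (fun ω => |X ω| ^ 2) P) {r : ℝ} (hr : 0 ≤ r)
    (h : ∫ ω, |X ω| ^ 2 ∂P ≤ r ^ 2) : ∫ ω, |X ω| ∂P ≤ r := by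
  have h1 := (convexOn_pow 2 (𝕜 := ℝ)).map_integral_le (μ := P) (f := fun ω => |X ω|)
    (by fun_prop) isClosed_Ici (Eventually.of_forall fun ω => abs_nonneg (X ω)) hX.abs hX2
  exact le_of_sq_le_sq (h1.trans h) hr

/-- **Moment inequality** for time integrals of mixing processes. -/
lemma exists_moment_bound (hc : IsBoundedStationaryField P c) {K : ℝ}
    (hK : ∀ r, 0 ≤ r → uniformMixing P c r ≤ K / (1 + r) ^ 2) (p : ℕ) (hp : 1 ≤ p) :
    ∃ C : ℝ, 0 ≤ C ∧ ∀ ξ : ℝ → Ω → ℝ, IsFieldProcess P c ξ → ∀ b : ℝ, 0 ≤ b →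
      (∀ j, 1 ≤ j → j ≤ max p 2 → ∀ s, 0 ≤ s → ∫ ω, |ξ s ω| ^ j ∂P ≤ b ^ j) →
      ∀ a, 0 ≤ a → ∀ T, 0 ≤ T → ∫ ω, |∫ s in a..a + T, ξ s ω| ^ p ∂P ≤ C * b ^ p * √T ^ p := by
  have hK0 : 0 ≤ K := by
    have := (uniformMixing_nonneg (P := P) (c := c) 0).trans (hK 0 le_rfl)
    simpa using this
  set J := ∫ r : ℝ, 1 / (1 + |r|) ^ 2 with hJ
  have hJ0 : 0 ≤ J := integral_nonneg fun r => by positivity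
  have two : ∀ ξ : ℝ → Ω → ℝ, IsFieldProcess P c ξ → ∀ b : ℝ, 0 ≤ b →
      (∀ s, 0 ≤ s → ∫ ω, |ξ s ω| ^ 2 ∂P ≤ b ^ 2) →
      ∀ a, 0 ≤ a → ∀ T, 0 ≤ T →
        ∫ ω, |∫ s in a..a + T, ξ s ω| ^ 2 ∂P ≤ 2 * K * J * b ^ 2 * √T ^ 2 := by
    intro ξ h b hb hβ a ha T hT
    rw [Real.sq_sqrt hT]
    exact h.second_moment_le hc hK hβ ha hT
  induction p using Nat.strong_induction_on with
  | _ p ih =>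
  -- The first moment is deduced from the second, which is why moments of `ξ` up to `max p 2` are
  -- assumed.
  rcases (by omega : p = 1 ∨ p = 2 ∨ 3 ≤ p) with rfl | rfl | hp3
  · refine ⟨√(2 * K * J), Real.sqrt_nonneg _, fun ξ h b hb hβ a ha T hT => ?_⟩
    simp only [pow_one]
    refine integral_abs_le_of_sq_le (h.integrable_integral _ _) (h.integrable_pow _ _ 2)
      (by positivity) ?_
    rw [mul_pow, mul_pow, Real.sq_sqrt (by positivity)]
    exact two ξ h b hb (hβ 2 (by norm_num) (by norm_num)) a ha T hT
  · exact ⟨2 * K * J, by positivity, fun ξ h b hb hβ =>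
      two ξ h b hb (hβ 2 (by norm_num) (by norm_num))⟩
  · choose! C hC0 hC using ih
    set D := ∑ j ∈ Finset.range p, |C j| with hD
    have hD0 : 0 ≤ D := Finset.sum_nonneg fun _ _ => abs_nonneg _
    have hCD : ∀ j, j < p → C j ≤ D := fun j hj =>
      (le_abs_self _).trans (Finset.single_le_sum (f := fun j => |C j|)
        (fun _ _ => abs_nonneg _) (Finset.mem_range.2 hj))
    -- The doubling factor is made at most `11/10 · (2 + 1/5) ≤ 5/2`: `δ` provides the `11/10`, and
    -- the gap `L` makes `2^(p+2) α_um(L) ≤ 1/5`. For `p ≥ 3` the target `√T ^ p` gains a factor of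
    -- at least `28/10` on doubling, leaving the contraction factor `25/28`.
    obtain ⟨δ, hδ, hδp⟩ : ∃ δ : ℝ, 0 < δ ∧ (1 + δ) ^ p ≤ 11 / 10 := by
      have hcont : ContinuousAt (fun δ : ℝ => (1 + δ) ^ p) 0 := by fun_prop
      have hev : ∀ᶠ δ in 𝓝 (0 : ℝ), (1 + δ) ^ p < 11 / 10 :=
        hcont.eventually_lt continuousAt_const (by norm_num)
      obtain ⟨ε, hε, hball⟩ := Metric.eventually_nhds_iff.1 hev
      refine ⟨ε / 2, by positivity, (hball ?_).le⟩
      rw [Real.dist_eq, sub_zero, abs_of_pos (by positivity)]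
      linarith
    set τ : ℝ := 1 / 5 / 2 ^ (p + 2) with hτ
    have hτ0 : 0 < τ := by positivity
    set L := K / τ with hLdef
    have hL : 0 ≤ L := by positivity
    have hφL : uniformMixing P c L ≤ τ := by
      refine (hK L hL).trans ?_
      rw [div_le_iff₀ (by positivity)]
      have : τ * L = K := by rw [hLdef]; field_simp
      nlinarith [mul_nonneg hτ0.le (sq_nonneg L)]
    have hφ0 : 0 ≤ uniformMixing P c L := uniformMixing_nonneg (P := P) L
    have hcoef : (1 + δ) ^ p * (2 + 2 ^ (p + 2) * uniformMixing P c L) ≤ 5 / 2 := by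
      have h1 : 2 ^ (p + 2) * uniformMixing P c L ≤ 1 / 5 := by
        calc 2 ^ (p + 2) * uniformMixing P c L ≤ 2 ^ (p + 2) * τ := by gcongr
          _ = 1 / 5 := by rw [hτ]; field_simp
      calc (1 + δ) ^ p * (2 + 2 ^ (p + 2) * uniformMixing P c L) ≤ 11 / 10 * (2 + 1 / 5) := by
            gcongr
        _ ≤ 5 / 2 := by norm_num
    set A : ℝ := 11 / 10 * (2 ^ p * (D * D)) + (1 + 1 / δ) ^ p * L ^ p with hA
    have hA0 : 0 ≤ A := by positivity
    -- The first entry handles intervals of length at most `L + 1`; the second gives `25/28 * B + A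
    -- ≤ B`.
    set B : ℝ := max (√(L + 1) ^ p) (10 * A) with hB
    have hB0 : 0 ≤ B := le_max_of_le_left (by positivity)
    refine ⟨B, hB0, fun ξ h b hb hβ => ?_⟩
    rw [max_eq_left (by omega : 2 ≤ p)] at hβ
    -- Here `n` counts the doublings needed to reach the length `U` from `L + 1`.
    have main : ∀ n : ℕ, ∀ a, 0 ≤ a → ∀ U, 0 ≤ U → U ≤ 2 ^ n * (L + 1) →
        ∫ ω, |∫ s in a..a + U, ξ s ω| ^ p ∂P ≤ B * b ^ p * √U ^ p := by
      have base : ∀ a, 0 ≤ a → ∀ U, 0 ≤ U → U ≤ L + 1 →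
          ∫ ω, |∫ s in a..a + U, ξ s ω| ^ p ∂P ≤ B * b ^ p * √U ^ p := by
        intro a ha U hU hUL
        refine (h.moment_le_length_pow hp (hβ p hp le_rfl) ha hU).trans ?_
        calc U ^ p * b ^ p = √U ^ p * b ^ p * √U ^ p := by
              nth_rewrite 1 [← Real.mul_self_sqrt hU]
              rw [mul_pow]; ring
          _ ≤ B * b ^ p * √U ^ p := by
              gcongr
              refine le_trans ?_ (le_max_left _ _)
              gcongr
      intro n
      induction n with
      | zero => simpa using base
      | succ n ihn =>
        intro a ha U hU hUn
        rcases le_or_gt U (L + 1) with hle | hgt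
        · exact base a ha U hU hle
        -- Two halves of length `T` and the gap fill `[a, a + U]` exactly. As `U > L + 1 ≥ 1`, the
        -- constant contribution of the gap is absorbed into `√U ^ p`.
        set T := (U - L) / 2 with hTdef
        have hT : 0 ≤ T := by rw [hTdef]; linarith
        have hTU : T ≤ U / 2 := by rw [hTdef]; linarith
        have hTn : T ≤ 2 ^ n * (L + 1) := by rw [pow_succ] at hUn; linarith
        have eU : 2 * T + L = U := by rw [hTdef]; ring
        have hstep := h.moment_doubling hc hp ha hT hL (m := B * b ^ p * √T ^ p)
          (R := D * D * b ^ p * √T ^ p) (by positivity) hδ (hβ p hp le_rfl)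
          (fun a ha => ihn a ha T hT hTn) (fun j hj hjp a ha a' ha' => by
            have e1 := hC j hjp hj ξ h b hb
              (fun i hi hi2 => hβ i hi (hi2.trans (max_le hjp.le (by omega)))) a ha T hT
            have e2 := hC (p - j) (by omega) (by omega) ξ h b hb
              (fun i hi hi2 => hβ i hi (hi2.trans (max_le (by omega) (by omega)))) a' ha' T hT
            calc _ ≤ (C j * b ^ j * √T ^ j) * (C (p - j) * b ^ (p - j) * √T ^ (p - j)) := by
                  refine mul_le_mul e1 e2 (by positivity) ?_
                  have := hC0 j hjp hj
                  positivity
              _ ≤ (D * b ^ j * √T ^ j) * (D * b ^ (p - j) * √T ^ (p - j)) := by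
                  have := hC0 (p - j) (by omega) (by omega)
                  gcongr
                  · exact hCD j hjp
                  · exact hCD _ (by omega)
              _ = D * D * (b ^ j * b ^ (p - j)) * (√T ^ j * √T ^ (p - j)) := by ring
              _ = _ := by rw [← pow_add, ← pow_add, Nat.add_sub_cancel' hjp.le])
        rw [eU] at hstep
        refine hstep.trans ?_
        have hsT : √T ^ p ≤ 10 / 28 * √U ^ p := by
          have h28 : (28 / 10 : ℝ) ≤ √2 ^ p := by
            have h14 : (7 / 5 : ℝ) ≤ √2 := Real.le_sqrt_of_sq_le (by norm_num)
            have h1 : (√2) ^ 3 = 2 * √2 := by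
              rw [pow_succ, Real.sq_sqrt (by norm_num)]
            calc (28 / 10 : ℝ) ≤ √2 ^ 3 := by rw [h1]; linarith
              _ ≤ √2 ^ p := pow_le_pow_right₀ (by linarith) hp3
          calc √T ^ p = √T ^ p * (28 / 10) * (10 / 28) := by ring
            _ ≤ √T ^ p * √2 ^ p * (10 / 28) := by gcongr
            _ = √(T * 2) ^ p * (10 / 28) := by rw [Real.sqrt_mul hT, mul_pow]
            _ ≤ √U ^ p * (10 / 28) := by gcongr; linarith
            _ = _ := mul_comm _ _
        have hTU' : √T ^ p ≤ √U ^ p := by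
          gcongr
          linarith
        have hU1 : 1 ≤ √U ^ p := one_le_pow₀ (Real.one_le_sqrt.2 (by linarith))
        have hb0 : 0 ≤ b ^ p := by positivity
        calc (1 + δ) ^ p * ((2 + 2 ^ (p + 2) * uniformMixing P c L) * (B * b ^ p * √T ^ p)
                + 2 ^ p * (D * D * b ^ p * √T ^ p)) + (1 + 1 / δ) ^ p * (L ^ p * b ^ p)
            = ((1 + δ) ^ p * (2 + 2 ^ (p + 2) * uniformMixing P c L)) * (B * b ^ p * √T ^ p)
                + (1 + δ) ^ p * (2 ^ p * (D * D)) * b ^ p * √T ^ p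
                + (1 + 1 / δ) ^ p * L ^ p * b ^ p * 1 := by ring
          _ ≤ 5 / 2 * (B * b ^ p * (10 / 28 * √U ^ p))
                + 11 / 10 * (2 ^ p * (D * D)) * b ^ p * √U ^ p
                + (1 + 1 / δ) ^ p * L ^ p * b ^ p * √U ^ p := by gcongr
          _ = (25 / 28 * B + A) * (b ^ p * √U ^ p) := by rw [hA]; ring
          _ ≤ B * (b ^ p * √U ^ p) := by
              gcongr
              have := le_max_right (√(L + 1) ^ p) (10 * A)
              rw [← hB] at this
              linarith
          _ = _ := by ring
    intro a ha T hT
    obtain ⟨n, hn⟩ := pow_unbounded_of_one_lt T (one_lt_two (α := ℝ))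
    refine main n a ha T hT (hn.le.trans ?_)
    exact le_mul_of_one_le_right (by positivity) (by linarith)

end Moments

/-! ### Linear combinations of the field and their asymptotic variance. -/

section Combination

variable {Ω : Type*} [mΩ : MeasurableSpace Ω] {P : Measure Ω} [IsProbabilityMeasure P]
  {c : ℝ≥0 → ℝ → Ω → ℝ} {ι : Type*} [Fintype ι]

/-- The linear combination `∑ uⱼ c(s, xⱼ)`. -/
def fieldComb (c : ℝ≥0 → ℝ → Ω → ℝ) (u x : ι → ℝ) (s : ℝ) (ω : Ω) : ℝ :=
  ∑ j, u j * c s.toNNReal (x j) ω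

lemma IsBoundedStationaryField.measurable_uncurry (hc : IsBoundedStationaryField P c) (x : ℝ) :
    Measurable (fun p : ℝ × Ω => c p.1.toNNReal x p.2) :=
  (hc.measurable x).comp ((measurable_real_toNNReal.comp measurable_fst).prodMk measurable_snd)

lemma IsBoundedStationaryField.integrable (hc : IsBoundedStationaryField P c) (t : ℝ≥0) (x : ℝ) :
    Integrable (c t x) P := by
  obtain ⟨M, hM⟩ := hc.bounded
  exact Integrable.of_bound (hc.measurable_apply t x).aestronglyMeasurable M
    (Eventually.of_forall fun ω => hM t x ω)

lemma IsBoundedStationaryField.isFieldProcess_fieldComb (hc : IsBoundedStationaryField P c)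
    (u x : ι → ℝ) : IsFieldProcess P c (fieldComb c u x) where
  measurable := by
    unfold fieldComb Function.uncurry
    exact Finset.measurable_sum _ fun j _ => (hc.measurable_uncurry (x j)).const_mul (u j)
  bounded := by
    obtain ⟨M, hM⟩ := hc.bounded
    refine ⟨∑ j, |u j| * M, fun s ω => ?_⟩
    refine (Finset.abs_sum_le_sum_abs _ _).trans (Finset.sum_le_sum fun j _ => ?_)
    rw [abs_mul]
    gcongr
    exact hM _ _ _
  adapted s hs := by
    unfold fieldComb
    refine Finset.measurable_sum _ fun j _ => ?_
    refine Measurable.const_mul ?_ (u j)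
    exact measurable_sigmaField (p := (s.toNNReal, x j)) (by simp [hs])
  centered s := by
    unfold fieldComb
    rw [integral_finsetSum _ fun j _ => (hc.integrable _ _).const_mul _]
    simp [integral_const_mul, hc.centered]

lemma IsBoundedStationaryField.isFieldProcess_apply (hc : IsBoundedStationaryField P c)
    (x : ℝ) : IsFieldProcess P c (fun s => c s.toNNReal x) := by
  convert hc.isFieldProcess_fieldComb (fun _ : Unit => 1) (fun _ => x) using 1
  ext s ω
  simp [fieldComb]

lemma IsBoundedStationaryField.isFieldProcess_sub (hc : IsBoundedStationaryField P c)
    (x y : ℝ) : IsFieldProcess P c (fun s ω => c s.toNNReal x ω - c s.toNNReal y ω) := by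
  convert hc.isFieldProcess_fieldComb ![1, -1] ![x, y] using 1
  ext s ω
  simp [fieldComb, Fin.sum_univ_two, sub_eq_add_neg]

lemma IsBoundedStationaryField.integral_comp_shift (hc : IsBoundedStationaryField P c) {n : ℕ}
    {g : (Fin n → ℝ) → ℝ} (hg : Measurable g) (t : Fin n → ℝ≥0) (x : Fin n → ℝ) (h : ℝ≥0) (k : ℝ) :
    ∫ ω, g (fun i => c (t i + h) (x i + k) ω) ∂P = ∫ ω, g (fun i => c (t i) (x i) ω) ∂P := by
  have e : ∀ (t : Fin n → ℝ≥0) (x : Fin n → ℝ), ∫ ω, g (fun i => c (t i) (x i) ω) ∂P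
      = ∫ v, g v ∂(P.map (fun ω i => c (t i) (x i) ω)) := fun t x =>
    (integral_map (measurable_pi_lambda _ fun i => hc.measurable_apply _ _).aemeasurable
      hg.aestronglyMeasurable).symm
  rw [e t x, ← hc.stationary n t x h k, ← e (fun i => t i + h) (fun i => x i + k)]

/-- `correlation` is normalized so that the earlier time is `0`; a shift by `min s t` in time and
`x` in space restores the given points. -/
lemma IsBoundedStationaryField.integral_mul_eq_correlation (hc : IsBoundedStationaryField P c)
    {s t : ℝ} (hs : 0 ≤ s) (ht : 0 ≤ t) (x y : ℝ) :
    ∫ ω, c s.toNNReal x ω * c t.toNNReal y ω ∂P = correlation P c (t - s) (y - x) := by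
  have := hc.integral_comp_shift (g := fun v => v 0 * v 1)
    ((measurable_pi_apply 0).mul (measurable_pi_apply 1))
    ![(-(t - s)).toNNReal, (t - s).toNNReal] ![0, y - x] (min s t).toNNReal x
  simp only [Matrix.cons_val_zero, Matrix.cons_val_one, zero_add, sub_add_cancel] at this
  rw [correlation, ← this]
  have e1 : (-(t - s)).toNNReal + (min s t).toNNReal = s.toNNReal := by
    rcases le_total s t with h | h
    · rw [min_eq_left h, Real.toNNReal_of_nonpos (by linarith), zero_add]
    · rw [min_eq_right h, ← Real.toNNReal_add (by linarith) ht]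
      congr 1; ring
  have e2 : (t - s).toNNReal + (min s t).toNNReal = t.toNNReal := by
    rcases le_total s t with h | h
    · rw [min_eq_left h, ← Real.toNNReal_add (by linarith) hs]
      congr 1; ring
    · rw [min_eq_right h, Real.toNNReal_of_nonpos (by linarith), zero_add]
  rw [e1, e2]

/-- Both sides are the expectation of one product, with its factors taken in the two possible
orders. -/
lemma IsBoundedStationaryField.correlation_neg (hc : IsBoundedStationaryField P c) (r x : ℝ) :
    correlation P c (-r) (-x) = correlation P c r x := by
  have h1 := hc.integral_mul_eq_correlation (s := max r 0) (t := max (-r) 0) (le_max_right _ _)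
    (le_max_right _ _) x 0
  have h2 := hc.integral_mul_eq_correlation (s := max (-r) 0) (t := max r 0) (le_max_right _ _)
    (le_max_right _ _) 0 x
  have e : max r 0 - max (-r) 0 = r := by
    rcases le_total r 0 with h | h
    · rw [max_eq_right h, max_eq_left (by linarith)]; ring
    · rw [max_eq_left h, max_eq_right (by linarith)]; ring
  rw [e, sub_zero] at h2
  rw [zero_sub, ← neg_sub (max r 0), e] at h1
  rw [← h1, ← h2]
  exact integral_congr_ae (Eventually.of_forall fun ω => mul_comm _ _)

lemma IsBoundedStationaryField.integratedCorrelation_neg (hc : IsBoundedStationaryField P c)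
    (x : ℝ) : integratedCorrelation P c (-x) = integratedCorrelation P c x := by
  unfold integratedCorrelation
  rw [← integral_neg_eq_self]
  simp_rw [hc.correlation_neg]

lemma IsBoundedStationaryField.integrable_correlation (hc : IsBoundedStationaryField P c) {K : ℝ}
    (hK : ∀ r, 0 ≤ r → uniformMixing P c r ≤ K / (1 + r) ^ 2) (x : ℝ) :
    Integrable (fun r : ℝ => correlation P c r x) := by
  obtain ⟨M, hM⟩ := hc.bounded
  have hmeas : Measurable (fun r : ℝ => correlation P c r x) := by
    refine (StronglyMeasurable.integral_prod_right (f := fun (r : ℝ) ω =>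
      c (-r).toNNReal 0 ω * c r.toNNReal x ω) (Measurable.stronglyMeasurable ?_)).measurable
    exact ((hc.measurable_uncurry 0).comp (measurable_fst.neg.prodMk measurable_snd)).mul
      (hc.measurable_uncurry x)
  have hb : ∀ y s : ℝ, 0 ≤ s → ∫ ω, |c s.toNNReal y ω| ^ 2 ∂P ≤ M ^ 2 := fun y s _ => by
    have : ∀ ω, |c s.toNNReal y ω| ^ 2 ≤ M ^ 2 := fun ω => by
      gcongr
      exact hM _ _ _
    calc ∫ ω, |c s.toNNReal y ω| ^ 2 ∂P ≤ ∫ _, M ^ 2 ∂P := by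
          refine integral_mono ?_ (integrable_const _) this
          refine Integrable.of_bound
            ((hc.measurable_apply _ _).norm.pow_const 2).aestronglyMeasurable (M ^ 2)
            (Eventually.of_forall fun ω => ?_)
          rw [Real.norm_eq_abs, abs_of_nonneg (by positivity)]
          exact this ω
      _ = M ^ 2 := by simp
  refine ((integrable_inv_one_add_abs_sq.const_mul (2 * K * M ^ 2)).mono' hmeas.aestronglyMeasurable
    (Eventually.of_forall fun r => ?_))
  have h1 := (hc.isFieldProcess_apply 0).abs_correlation_le hc (hc.isFieldProcess_apply x)
    (hb 0) (hb x) (le_max_right (-r) 0) (le_max_right r 0)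
  rw [hc.integral_mul_eq_correlation (le_max_right (-r) 0) (le_max_right r 0)] at h1
  have e : max r 0 - max (-r) 0 = r := by
    rcases le_total r 0 with h | h
    · rw [max_eq_right h, max_eq_left (by linarith)]; ring
    · rw [max_eq_left h, max_eq_right (by linarith)]; ring
  rw [abs_sub_comm, e, sub_zero] at h1
  have := hK |r| (abs_nonneg r)
  rw [Real.norm_eq_abs]
  calc |correlation P c r x| ≤ _ := h1
    _ ≤ 2 * (K / (1 + |r|) ^ 2) * M ^ 2 := by gcongr
    _ = _ := by ring

/-- `(1/T) ∫_0^T ∫_0^T f(t - s) dt ds`, after the substitution `s = T v`. -/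
noncomputable def squareAverage (f : ℝ → ℝ) (T : ℝ) : ℝ := ∫ v in (0 : ℝ)..1, ∫ r in (-(T * v))..(T - T * v), f r

/-- For `0 < v < 1` the interval `(-Tv, T(1 - v))` exhausts `ℝ`, and all inner integrals are
dominated by `∫ |f|`. -/
lemma tendsto_squareAverage {f : ℝ → ℝ} (hf : Integrable f) :
    Tendsto (squareAverage f) atTop (𝓝 (∫ r, f r)) := by
  have h1 : (∫ r, f r) = ∫ _ in (0 : ℝ)..1, ∫ r, f r := by simp
  rw [h1]
  refine intervalIntegral.tendsto_integral_filter_of_dominated_convergence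
    (fun _ => ∫ r, |f r|) ?_ ?_ intervalIntegrable_const ?_
  · refine Eventually.of_forall fun T => Continuous.aestronglyMeasurable ?_
    have hp : Continuous fun b => ∫ r in (0 : ℝ)..b, f r :=
      intervalIntegral.continuous_primitive (fun a b => hf.intervalIntegrable) 0
    have e : ∀ v, ∫ r in (-(T * v))..(T - T * v), f r
        = (∫ r in (0 : ℝ)..(T - T * v), f r) - ∫ r in (0 : ℝ)..(-(T * v)), f r := fun v =>
      (intervalIntegral.integral_interval_sub_left hf.intervalIntegrable
        hf.intervalIntegrable).symm
    simp_rw [e]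
    exact (hp.comp (by fun_prop)).sub (hp.comp (by fun_prop))
  · refine Eventually.of_forall fun T => Eventually.of_forall fun v _ => ?_
    refine intervalIntegral.norm_integral_le_integral_norm_uIoc.trans ?_
    exact setIntegral_le_integral hf.norm (Eventually.of_forall fun r => norm_nonneg _)
  · have h01 : ∀ᵐ v : ℝ, v ≠ 1 := by
      simp [ae_iff, measure_singleton]
    filter_upwards [h01] with v hv1 hv
    rw [uIoc_of_le zero_le_one] at hv
    have hv2 : v < 1 := lt_of_le_of_ne hv.2 hv1
    refine intervalIntegral_tendsto_integral hf ?_ ?_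
    · exact tendsto_neg_atTop_atBot.comp (tendsto_id.atTop_mul_const hv.1)
    · have : Tendsto (fun T : ℝ => T * (1 - v)) atTop atTop :=
        tendsto_id.atTop_mul_const (sub_pos.2 hv2)
      refine this.congr fun T => by ring

/-- The limit variance per unit of time of the linear combination with weights `u` at points
`x`. -/
noncomputable def limitVariance (P : Measure Ω) (c : ℝ≥0 → ℝ → Ω → ℝ) (u x : ι → ℝ) : ℝ :=
  ∑ i, ∑ j, u i * u j * integratedCorrelation P c (x j - x i)

lemma integral_fieldComb_mul (hc : IsBoundedStationaryField P c) (u x : ι → ℝ) {s t : ℝ}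
    (hs : 0 ≤ s) (ht : 0 ≤ t) :
    ∫ ω, fieldComb c u x s ω * fieldComb c u x t ω ∂P
      = ∑ i, ∑ j, u i * u j * correlation P c (t - s) (x j - x i) := by
  obtain ⟨M, hM⟩ := hc.bounded
  have hi : ∀ i j, Integrable (fun ω => u i * u j *
      (c s.toNNReal (x i) ω * c t.toNNReal (x j) ω)) P := fun i j =>
    ((hc.integrable _ _).bdd_mul (hc.measurable_apply _ _).aestronglyMeasurable
      (Eventually.of_forall fun ω => hM _ _ ω)).const_mul _
  have e : ∀ ω, fieldComb c u x s ω * fieldComb c u x t ω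
      = ∑ i, ∑ j, u i * u j * (c s.toNNReal (x i) ω * c t.toNNReal (x j) ω) := fun ω => by
    unfold fieldComb
    rw [Finset.sum_mul_sum]
    exact Finset.sum_congr rfl fun i _ => Finset.sum_congr rfl fun j _ => by ring
  simp_rw [e]
  rw [integral_finsetSum _ fun i _ => integrable_finsetSum _ fun j _ => hi i j]
  refine Finset.sum_congr rfl fun i _ => ?_
  rw [integral_finsetSum _ fun j _ => hi i j]
  refine Finset.sum_congr rfl fun j _ => ?_
  rw [integral_const_mul, hc.integral_mul_eq_correlation hs ht]

lemma intervalIntegral_sum_sum {f : ι → ι → ℝ → ℝ} {a b : ℝ}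
    (h : ∀ i j, IntervalIntegrable (f i j) volume a b) :
    ∫ s in a..b, ∑ i, ∑ j, f i j s = ∑ i, ∑ j, ∫ s in a..b, f i j s := by
  simp_rw [← Fintype.sum_prod_type']
  exact intervalIntegral.integral_finsetSum fun p _ => h p.1 p.2

/-- Fubini turns the variance into a double integral of `correlation P c (t - s)`; the substitutions
`r = t - s` and `s = a + T v` produce `squareAverage`. The identity is exact for each `T`, and its
right side is free of `a`. -/
lemma second_moment_fieldComb (hc : IsBoundedStationaryField P c) {K : ℝ}
    (hK : ∀ r, 0 ≤ r → uniformMixing P c r ≤ K / (1 + r) ^ 2) (u x : ι → ℝ) {a T : ℝ}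
    (ha : 0 ≤ a) (hT : 0 ≤ T) :
    ∫ ω, (∫ s in a..a + T, fieldComb c u x s ω) ^ 2 ∂P
      = T * ∑ i, ∑ j, u i * u j * squareAverage (fun r => correlation P c r (x j - x i)) T := by
  have h := hc.isFieldProcess_fieldComb u x
  have hle : a ≤ a + T := by linarith
  have hΦ : ∀ y, Integrable (fun r => correlation P c r y) := hc.integrable_correlation hK
  obtain ⟨M, hM⟩ := h.bounded
  have e1 : ∫ ω, (∫ s in a..a + T, fieldComb c u x s ω) ^ 2 ∂P
      = ∫ s in a..a + T, ∫ t in a..a + T,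
        ∑ i, ∑ j, u i * u j * correlation P c (t - s) (x j - x i) := by
    simp_rw [sq]
    rw [h.integral_integral_mul a (a + T) (h.integrable_integral a (a + T))]
    refine intervalIntegral.integral_congr fun s hs => ?_
    rw [uIcc_of_le hle] at hs
    have : ∫ ω, fieldComb c u x s ω * (∫ t in a..a + T, fieldComb c u x t ω) ∂P
        = ∫ ω, (∫ t in a..a + T, fieldComb c u x t ω) * fieldComb c u x s ω ∂P :=
      integral_congr_ae (Eventually.of_forall fun ω => mul_comm _ _)
    beta_reduce
    rw [this, h.integral_integral_mul a (a + T) (Integrable.of_bound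
      (h.measurable_apply s).aestronglyMeasurable M (Eventually.of_forall fun ω => hM s ω))]
    refine intervalIntegral.integral_congr fun t ht => ?_
    rw [uIcc_of_le hle] at ht
    beta_reduce
    rw [← integral_fieldComb_mul hc u x (ha.trans hs.1) (ha.trans ht.1)]
    exact integral_congr_ae (Eventually.of_forall fun ω => mul_comm _ _)
  have e2 : ∀ s, ∫ t in a..a + T, ∑ i, ∑ j, u i * u j * correlation P c (t - s) (x j - x i)
      = ∑ i, ∑ j, u i * u j * ∫ r in (a - s)..(a + T - s), correlation P c r (x j - x i) := by
    intro s
    have hi : ∀ i j, IntervalIntegrable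
        (fun t => u i * u j * correlation P c (t - s) (x j - x i)) volume a (a + T) := fun i j =>
      (((hΦ (x j - x i)).comp_sub_right s).const_mul _).intervalIntegrable
    rw [intervalIntegral_sum_sum hi]
    refine Finset.sum_congr rfl fun i _ => Finset.sum_congr rfl fun j _ => ?_
    rw [intervalIntegral.integral_const_mul,
      intervalIntegral.integral_comp_sub_right (fun r => correlation P c r (x j - x i))]
  have hcont : ∀ y, Continuous fun s => ∫ r in (a - s)..(a + T - s), correlation P c r y := by
    intro y
    have hp : Continuous fun b => ∫ r in (0 : ℝ)..b, correlation P c r y :=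
      intervalIntegral.continuous_primitive (fun a b => (hΦ y).intervalIntegrable) 0
    have e : ∀ s, ∫ r in (a - s)..(a + T - s), correlation P c r y
        = (∫ r in (0 : ℝ)..(a + T - s), correlation P c r y)
          - ∫ r in (0 : ℝ)..(a - s), correlation P c r y := fun v =>
      (intervalIntegral.integral_interval_sub_left (hΦ y).intervalIntegrable
        (hΦ y).intervalIntegrable).symm
    simp_rw [e]
    exact (hp.comp (by fun_prop)).sub (hp.comp (by fun_prop))
  have e3 : ∀ y, ∫ s in a..a + T, ∫ r in (a - s)..(a + T - s), correlation P c r y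
      = T * squareAverage (fun r => correlation P c r y) T := by
    intro y
    have := intervalIntegral.mul_integral_comp_add_mul (a := 0) (b := 1)
      (f := fun s => ∫ r in (a - s)..(a + T - s), correlation P c r y) T a
    simp only [mul_zero, add_zero, mul_one] at this
    rw [← this, squareAverage]
    congr 1
    refine intervalIntegral.integral_congr fun v _ => ?_
    beta_reduce
    congr 1 <;> ring
  rw [e1]
  simp_rw [e2]
  rw [intervalIntegral_sum_sum fun i j => ((hcont _).const_mul _).intervalIntegrable _ _]
  simp_rw [Finset.mul_sum]
  refine Finset.sum_congr rfl fun i _ => Finset.sum_congr rfl fun j _ => ?_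
  rw [intervalIntegral.integral_const_mul, e3]
  ring

lemma tendsto_variance_fieldComb (hc : IsBoundedStationaryField P c) {K : ℝ}
    (hK : ∀ r, 0 ≤ r → uniformMixing P c r ≤ K / (1 + r) ^ 2) (u x : ι → ℝ) :
    Tendsto (fun T => ∑ i, ∑ j, u i * u j *
      squareAverage (fun r => correlation P c r (x j - x i)) T) atTop
      (𝓝 (limitVariance P c u x)) :=
  tendsto_finsetSum _ fun _ _ => tendsto_finsetSum _ fun _ _ =>
    (tendsto_squareAverage (hc.integrable_correlation hK _)).const_mul _

/-- It is the limit of variances divided by the length of the time interval. -/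
lemma limitVariance_nonneg (hc : IsBoundedStationaryField P c) {K : ℝ}
    (hK : ∀ r, 0 ≤ r → uniformMixing P c r ≤ K / (1 + r) ^ 2) (u x : ι → ℝ) :
    0 ≤ limitVariance P c u x := by
  refine ge_of_tendsto (tendsto_variance_fieldComb hc hK u x) ?_
  filter_upwards [eventually_gt_atTop 0] with T hT
  have h := second_moment_fieldComb hc hK u x le_rfl hT.le
  have h0 : 0 ≤ ∫ ω, (∫ s in (0 : ℝ)..0 + T, fieldComb c u x s ω) ^ 2 ∂P :=
    integral_nonneg fun ω => sq_nonneg _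
  rw [h] at h0
  exact nonneg_of_mul_nonneg_right h0 hT

end Combination

/-! ### Elementary estimates for the complex exponential. -/

section ExpI

/-- `e^{iy}`. -/
noncomputable def expI (y : ℝ) : ℂ := Complex.exp (y * Complex.I)

lemma continuous_expI : Continuous expI := by unfold expI; fun_prop

lemma norm_expI (y : ℝ) : ‖expI y‖ = 1 := Complex.norm_exp_ofReal_mul_I y

lemma expI_add (x y : ℝ) : expI (x + y) = expI x * expI y := by
  unfold expI
  rw [← Complex.exp_add]
  push_cast
  ring_nf

lemma norm_expI_sub_le (x y : ℝ) : ‖expI x - expI y‖ ≤ |x - y| := by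
  have e : expI x - expI y = expI y * (expI (x - y) - 1) := by
    rw [mul_sub, ← expI_add, mul_one]
    congr 2
    ring
  rw [e, norm_mul, norm_expI, one_mul, expI, mul_comm]
  exact Real.norm_exp_I_mul_ofReal_sub_one_le

/-- Taylor's remainder for `|y| ≤ 1`. For `|y| ≥ 1` every term separately is at most a multiple of
`|y|³`, so the bound is global and only a third moment is needed later. -/
lemma norm_expI_sub_taylor_le (y : ℝ) :
    ‖expI y - (1 + y * Complex.I - (y ^ 2 / 2 : ℝ))‖ ≤ 4 * |y| ^ 3 := by
  rcases le_total |y| 1 with h | h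
  · have hn : ‖(y : ℂ) * Complex.I‖ = |y| := by simp
    have := Complex.exp_bound (x := y * Complex.I) (by rwa [hn]) (n := 3) (by norm_num)
    rw [hn] at this
    have e : ∑ m ∈ Finset.range 3, ((y : ℂ) * Complex.I) ^ m / (m.factorial : ℂ)
        = 1 + y * Complex.I - (y ^ 2 / 2 : ℝ) := by
      simp only [Finset.sum_range_succ, Finset.range_zero, Finset.sum_empty, pow_zero, pow_one,
        mul_pow, Complex.I_sq]
      norm_num [Nat.factorial]
      ring
    rw [e] at this
    refine this.trans ?_
    rw [mul_comm]
    gcongr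
    norm_num [Nat.factorial]
  · have h1 : ‖(1 + y * Complex.I - (y ^ 2 / 2 : ℝ) : ℂ)‖ ≤ 1 + |y| + y ^ 2 / 2 := by
      refine (norm_sub_le _ _).trans ?_
      gcongr
      · refine (norm_add_le _ _).trans ?_
        simp
      · rw [Complex.norm_real, Real.norm_eq_abs, abs_of_nonneg (by positivity)]
    have h2 : y ^ 2 = |y| ^ 2 := (sq_abs y).symm
    refine (norm_sub_le _ _).trans ?_
    rw [norm_expI]
    have h3 : |y| ≤ |y| ^ 3 := le_self_pow₀ h (by norm_num)
    have h4 : |y| ^ 2 ≤ |y| ^ 3 := pow_le_pow_right₀ h (by norm_num)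
    have h6 : (1 : ℝ) ≤ |y| ^ 3 := one_le_pow₀ h
    have h5 : 0 ≤ |y| := abs_nonneg y
    linarith

end ExpI

/-! ### Central limit theorem for increments, uniformly in the past. -/

section CentralLimit

variable {Ω : Type*} [mΩ : MeasurableSpace Ω] {P : Measure Ω} [IsProbabilityMeasure P]
  {c : ℝ≥0 → ℝ → Ω → ℝ} {ξ : ℝ → Ω → ℝ}

lemma integrable_expI {Z : Ω → ℝ} (hZ : AEMeasurable Z P) : Integrable (fun ω => expI (Z ω)) P :=
  Integrable.of_bound (continuous_expI.measurable.comp_aemeasurable hZ).aestronglyMeasurable 1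
    (Eventually.of_forall fun _ => (norm_expI _).le)

lemma norm_integral_expI_le (Z : Ω → ℝ) : ‖∫ ω, expI (Z ω) ∂P‖ ≤ 1 := by
  refine (norm_integral_le_of_norm_le_const
    (Eventually.of_forall fun ω => (norm_expI (Z ω)).le)).trans ?_
  simp

lemma norm_integral_expI_sub_le {X Y : Ω → ℝ} (hX : AEMeasurable X P) (hY : AEMeasurable Y P)
    {r : ℝ} (h : ∀ ω, |X ω - Y ω| ≤ r) :
    ‖∫ ω, expI (X ω) ∂P - ∫ ω, expI (Y ω) ∂P‖ ≤ r := by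
  rw [← integral_sub (integrable_expI hX) (integrable_expI hY)]
  refine (norm_integral_le_of_norm_le_const
    (Eventually.of_forall fun ω => (norm_expI_sub_le _ _).trans (h ω))).trans ?_
  simp

/-- `√ε ∫_{a/ε}^{b/ε} ξ(s) ds`. -/
noncomputable def scaledIncrement (ξ : ℝ → Ω → ℝ) (ε a b : ℝ) (ω : Ω) : ℝ :=
  √ε * ∫ s in (a / ε)..(b / ε), ξ s ω

lemma IsFieldProcess.measurable_scaledIncrement (h : IsFieldProcess P c ξ) (ε a b : ℝ) :
    Measurable (scaledIncrement ξ ε a b) :=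
  (h.measurable_integral _ _).const_mul _

lemma IsFieldProcess.scaledIncrement_add (h : IsFieldProcess P c ξ) (ε a b d : ℝ) (ω : Ω) :
    scaledIncrement ξ ε a b ω + scaledIncrement ξ ε b d ω = scaledIncrement ξ ε a d ω := by
  unfold scaledIncrement
  rw [← mul_add, intervalIntegral.integral_add_adjacent_intervals (h.intervalIntegrable ω _ _)
    (h.intervalIntegrable ω _ _)]

lemma IsFieldProcess.bounded_scaledIncrement (h : IsFieldProcess P c ξ) (ε a b : ℝ) :
    ∃ B, ∀ ω, |scaledIncrement ξ ε a b ω| ≤ B := by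
  obtain ⟨M, hM⟩ := h.bounded
  refine ⟨√ε * (M * |b / ε - a / ε|), fun ω => ?_⟩
  unfold scaledIncrement
  rw [abs_mul, abs_of_nonneg (Real.sqrt_nonneg _)]
  gcongr
  exact IsFieldProcess.abs_integral_le hM ω _ _

lemma IsFieldProcess.aestronglyMeasurable_scaledIncrement (hc : IsBoundedStationaryField P c)
    (h : IsFieldProcess P c ξ) {ε a b : ℝ} (hε : 0 < ε) (ha : 0 ≤ a) (hab : a ≤ b) :
    AEStronglyMeasurable[timeSigma c (a / ε) (b / ε)] (scaledIncrement ξ ε a b) P :=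
  (h.aestronglyMeasurable_integral hc (by positivity) (by gcongr)).const_mul _

/-- Decoupling of an increment from the past, at the cost of a gap of (unscaled) length `L`. -/
lemma IsFieldProcess.norm_decoupling_le (hc : IsBoundedStationaryField P c)
    (h : IsFieldProcess P c ξ) {M : ℝ} (hM : ∀ s ω, |ξ s ω| ≤ M) {ε a b L : ℝ} (hε : 0 < ε)
    (ha : 0 ≤ a) (hL : 0 ≤ L) (hab : a / ε + L ≤ b / ε) {Z : Ω → ℝ}
    (hZ : AEStronglyMeasurable[timeSigma c 0 (a / ε)] Z P) (hZb : ∃ B, ∀ ω, |Z ω| ≤ B) :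
    ‖∫ ω, expI (Z ω + scaledIncrement ξ ε a b ω) ∂P
        - (∫ ω, expI (Z ω) ∂P) * ∫ ω, expI (scaledIncrement ξ ε a b ω) ∂P‖
      ≤ 2 * (√ε * (M * L)) + 2 * uniformMixing P c L := by
  have ha' : 0 ≤ a / ε := by positivity
  obtain ⟨B, hB⟩ := hZb
  set D := scaledIncrement ξ ε a b with hD
  -- `V` is the increment without its first `L` units of unscaled time, hence separated from `Z`.
  -- Exchanging `D` for `V`, once jointly with `Z` and once alone, costs `√ε M L` each time.
  set V : Ω → ℝ := fun ω => √ε * ∫ s in (a / ε + L)..(b / ε), ξ s ω with hV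
  have hZm : AEMeasurable Z P := (hZ.mono (hc.timeSigma_le _ _)).aemeasurable
  have hDm : Measurable D := h.measurable_scaledIncrement ε a b
  have hVm : Measurable V := (h.measurable_integral _ _).const_mul _
  have hgap : ∀ ω, |D ω - V ω| ≤ √ε * (M * L) := by
    intro ω
    have e : D ω - V ω = √ε * ∫ s in (a / ε)..(a / ε + L), ξ s ω := by
      rw [hD, hV, scaledIncrement, ← mul_sub,
        ← intervalIntegral.integral_add_adjacent_intervals
          (h.intervalIntegrable ω (a / ε) (a / ε + L)) (h.intervalIntegrable ω _ (b / ε)),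
        add_sub_cancel_right]
    rw [e, abs_mul, abs_of_nonneg (Real.sqrt_nonneg _)]
    gcongr
    have := IsFieldProcess.abs_integral_le hM ω (a / ε) (a / ε + L)
    rwa [add_sub_cancel_left, abs_of_nonneg hL] at this
  have hmix : UniformlyMixing P (timeSigma c 0 (a / ε)) (timeSigma c (a / ε + L) (b / ε))
      (uniformMixing P c L) := by
    have := hc.uniformlyMixing_timeSigma (a := 0) (b := a / ε) (a' := a / ε + L)
      (b' := b / ε) (by linarith)
    rwa [add_sub_cancel_left] at this
  obtain ⟨B', hB'⟩ : ∃ B', ∀ ω, |V ω| ≤ B' := by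
    refine ⟨√ε * (M * |b / ε - (a / ε + L)|), fun ω => ?_⟩
    rw [hV, abs_mul, abs_of_nonneg (Real.sqrt_nonneg _)]
    gcongr
    exact IsFieldProcess.abs_integral_le hM ω _ _
  have hcov := hmix.covariance_le (hc.timeSigma_le _ _) (hc.timeSigma_le _ _) hZ
    ((h.aestronglyMeasurable_integral hc (by positivity) hab).const_mul (√ε))
    (Eventually.of_forall fun ω => (hB ω).trans (le_max_left B B'))
    (Eventually.of_forall fun ω => (hB' ω).trans (le_max_right B B'))
    (α := expI) (β := expI) (f := fun _ => 1) (g := fun _ => 0) continuous_expI continuous_expI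
    continuous_const continuous_const (fun _ => zero_le_one) (fun _ => le_rfl)
    (fun x y => by rw [norm_mul, norm_expI, norm_expI]; norm_num)
  simp_rw [← expI_add] at hcov
  simp only [integral_const, probReal_univ, smul_eq_mul, mul_one] at hcov
  have h1 : ‖∫ ω, expI (Z ω + D ω) ∂P - ∫ ω, expI (Z ω + V ω) ∂P‖ ≤ √ε * (M * L) :=
    norm_integral_expI_sub_le (hZm.add hDm.aemeasurable) (hZm.add hVm.aemeasurable)
      (fun ω => by
        rw [Pi.add_apply, Pi.add_apply, add_sub_add_left_eq_sub]
        exact hgap ω)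
  have h2 : ‖∫ ω, expI (V ω) ∂P - ∫ ω, expI (D ω) ∂P‖ ≤ √ε * (M * L) :=
    norm_integral_expI_sub_le hVm.aemeasurable hDm.aemeasurable
      (fun ω => by rw [abs_sub_comm]; exact hgap ω)
  have h3 : ‖(∫ ω, expI (Z ω) ∂P) * (∫ ω, expI (V ω) ∂P - ∫ ω, expI (D ω) ∂P)‖
      ≤ √ε * (M * L) := by
    rw [norm_mul]
    exact (mul_le_of_le_one_left (norm_nonneg _) (norm_integral_expI_le Z)).trans h2
  have e : ∫ ω, expI (Z ω + D ω) ∂P - (∫ ω, expI (Z ω) ∂P) * ∫ ω, expI (D ω) ∂P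
      = (∫ ω, expI (Z ω + D ω) ∂P - ∫ ω, expI (Z ω + V ω) ∂P)
        + (∫ ω, expI (Z ω + V ω) ∂P - (∫ ω, expI (Z ω) ∂P) * ∫ ω, expI (V ω) ∂P)
        + (∫ ω, expI (Z ω) ∂P) * (∫ ω, expI (V ω) ∂P - ∫ ω, expI (D ω) ∂P) := by ring
  rw [e]
  refine (norm_add₃_le).trans ?_
  linarith [hcov]

lemma norm_integral_expI_sub_taylor_le {X : Ω → ℝ} (hX : Measurable X) {B : ℝ}
    (hB : ∀ ω, |X ω| ≤ B) (h0 : ∫ ω, X ω ∂P = 0) :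
    ‖∫ ω, expI (X ω) ∂P - (1 - ((∫ ω, X ω ^ 2 ∂P) / 2 : ℝ))‖ ≤ 4 * ∫ ω, |X ω| ^ 3 ∂P := by
  have hi : Integrable X P := Integrable.of_bound hX.aestronglyMeasurable B
    (Eventually.of_forall hB)
  have hip : ∀ p : ℕ, Integrable (fun ω => |X ω| ^ p) P := fun p =>
    Integrable.of_bound (hX.norm.pow_const p).aestronglyMeasurable (B ^ p)
    (Eventually.of_forall fun ω => by
      rw [Real.norm_eq_abs, abs_of_nonneg (by positivity)]
      gcongr
      exact hB ω)
  have hi2 : Integrable (fun ω => X ω ^ 2) P := by simpa using hip 2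
  have e : (1 - ((∫ ω, X ω ^ 2 ∂P) / 2 : ℝ) : ℂ)
      = ∫ ω, (1 + X ω * Complex.I - (X ω ^ 2 / 2 : ℝ) : ℂ) ∂P := by
    rw [integral_sub, integral_add, integral_mul_const, integral_complex_ofReal, h0,
      integral_complex_ofReal, integral_div]
    · simp
    · exact integrable_const _
    · exact hi.ofReal.mul_const _
    · exact (integrable_const _).add (hi.ofReal.mul_const _)
    · exact (hi2.div_const 2).ofReal
  have hi3 : Integrable (fun ω => (1 + X ω * Complex.I - (X ω ^ 2 / 2 : ℝ) : ℂ)) P :=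
    ((integrable_const _).add (hi.ofReal.mul_const _)).sub (hi2.div_const 2).ofReal
  rw [e, ← integral_sub (integrable_expI hX.aemeasurable) hi3, ← integral_const_mul]
  exact norm_integral_le_of_norm_le ((hip 3).const_mul 4)
    (Eventually.of_forall fun ω => norm_expI_sub_taylor_le (X ω))

variable {ι : Type*} [Fintype ι]

/-- Conditional characteristic function of a short increment. -/
lemma exists_norm_charFun_step_le (hc : IsBoundedStationaryField P c) {K : ℝ}
    (hK : ∀ r, 0 ≤ r → uniformMixing P c r ≤ K / (1 + r) ^ 2) (u x : ι → ℝ) :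
    ∃ C : ℝ, 0 ≤ C ∧ ∀ h : ℝ, 0 < h → h * limitVariance P c u x / 2 ≤ 1 → ∀ η : ℝ, 0 < η →
      ∀ᶠ ε in 𝓝[>] (0 : ℝ), ∀ a : ℝ, 0 ≤ a → ∀ Z : Ω → ℝ,
        AEStronglyMeasurable[timeSigma c 0 (a / ε)] Z P → (∃ B, ∀ ω, |Z ω| ≤ B) →
        ‖∫ ω, expI (Z ω + scaledIncrement (fieldComb c u x) ε a (a + h) ω) ∂P
          - (∫ ω, expI (Z ω) ∂P) * Real.exp (-(h * limitVariance P c u x / 2))‖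
          ≤ C * (√h ^ 3 + h ^ 2) + η := by
  set σ := limitVariance P c u x with hσ
  have hσ0 : 0 ≤ σ := limitVariance_nonneg hc hK u x
  have hξ := hc.isFieldProcess_fieldComb u x
  obtain ⟨M, hM⟩ := hξ.bounded
  obtain ⟨ω₀⟩ : Nonempty Ω := nonempty_of_isProbabilityMeasure P
  have hM0 : 0 ≤ M := (abs_nonneg _).trans (hM 0 ω₀)
  have hK0 : 0 ≤ K := by
    have := (uniformMixing_nonneg (P := P) (c := c) 0).trans (hK 0 le_rfl)
    simpa using this
  obtain ⟨C3, hC30, hC3⟩ := exists_moment_bound hc hK 3 (by norm_num)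
  have h3 : ∀ a, 0 ≤ a → ∀ T, 0 ≤ T →
      ∫ ω, |∫ s in a..a + T, fieldComb c u x s ω| ^ 3 ∂P ≤ C3 * M ^ 3 * √T ^ 3 := by
    refine hC3 _ hξ M hM0 fun j _ _ s _ => ?_
    calc ∫ ω, |fieldComb c u x s ω| ^ j ∂P ≤ ∫ _, M ^ j ∂P := by
          have hb : ∀ ω, |fieldComb c u x s ω| ^ j ≤ M ^ j := fun ω => by
            gcongr
            exact hM s ω
          refine integral_mono ?_ (integrable_const _) hb
          refine Integrable.of_bound
            ((hξ.measurable_apply s).norm.pow_const j).aestronglyMeasurable (M ^ j)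
            (Eventually.of_forall fun ω => ?_)
          rw [Real.norm_eq_abs, abs_of_nonneg (by positivity)]
          exact hb ω
      _ = M ^ j := by simp
  refine ⟨4 * (C3 * M ^ 3) + (σ / 2) ^ 2, by positivity, fun h hh hhσ η hη => ?_⟩
  -- The gap depends on `η` only and is fixed before `ε` tends to `0`; its effect `√ε M L` therefore
  -- vanishes in the limit.
  obtain ⟨L, hL0, hL⟩ : ∃ L, 0 ≤ L ∧ 2 * uniformMixing P c L ≤ η / 4 := by
    refine ⟨8 * K / η, by positivity, ?_⟩
    have h1 := hK (8 * K / η) (by positivity)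
    have h2 : K / (1 + 8 * K / η) ^ 2 ≤ η / 8 := by
      rw [div_le_iff₀ (by positivity)]
      have e : η / 8 * (8 * K / η) = K := by field_simp
      have : 0 ≤ 8 * K / η := by positivity
      nlinarith [mul_nonneg hη.le (sq_nonneg (8 * K / η))]
    linarith
  -- For small `ε` the gap is negligible (`ev1`), fits into the increment (`ev2`), and the variance
  -- of the increment is close to its limit `h * σ` (`ev3`).
  have ev1 : ∀ᶠ ε in 𝓝[>] (0 : ℝ), 2 * (√ε * (M * L)) < η / 4 := by
    have : Tendsto (fun ε : ℝ => 2 * (√ε * (M * L))) (𝓝[>] 0) (𝓝 (2 * (√0 * (M * L)))) :=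
      (Continuous.tendsto (by fun_prop) _).mono_left nhdsWithin_le_nhds
    refine this.eventually_lt_const ?_
    simp only [Real.sqrt_zero, zero_mul, mul_zero]
    positivity
  have ev2 : ∀ᶠ ε in 𝓝[>] (0 : ℝ), ε * L < h := by
    have : Tendsto (fun ε : ℝ => ε * L) (𝓝[>] 0) (𝓝 (0 * L)) :=
      (Continuous.tendsto (by fun_prop) _).mono_left nhdsWithin_le_nhds
    refine this.eventually_lt_const ?_
    simpa using hh
  have ev3 : ∀ᶠ ε in 𝓝[>] (0 : ℝ), |h * (∑ i, ∑ j, u i * u j *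
      squareAverage (fun r => correlation P c r (x j - x i)) (h / ε)) - h * σ| < η / 4 := by
    have t1 : Tendsto (fun ε : ℝ => h / ε) (𝓝[>] 0) atTop := by
      simp_rw [div_eq_mul_inv]
      exact tendsto_inv_nhdsGT_zero.const_mul_atTop hh
    have t2 := ((tendsto_variance_fieldComb hc hK u x).comp t1).const_mul h
    have := (Metric.tendsto_nhds.1 t2) (η / 4) (by positivity)
    simpa [Real.dist_eq] using this
  filter_upwards [ev1, ev2, ev3, self_mem_nhdsWithin] with ε e1 e2 e3 hε a ha Z hZ hZb
  have hε : 0 < ε := hε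
  set D := scaledIncrement (fieldComb c u x) ε a (a + h) with hD
  have hahε : (a + h) / ε = a / ε + h / ε := add_div _ _ _
  have hdec := hξ.norm_decoupling_le hc hM hε ha hL0 (b := a + h)
    (by rw [hahε]; gcongr; rw [le_div_iff₀ hε]; linarith) hZ hZb
  have hD1 : ∫ ω, D ω ∂P = 0 := by
    rw [hD]
    unfold scaledIncrement
    rw [integral_const_mul, hξ.integral_integral, mul_zero]
  have hD2 : ∫ ω, D ω ^ 2 ∂P = h * (∑ i, ∑ j, u i * u j *
      squareAverage (fun r => correlation P c r (x j - x i)) (h / ε)) := by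
    rw [hD]
    unfold scaledIncrement
    simp_rw [mul_pow, Real.sq_sqrt hε.le]
    rw [integral_const_mul, hahε, second_moment_fieldComb hc hK u x (by positivity) (by positivity),
      ← mul_assoc]
    congr 1
    field_simp
  have hD3 : ∫ ω, |D ω| ^ 3 ∂P ≤ C3 * M ^ 3 * √h ^ 3 := by
    rw [hD]
    unfold scaledIncrement
    simp_rw [abs_mul, mul_pow, abs_of_nonneg (Real.sqrt_nonneg ε)]
    rw [integral_const_mul, hahε]
    calc √ε ^ 3 * _ ≤ √ε ^ 3 * (C3 * M ^ 3 * √(h / ε) ^ 3) := by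
          gcongr
          exact h3 (a / ε) (by positivity) (h / ε) (by positivity)
      _ = C3 * M ^ 3 * (√ε * √(h / ε)) ^ 3 := by ring
      _ = C3 * M ^ 3 * √h ^ 3 := by
          rw [← Real.sqrt_mul hε.le]
          congr 3
          field_simp
  obtain ⟨B, hB⟩ := hξ.bounded_scaledIncrement ε a (a + h)
  have htay := norm_integral_expI_sub_taylor_le (hξ.measurable_scaledIncrement ε a (a + h)) hB hD1
  rw [hD2] at htay
  set S := ∑ i, ∑ j, u i * u j *
      squareAverage (fun r => correlation P c r (x j - x i)) (h / ε) with hS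
  -- The quadratic error bound for the exponential is available for arguments of modulus at most
  -- `1`; this is the role of `hhσ`.
  have hexp : |Real.exp (-(h * σ / 2)) - 1 - -(h * σ / 2)| ≤ (-(h * σ / 2)) ^ 2 :=
    Real.abs_exp_sub_one_sub_id_le (by rw [abs_neg, abs_of_nonneg (by positivity)]; exact hhσ)
  have h6 : ‖((1 - (h * S / 2 : ℝ) : ℂ) - Real.exp (-(h * σ / 2)))‖
      ≤ η / 4 + (σ / 2) ^ 2 * h ^ 2 := by
    rw [← Complex.ofReal_one, ← Complex.ofReal_sub, ← Complex.ofReal_sub, Complex.norm_real,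
      Real.norm_eq_abs]
    have e : 1 - h * S / 2 - Real.exp (-(h * σ / 2))
        = -((h * S - h * σ) / 2) - (Real.exp (-(h * σ / 2)) - 1 - -(h * σ / 2)) := by ring
    rw [e]
    refine (abs_sub _ _).trans ?_
    rw [abs_neg, abs_div, abs_two]
    have : |h * S - h * σ| / 2 ≤ η / 4 := by
      have := abs_nonneg (h * S - h * σ)
      linarith
    have e4 : (-(h * σ / 2)) ^ 2 = (σ / 2) ^ 2 * h ^ 2 := by ring
    rw [e4] at hexp
    linarith
  have h7 : ‖∫ ω, expI (D ω) ∂P - Real.exp (-(h * σ / 2))‖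
      ≤ 4 * (C3 * M ^ 3 * √h ^ 3) + (η / 4 + (σ / 2) ^ 2 * h ^ 2) := by
    refine (norm_sub_le_norm_sub_add_norm_sub _ (1 - (h * S / 2 : ℝ) : ℂ) _).trans ?_
    gcongr
    exact htay.trans (by gcongr)
  have h8 : ‖(∫ ω, expI (Z ω) ∂P) * (∫ ω, expI (D ω) ∂P - Real.exp (-(h * σ / 2)))‖
      ≤ 4 * (C3 * M ^ 3 * √h ^ 3) + (η / 4 + (σ / 2) ^ 2 * h ^ 2) := by
    rw [norm_mul]
    exact (mul_le_of_le_one_left (norm_nonneg _) (norm_integral_expI_le Z)).trans h7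
  have e : ∫ ω, expI (Z ω + D ω) ∂P - (∫ ω, expI (Z ω) ∂P) * Real.exp (-(h * σ / 2))
      = (∫ ω, expI (Z ω + D ω) ∂P - (∫ ω, expI (Z ω) ∂P) * ∫ ω, expI (D ω) ∂P)
        + (∫ ω, expI (Z ω) ∂P) * (∫ ω, expI (D ω) ∂P - Real.exp (-(h * σ / 2))) := by ring
  rw [e]
  refine (norm_add_le _ _).trans ?_
  have h9 : 0 ≤ C3 * M ^ 3 * h ^ 2 := by positivity
  have h10 : 0 ≤ (σ / 2) ^ 2 * √h ^ 3 := by positivity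
  nlinarith [hdec, h8]

/-- Conditional characteristic function of an increment: the central limit theorem, uniformly
with respect to the past. -/
lemma norm_charFun_increment_le (hc : IsBoundedStationaryField P c) {K : ℝ}
    (hK : ∀ r, 0 ≤ r → uniformMixing P c r ≤ K / (1 + r) ^ 2) (u x : ι → ℝ) {h : ℝ} (hh : 0 < h)
    {η : ℝ} (hη : 0 < η) :
    ∀ᶠ ε in 𝓝[>] (0 : ℝ), ∀ a : ℝ, 0 ≤ a → ∀ Z : Ω → ℝ,
      AEStronglyMeasurable[timeSigma c 0 (a / ε)] Z P → (∃ B, ∀ ω, |Z ω| ≤ B) →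
      ‖∫ ω, expI (Z ω + scaledIncrement (fieldComb c u x) ε a (a + h) ω) ∂P
        - (∫ ω, expI (Z ω) ∂P) * Real.exp (-(h * limitVariance P c u x / 2))‖ ≤ η := by
  set σ := limitVariance P c u x with hσ
  have hσ0 : 0 ≤ σ := limitVariance_nonneg hc hK u x
  have hξ := hc.isFieldProcess_fieldComb u x
  obtain ⟨C, hC0, hC⟩ := exists_norm_charFun_step_le hc hK u x
  -- The error of a block of length `h / n` is `O((h/n)^{3/2})` plus a part vanishing with `ε`.
  -- Summed over `n` blocks the former is `O(n^{-1/2})`; the latter is allotted `η / (2n)` per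
  -- block.
  obtain ⟨n, hn0, hn1, hn2⟩ : ∃ n : ℕ, 0 < n ∧ h / n * σ / 2 ≤ 1 ∧
      n * (C * (√(h / n) ^ 3 + (h / n) ^ 2)) ≤ η / 2 := by
    have t1 : Tendsto (fun n : ℕ => h / (n : ℝ)) atTop (𝓝 0) :=
      tendsto_const_div_atTop_nhds_zero_nat h
    have t2 : Tendsto (fun n : ℕ => h / (n : ℝ) * σ / 2) atTop (𝓝 (0 * σ / 2)) :=
      (t1.mul_const σ).div_const 2
    have t3 : Tendsto (fun n : ℕ => C * h * (√(h / n) + h / n)) atTop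
        (𝓝 (C * h * (√0 + 0))) :=
      (((Real.continuous_sqrt.tendsto 0).comp t1).add t1).const_mul _
    have ev2 := t2.eventually_lt_const (show 0 * σ / 2 < 1 by norm_num)
    have ev3 := t3.eventually_lt_const (show C * h * (√0 + 0) < η / 2 by simpa using hη)
    obtain ⟨n, hn⟩ := (ev2.and (ev3.and (eventually_gt_atTop 0))).exists
    refine ⟨n, hn.2.2, hn.1.le, le_trans (le_of_eq ?_) hn.2.1.le⟩
    have hnpos : (0 : ℝ) < n := Nat.cast_pos.2 hn.2.2
    have e : √(h / n) ^ 3 = h / n * √(h / n) := by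
      rw [pow_succ, Real.sq_sqrt (by positivity)]
    rw [e]
    field_simp
  have hnpos : (0 : ℝ) < n := Nat.cast_pos.2 hn0
  filter_upwards [hC (h / n) (by positivity) hn1 (η / (2 * n)) (by positivity),
    self_mem_nhdsWithin] with ε hε hεpos a ha Z hZ hZb
  have hεpos : 0 < ε := hεpos
  set δ := h / n with hδ
  have hδ0 : 0 < δ := by positivity
  set err := C * (√δ ^ 3 + δ ^ 2) + η / (2 * n) with herr
  have key : ∀ k : ℕ, ‖∫ ω, expI (Z ω + scaledIncrement (fieldComb c u x) ε a (a + k * δ) ω) ∂P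
        - (∫ ω, expI (Z ω) ∂P) * (Real.exp (-(δ * σ / 2)) : ℂ) ^ k‖ ≤ k * err := by
    intro k
    induction k with
    | zero => simp [scaledIncrement]
    | succ k ih =>
      have hak : 0 ≤ a + k * δ := by positivity
      -- The blocks already treated join `Z` in the past. Since `‖ρ‖ ≤ 1`, earlier errors are not
      -- amplified and simply add up.
      have hstep := hε (a + k * δ) hak
        (fun ω => Z ω + scaledIncrement (fieldComb c u x) ε a (a + k * δ) ω) (by
          refine AEStronglyMeasurable.add (hZ.mono ?_) ?_
          · exact timeSigma_mono le_rfl (by gcongr; linarith [mul_nonneg (Nat.cast_nonneg k) hδ0.le])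
          · refine (hξ.aestronglyMeasurable_scaledIncrement hc hεpos ha
              (by linarith [mul_nonneg (Nat.cast_nonneg k) hδ0.le])).mono ?_
            exact timeSigma_mono (by positivity) le_rfl) (by
          obtain ⟨B, hB⟩ := hZb
          obtain ⟨B', hB'⟩ := hξ.bounded_scaledIncrement ε a (a + k * δ)
          exact ⟨B + B', fun ω => (abs_add_le _ _).trans (add_le_add (hB ω) (hB' ω))⟩)
      have e1 : a + k * δ + δ = a + ((k + 1 : ℕ) : ℝ) * δ := by push_cast; ring
      rw [e1] at hstep
      have e2 : ∀ ω, Z ω + scaledIncrement (fieldComb c u x) ε a (a + k * δ) ω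
          + scaledIncrement (fieldComb c u x) ε (a + k * δ) (a + ((k + 1 : ℕ) : ℝ) * δ) ω
          = Z ω + scaledIncrement (fieldComb c u x) ε a (a + ((k + 1 : ℕ) : ℝ) * δ) ω := fun ω => by
        rw [add_assoc, hξ.scaledIncrement_add]
      simp_rw [e2] at hstep
      set A := ∫ ω, expI (Z ω + scaledIncrement (fieldComb c u x) ε a (a + k * δ) ω) ∂P
      set ρ : ℂ := (Real.exp (-(δ * σ / 2)) : ℂ) with hρ
      have hρ1 : ‖ρ‖ ≤ 1 := by
        rw [hρ, Complex.norm_real, Real.norm_eq_abs, abs_of_pos (Real.exp_pos _)]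
        exact Real.exp_le_one_iff.2 (by linarith [mul_nonneg hδ0.le hσ0])
      have e3 : ∫ ω, expI (Z ω + scaledIncrement (fieldComb c u x) ε a
            (a + ((k + 1 : ℕ) : ℝ) * δ) ω) ∂P - (∫ ω, expI (Z ω) ∂P) * ρ ^ (k + 1)
          = (∫ ω, expI (Z ω + scaledIncrement (fieldComb c u x) ε a
            (a + ((k + 1 : ℕ) : ℝ) * δ) ω) ∂P - A * ρ)
            + (A - (∫ ω, expI (Z ω) ∂P) * ρ ^ k) * ρ := by ring
      rw [e3]
      refine (norm_add_le _ _).trans ?_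
      rw [norm_mul]
      have : ‖A - (∫ ω, expI (Z ω) ∂P) * ρ ^ k‖ * ‖ρ‖ ≤ k * err :=
        (mul_le_of_le_one_right (norm_nonneg _) hρ1).trans ih
      have e4 : ((k + 1 : ℕ) : ℝ) * err = err + k * err := by push_cast; ring
      rw [e4]
      exact add_le_add hstep this
  have hfin := key n
  have e1 : (n : ℝ) * δ = h := by rw [hδ]; field_simp
  rw [e1, ← Complex.ofReal_pow, ← Real.exp_nat_mul] at hfin
  have e2 : (n : ℝ) * -(δ * σ / 2) = -(h * σ / 2) := by rw [← e1]; ring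
  rw [e2] at hfin
  refine hfin.trans ?_
  have e3 : (n : ℝ) * (η / (2 * n)) = η / 2 := by field_simp
  rw [herr, mul_add, e3]
  linarith

end CentralLimit

/-! ### Finite-dimensional limits by peeling off the latest time. -/

section FiniteDimensional

lemma aestronglyMeasurable_sum_of_sub {Ω ι : Type*} {m mΩ : MeasurableSpace Ω} {P : Measure Ω}
    {f : ι → Ω → ℝ} (s : Finset ι) (h : ∀ i, AEStronglyMeasurable[m] (f i) P) :
    AEStronglyMeasurable[m] (fun ω => ∑ i ∈ s, f i ω) P := by
  classical
  induction s using Finset.induction_on with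
  | empty => simpa using aestronglyMeasurable_const
  | insert i s hi ih =>
    simp_rw [Finset.sum_insert hi]
    exact (h i).add ih

variable {Ω : Type*} [mΩ : MeasurableSpace Ω] {P : Measure Ω} [IsProbabilityMeasure P]
  {c : ℝ≥0 → ℝ → Ω → ℝ} {ι : Type*} [Fintype ι]

lemma scaledIntegral_eq_scaledIncrement {ε : ℝ} (hε : 0 < ε) (t : ℝ≥0) (x : ℝ) (ω : Ω) :
    scaledIntegral c ε t x ω = scaledIncrement (fun s => c s.toNNReal x) ε 0 t ω := by
  unfold scaledIntegral scaledIncrement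
  rw [intervalIntegral.integral_comp_div (fun s => c s.toNNReal x ω) hε.ne', smul_eq_mul,
    ← mul_assoc]
  congr 1
  rw [inv_mul_eq_div, Real.div_sqrt]

lemma scaledIncrement_fieldComb (hc : IsBoundedStationaryField P c) (u x : ι → ℝ) (ε a b : ℝ)
    (ω : Ω) : scaledIncrement (fieldComb c u x) ε a b ω
      = ∑ j, u j * scaledIncrement (fun s => c s.toNNReal (x j)) ε a b ω := by
  unfold scaledIncrement fieldComb
  rw [intervalIntegral.integral_finsetSum fun j _ =>
    ((hc.isFieldProcess_apply (x j)).intervalIntegrable ω _ _).const_mul _, Finset.mul_sum]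
  refine Finset.sum_congr rfl fun j _ => ?_
  rw [intervalIntegral.integral_const_mul]
  ring

/-- The quadratic form of the limit covariance `(t ∧ t') R(x - x')`. -/
noncomputable def limitQuadraticForm (P : Measure Ω) (c : ℝ≥0 → ℝ → Ω → ℝ) (u : ι → ℝ)
    (t : ι → ℝ≥0) (x : ι → ℝ) : ℝ :=
  ∑ i, ∑ j, u i * u j * ((min (t i) (t j) : ℝ≥0) * integratedCorrelation P c (x i - x j))

/-- Convergence of the finite-dimensional characteristic functions. -/
lemma tendsto_charFun_scaledIntegral (hc : IsBoundedStationaryField P c) {K : ℝ}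
    (hK : ∀ r, 0 ≤ r → uniformMixing P c r ≤ K / (1 + r) ^ 2) (u : ι → ℝ) (t : ι → ℝ≥0)
    (x : ι → ℝ) :
    Tendsto (fun ε => ∫ ω, expI (∑ j, u j * scaledIntegral c ε (t j) (x j) ω) ∂P) (𝓝[>] 0)
      (𝓝 (Real.exp (-(limitQuadraticForm P c u t x / 2)) : ℂ)) := by
  -- Induction over the finite set of times, removing the largest. The value `0` is always admitted,
  -- since the field vanishes there and since truncated times can fall to `0`.
  suffices H : ∀ (S : Finset ℝ≥0) (t : ι → ℝ≥0), (∀ j, t j = 0 ∨ t j ∈ S) →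
      Tendsto (fun ε => ∫ ω, expI (∑ j, u j * scaledIntegral c ε (t j) (x j) ω) ∂P) (𝓝[>] 0)
      (𝓝 (Real.exp (-(limitQuadraticForm P c u t x / 2)) : ℂ)) by
    exact H (Finset.univ.image t) t fun j => Or.inr (Finset.mem_image_of_mem t (Finset.mem_univ j))
  intro S
  induction S using Finset.induction_on_max with
  | empty =>
    intro t ht
    have ht0 : ∀ j, t j = 0 := fun j => (ht j).resolve_right (by simp)
    simp [ht0, limitQuadraticForm, scaledIntegral, expI]
  | insert m S hm ih =>
    intro t ht
    rcases eq_or_ne m 0 with rfl | hm0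
    · refine ih t fun j => (ht j).elim Or.inl fun h => ?_
      simpa using h
    set T := S.sup id with hT
    have hTm : T < m := (Finset.sup_lt_iff (pos_iff_ne_zero.2 hm0)).2 fun s hs => hm s hs
    have hTS : T = 0 ∨ T ∈ S := by
      rcases S.eq_empty_or_nonempty with rfl | hne
      · left; simp [hT]
      · right
        obtain ⟨s, hs, e⟩ := Finset.exists_mem_eq_sup S hne id
        rw [hT, e]
        exact hs
    have hcase : ∀ j, t j = m ∨ (t j ≤ T ∧ (t j = 0 ∨ t j ∈ S)) := fun j => by
      rcases ht j with h | h
      · exact Or.inr ⟨by simp [h], Or.inl h⟩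
      · rcases Finset.mem_insert.1 h with h | h
        · exact Or.inl h
        · exact Or.inr ⟨Finset.le_sup (f := id) h, Or.inr h⟩
    -- Times are truncated at `T`, the last time before `m`; the weights `u'` keep just those terms
    -- that take part in the increment from `T` to `m`.
    set t' : ι → ℝ≥0 := fun j => min (t j) T with ht'
    set u' : ι → ℝ := fun j => if t j = m then u j else 0 with hu'
    have ht'S : ∀ j, t' j = 0 ∨ t' j ∈ S := fun j => by
      rcases hcase j with h | ⟨h, h2⟩
      · simp only [ht', h, min_eq_right hTm.le]
        exact hTS
      · simp only [ht', min_eq_left h]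
        exact h2
    have hIH := ih t' ht'S
    -- Independence of increments at the level of covariances: `min (t i) (t j)` equals `min (t' i)
    -- (t' j)`, plus `m - T` when both times are `m`. Evenness of `R` reconciles the two sign
    -- conventions.
    have hquad : limitQuadraticForm P c u t x
        = limitQuadraticForm P c u t' x + (m - T : ℝ) * limitVariance P c u' x := by
      unfold limitQuadraticForm limitVariance
      rw [Finset.mul_sum, ← Finset.sum_add_distrib]
      refine Finset.sum_congr rfl fun i _ => ?_
      rw [Finset.mul_sum, ← Finset.sum_add_distrib]
      refine Finset.sum_congr rfl fun j _ => ?_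
      rw [← hc.integratedCorrelation_neg (x i - x j), neg_sub]
      rcases hcase i with hi | ⟨hi, -⟩ <;> rcases hcase j with hj | ⟨hj, -⟩
      · simp only [ht', hu', hi, hj, if_true, min_self, min_eq_right hTm.le]
        ring
      · have hj' : t j ≠ m := (hj.trans_lt hTm).ne
        simp only [ht', hu', hi, hj', if_true, if_false, min_eq_left hj, min_eq_right hTm.le,
          min_eq_right hj, min_eq_right (hj.trans hTm.le)]
        ring
      · have hi' : t i ≠ m := (hi.trans_lt hTm).ne
        simp only [ht', hu', hj, hi', if_true, if_false, min_eq_left hi, min_eq_right hTm.le,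
          min_eq_left (hi.trans hTm.le)]
        ring
      · have hi' : t i ≠ m := (hi.trans_lt hTm).ne
        simp only [ht', hu', hi', if_false, min_eq_left hi, min_eq_left hj]
        ring
    have hsum : ∀ ε, 0 < ε → ∀ ω, ∑ j, u j * scaledIntegral c ε (t j) (x j) ω
        = ∑ j, u j * scaledIntegral c ε (t' j) (x j) ω
          + scaledIncrement (fieldComb c u' x) ε T (T + (m - T)) ω := by
      intro ε hε ω
      rw [scaledIncrement_fieldComb hc, ← Finset.sum_add_distrib]
      refine Finset.sum_congr rfl fun j _ => ?_
      rw [add_sub_cancel]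
      rcases hcase j with h | ⟨h, -⟩
      · simp only [ht', hu', h, if_true, min_eq_right hTm.le]
        rw [scaledIntegral_eq_scaledIncrement hε, scaledIntegral_eq_scaledIncrement hε, ← mul_add,
          (hc.isFieldProcess_apply (x j)).scaledIncrement_add]
      · have h' : t j ≠ m := (h.trans_lt hTm).ne
        simp only [ht', hu', h', if_false, min_eq_left h, zero_mul, add_zero]
    set ρ : ℂ := (Real.exp (-((m - T : ℝ) * limitVariance P c u' x / 2)) : ℂ) with hρ
    have hlim : (Real.exp (-(limitQuadraticForm P c u t x / 2)) : ℂ)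
        = (Real.exp (-(limitQuadraticForm P c u t' x / 2)) : ℂ) * ρ := by
      rw [hquad, hρ, ← Complex.ofReal_mul, ← Real.exp_add]
      congr 2
      ring
    rw [hlim]
    -- The truncated sum is a bounded function of the field up to time `T / ε`, hence an admissible
    -- past variable.
    have hdiff : Tendsto (fun ε => ∫ ω, expI (∑ j, u j * scaledIntegral c ε (t j) (x j) ω) ∂P
        - (∫ ω, expI (∑ j, u j * scaledIntegral c ε (t' j) (x j) ω) ∂P) * ρ) (𝓝[>] 0) (𝓝 0) := by
      rw [Metric.tendsto_nhds]
      intro η hη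
      have hTm' : (0 : ℝ) < (m : ℝ) - T := sub_pos.2 (NNReal.coe_lt_coe.2 hTm)
      filter_upwards [norm_charFun_increment_le hc hK u' x hTm' (half_pos hη),
        self_mem_nhdsWithin] with ε hε hεpos
      have hεpos : 0 < ε := hεpos
      rw [dist_zero_right]
      refine lt_of_le_of_lt ?_ (half_lt_self hη)
      simp_rw [hsum ε hεpos]
      refine hε T T.2 (fun ω => ∑ j, u j * scaledIntegral c ε (t' j) (x j) ω) ?_ ?_
      · refine aestronglyMeasurable_sum_of_sub
          (f := fun j ω => u j * scaledIntegral c ε (t' j) (x j) ω) Finset.univ fun j => ?_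
        simp_rw [scaledIntegral_eq_scaledIncrement hεpos]
        refine AEStronglyMeasurable.const_mul ?_ _
        refine ((hc.isFieldProcess_apply (x j)).aestronglyMeasurable_scaledIncrement hc hεpos
          le_rfl (t' j).2).mono ?_
        refine timeSigma_mono (by simp) ?_
        have : (t' j : ℝ) ≤ T := NNReal.coe_le_coe.2 (min_le_right _ _)
        exact div_le_div_of_nonneg_right this hεpos.le
      · have hb : ∀ j, ∃ B, ∀ ω, |scaledIntegral c ε (t' j) (x j) ω| ≤ B := fun j => by
          simp_rw [scaledIntegral_eq_scaledIncrement hεpos]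
          exact (hc.isFieldProcess_apply (x j)).bounded_scaledIncrement ε 0 (t' j)
        choose B hB using hb
        refine ⟨∑ j, |u j| * B j, fun ω => ?_⟩
        refine (Finset.abs_sum_le_sum_abs _ _).trans (Finset.sum_le_sum fun j _ => ?_)
        rw [abs_mul]
        gcongr
        exact hB j ω
    have := hdiff.add (hIH.mul_const ρ)
    simpa using this

end FiniteDimensional

/-! ### Dyadic chaining on the half plane. -/

section Chaining

/-- The point `(i, j) / 2^n` of the dyadic grid. -/
noncomputable def gridPoint (n i : ℕ) (j : ℤ) : ℝ≥0 × ℝ := ((i : ℝ≥0) / 2 ^ n, (j : ℝ) / 2 ^ n)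

/-- The lower left corner of the dyadic square of level `n` that contains `q`. -/
noncomputable def gridFloor (n : ℕ) (q : ℝ≥0 × ℝ) : ℝ≥0 × ℝ :=
  gridPoint n ⌊q.1 * 2 ^ n⌋₊ ⌊q.2 * 2 ^ n⌋

/-- Increments of `f` between neighbours of level `n` in the box `[0, N] × [-N, N]` are bounded by
`A ρ^n`. -/
def HasGridModulus (f : ℝ≥0 × ℝ → ℝ) (N : ℕ) (A ρ : ℝ) : Prop :=
  ∀ (n i : ℕ) (j : ℤ), i ≤ N * 2 ^ n → |j| ≤ N * 2 ^ n →
    |f (gridPoint n (i + 1) j) - f (gridPoint n i j)| ≤ A * ρ ^ n ∧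
    |f (gridPoint n i (j + 1)) - f (gridPoint n i j)| ≤ A * ρ ^ n

/-- The box `[0, N] × [-N, N]`. -/
def fieldBox (N : ℕ) : Set (ℝ≥0 × ℝ) := {q | q.1 ≤ N ∧ |q.2| ≤ N}

lemma gridPoint_two_mul (n i : ℕ) (j : ℤ) : gridPoint (n + 1) (2 * i) (2 * j) = gridPoint n i j := by
  unfold gridPoint
  ext
  · push_cast
    rw [pow_succ, mul_comm 2 (i : ℝ), mul_div_mul_right _ _ two_ne_zero]
  · push_cast
    rw [pow_succ, mul_comm 2 (j : ℝ), mul_div_mul_right _ _ two_ne_zero]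

lemma floor_mul_two_pow_succ (x : ℝ) (n : ℕ) :
    ⌊x * 2 ^ (n + 1)⌋ = 2 * ⌊x * 2 ^ n⌋ ∨ ⌊x * 2 ^ (n + 1)⌋ = 2 * ⌊x * 2 ^ n⌋ + 1 := by
  have h1 := Int.floor_le (x * 2 ^ n)
  have h2 := Int.lt_floor_add_one (x * 2 ^ n)
  have e : x * 2 ^ (n + 1) = 2 * (x * 2 ^ n) := by ring
  have h3 : 2 * ⌊x * 2 ^ n⌋ ≤ ⌊x * 2 ^ (n + 1)⌋ := by
    rw [Int.le_floor, e]; push_cast; linarith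
  have h4 : ⌊x * 2 ^ (n + 1)⌋ < 2 * ⌊x * 2 ^ n⌋ + 2 := by
    rw [Int.floor_lt, e]; push_cast; linarith
  omega

lemma natFloor_mul_two_pow_succ (x : ℝ≥0) (n : ℕ) :
    ⌊x * 2 ^ (n + 1)⌋₊ = 2 * ⌊x * 2 ^ n⌋₊ ∨ ⌊x * 2 ^ (n + 1)⌋₊ = 2 * ⌊x * 2 ^ n⌋₊ + 1 := by
  have h1 := Nat.floor_le (a := x * 2 ^ n) zero_le
  have h2 := Nat.lt_floor_add_one (x * 2 ^ n)
  have e : x * 2 ^ (n + 1) = 2 * (x * 2 ^ n) := by ring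
  have h3 : 2 * ⌊x * 2 ^ n⌋₊ ≤ ⌊x * 2 ^ (n + 1)⌋₊ := by
    rw [Nat.le_floor_iff zero_le, e]; push_cast; gcongr
  have h4 : ⌊x * 2 ^ (n + 1)⌋₊ < 2 * ⌊x * 2 ^ n⌋₊ + 2 := by
    rw [Nat.floor_lt zero_le, e]; push_cast
    calc 2 * (x * 2 ^ n) < 2 * ((⌊x * 2 ^ n⌋₊ : ℝ≥0) + 1) := by gcongr
      _ = _ := by ring
  omega

lemma natFloor_le_of_mem_fieldBox {N : ℕ} {q : ℝ≥0 × ℝ} (hq : q ∈ fieldBox N) (n : ℕ) :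
    ⌊q.1 * 2 ^ n⌋₊ ≤ N * 2 ^ n := by
  refine Nat.floor_le_of_le ?_
  push_cast
  gcongr
  exact hq.1

lemma abs_floor_le_of_mem_fieldBox {N : ℕ} {q : ℝ≥0 × ℝ} (hq : q ∈ fieldBox N) (n : ℕ) :
    |⌊q.2 * 2 ^ n⌋| ≤ N * 2 ^ n := by
  have h := abs_le.1 hq.2
  have hp : (0 : ℝ) < 2 ^ n := by positivity
  rw [abs_le]
  constructor
  · rw [Int.le_floor]
    push_cast
    nlinarith
  · have : (⌊q.2 * 2 ^ n⌋ : ℝ) ≤ ((N * 2 ^ n : ℤ) : ℝ) := by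
      refine (Int.floor_le _).trans ?_
      push_cast
      nlinarith
    exact_mod_cast this

lemma HasGridModulus.nonneg {f : ℝ≥0 × ℝ → ℝ} {N : ℕ} {A ρ : ℝ} (h : HasGridModulus f N A ρ) :
    0 ≤ A := by
  have := (h 0 0 0 (by simp) (by simp)).1
  simpa using (abs_nonneg _).trans this

/-- The corner of level `n` is also a grid point of level `n + 1`, and the new corner is at most one
fine step away in each direction. -/
lemma HasGridModulus.abs_gridFloor_succ_sub_le {f : ℝ≥0 × ℝ → ℝ} {N : ℕ} {A ρ : ℝ}
    (h : HasGridModulus f N A ρ) (hρ : 0 < ρ) {q : ℝ≥0 × ℝ} (hq : q ∈ fieldBox N) (n : ℕ) :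
    |f (gridFloor (n + 1) q) - f (gridFloor n q)| ≤ 2 * A * ρ ^ (n + 1) := by
  have hA : 0 ≤ A := h.nonneg
  have hAρ : 0 ≤ A * ρ ^ (n + 1) := by positivity
  unfold gridFloor
  rw [← gridPoint_two_mul n]
  set i := ⌊q.1 * 2 ^ n⌋₊ with hi
  set j := ⌊q.2 * 2 ^ n⌋ with hj
  set i' := ⌊q.1 * 2 ^ (n + 1)⌋₊ with hi'
  set j' := ⌊q.2 * 2 ^ (n + 1)⌋ with hj'
  have hiN : i' ≤ N * 2 ^ (n + 1) := natFloor_le_of_mem_fieldBox hq (n + 1)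
  have hiN2 : 2 * i ≤ N * 2 ^ (n + 1) := by
    have := natFloor_le_of_mem_fieldBox hq n
    rw [pow_succ]; rw [← hi] at this; nlinarith
  have hjN2 : |2 * j| ≤ N * 2 ^ (n + 1) := by
    have := abs_floor_le_of_mem_fieldBox hq n
    rw [abs_mul, abs_two, pow_succ]; rw [← hj] at this; nlinarith
  have s1 : |f (gridPoint (n + 1) i' (2 * j)) - f (gridPoint (n + 1) (2 * i) (2 * j))|
      ≤ A * ρ ^ (n + 1) := by
    rcases natFloor_mul_two_pow_succ q.1 n with e | e
    · rw [hi', e, ← hi]; simpa using hAρ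
    · rw [hi', e, ← hi]; exact (h (n + 1) (2 * i) (2 * j) hiN2 hjN2).1
  have s2 : |f (gridPoint (n + 1) i' j') - f (gridPoint (n + 1) i' (2 * j))|
      ≤ A * ρ ^ (n + 1) := by
    rcases floor_mul_two_pow_succ q.2 n with e | e
    · rw [hj', e, ← hj]; simpa using hAρ
    · rw [hj', e, ← hj]; exact (h (n + 1) i' (2 * j) hiN hjN2).2
  have := abs_sub_le (f (gridPoint (n + 1) i' j')) (f (gridPoint (n + 1) i' (2 * j)))
    (f (gridPoint (n + 1) (2 * i) (2 * j)))
  linarith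

lemma HasGridModulus.cauchySeq {f : ℝ≥0 × ℝ → ℝ} {N : ℕ} {A ρ : ℝ}
    (h : HasGridModulus f N A ρ) (hρ : 0 < ρ) (hρ1 : ρ < 1) {q : ℝ≥0 × ℝ} (hq : q ∈ fieldBox N) :
    CauchySeq (fun n => f (gridFloor n q)) := by
  refine cauchySeq_of_le_geometric ρ (2 * A * ρ) hρ1 fun n => ?_
  rw [dist_comm, Real.dist_eq]
  calc _ ≤ _ := h.abs_gridFloor_succ_sub_le hρ hq n
    _ = _ := by ring

/-- The limit of `f` along the dyadic approximations of `q`. -/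
noncomputable def gridLimit (f : ℝ≥0 × ℝ → ℝ) (q : ℝ≥0 × ℝ) : ℝ :=
  limUnder atTop (fun n => f (gridFloor n q))

lemma HasGridModulus.tendsto_gridLimit {f : ℝ≥0 × ℝ → ℝ} {N : ℕ} {A ρ : ℝ}
    (h : HasGridModulus f N A ρ) (hρ : 0 < ρ) (hρ1 : ρ < 1) {q : ℝ≥0 × ℝ} (hq : q ∈ fieldBox N) :
    Tendsto (fun n => f (gridFloor n q)) atTop (𝓝 (gridLimit f q)) :=
  (h.cauchySeq hρ hρ1 hq).tendsto_limUnder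

lemma HasGridModulus.abs_gridFloor_sub_gridLimit_le {f : ℝ≥0 × ℝ → ℝ} {N : ℕ} {A ρ : ℝ}
    (h : HasGridModulus f N A ρ) (hρ : 0 < ρ) (hρ1 : ρ < 1) {q : ℝ≥0 × ℝ} (hq : q ∈ fieldBox N)
    (n : ℕ) : |f (gridFloor n q) - gridLimit f q| ≤ 2 * A * ρ * ρ ^ n / (1 - ρ) := by
  refine dist_le_of_le_geometric_of_tendsto ρ (2 * A * ρ) hρ1 (fun n => ?_)
    (h.tendsto_gridLimit hρ hρ1 hq) n
  rw [dist_comm, Real.dist_eq]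
  calc _ ≤ _ := h.abs_gridFloor_succ_sub_le hρ hq n
    _ = _ := by ring

lemma HasGridModulus.abs_horizontal_le {f : ℝ≥0 × ℝ → ℝ} {N : ℕ} {A ρ : ℝ}
    (h : HasGridModulus f N A ρ) (hρ : 0 < ρ) {n i i' : ℕ} {j : ℤ} (hi : i ≤ N * 2 ^ n)
    (hi' : i' ≤ N * 2 ^ n) (hj : |j| ≤ N * 2 ^ n) (h1 : i ≤ i' + 1) (h2 : i' ≤ i + 1) :
    |f (gridPoint n i j) - f (gridPoint n i' j)| ≤ A * ρ ^ n := by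
  have hA : 0 ≤ A := h.nonneg
  rcases (by omega : i = i' ∨ i = i' + 1 ∨ i' = i + 1) with rfl | rfl | rfl
  · rw [sub_self, abs_zero]; positivity
  · exact (h n i' j hi' hj).1
  · rw [abs_sub_comm]; exact (h n i j hi hj).1

lemma HasGridModulus.abs_vertical_le {f : ℝ≥0 × ℝ → ℝ} {N : ℕ} {A ρ : ℝ}
    (h : HasGridModulus f N A ρ) (hρ : 0 < ρ) {n i : ℕ} {j j' : ℤ} (hi : i ≤ N * 2 ^ n)
    (hj : |j| ≤ N * 2 ^ n) (hj' : |j'| ≤ N * 2 ^ n) (h1 : j ≤ j' + 1) (h2 : j' ≤ j + 1) :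
    |f (gridPoint n i j) - f (gridPoint n i j')| ≤ A * ρ ^ n := by
  have hA : 0 ≤ A := h.nonneg
  rcases (by omega : j = j' ∨ j = j' + 1 ∨ j' = j + 1) with rfl | rfl | rfl
  · rw [sub_self, abs_zero]; positivity
  · exact (h n i j' hi hj').2
  · rw [abs_sub_comm]; exact (h n i j hi hj).2

lemma natFloor_mul_le_add_one {s t : ℝ≥0} {n : ℕ} (h : (s : ℝ) ≤ t + (2 ^ n)⁻¹) :
    ⌊s * 2 ^ n⌋₊ ≤ ⌊t * 2 ^ n⌋₊ + 1 := by
  have h' : s ≤ t + (2 ^ n)⁻¹ := by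
    rw [← NNReal.coe_le_coe]
    push_cast
    exact h
  rw [← Nat.floor_add_one zero_le]
  refine Nat.floor_le_floor ?_
  calc s * 2 ^ n ≤ (t + (2 ^ n)⁻¹) * 2 ^ n := by gcongr
    _ = t * 2 ^ n + 1 := by rw [add_mul, inv_mul_cancel₀ (by positivity)]

lemma floor_mul_le_add_one {s t : ℝ} {n : ℕ} (h : s ≤ t + (2 ^ n)⁻¹) :
    ⌊s * 2 ^ n⌋ ≤ ⌊t * 2 ^ n⌋ + 1 := by
  rw [← Int.floor_add_one]
  refine Int.floor_le_floor ?_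
  calc s * 2 ^ n ≤ (t + (2 ^ n)⁻¹) * 2 ^ n := by gcongr
    _ = t * 2 ^ n + 1 := by rw [add_mul, inv_mul_cancel₀ (by positivity)]

/-- Modulus of continuity of `gridLimit f`. -/
lemma HasGridModulus.abs_gridLimit_sub_le {f : ℝ≥0 × ℝ → ℝ} {N : ℕ} {A ρ : ℝ}
    (h : HasGridModulus f N A ρ) (hρ : 0 < ρ) (hρ1 : ρ < 1) {q q' : ℝ≥0 × ℝ}
    (hq : q ∈ fieldBox N) (hq' : q' ∈ fieldBox N) {n : ℕ}
    (h1 : |(q.1 : ℝ) - q'.1| ≤ (2 ^ n)⁻¹) (h2 : |q.2 - q'.2| ≤ (2 ^ n)⁻¹) :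
    |gridLimit f q - gridLimit f q'| ≤ A * (2 + 4 * ρ / (1 - ρ)) * ρ ^ n := by
  have e1 := h.abs_gridFloor_sub_gridLimit_le hρ hρ1 hq n
  have e2 := h.abs_gridFloor_sub_gridLimit_le hρ hρ1 hq' n
  -- Points within `2^{-n}` in each coordinate have corners whose indices differ by at most one; one
  -- horizontal and one vertical step connect them.
  have e3 : |f (gridFloor n q) - f (gridFloor n q')| ≤ 2 * (A * ρ ^ n) := by
    unfold gridFloor
    have a1 := abs_le.1 h1
    have a2 := abs_le.1 h2
    have hi := natFloor_le_of_mem_fieldBox hq n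
    have hi' := natFloor_le_of_mem_fieldBox hq' n
    have hj := abs_floor_le_of_mem_fieldBox hq n
    have hj' := abs_floor_le_of_mem_fieldBox hq' n
    have s1 := h.abs_horizontal_le hρ hi hi' hj (natFloor_mul_le_add_one (by linarith))
      (natFloor_mul_le_add_one (by linarith))
    have s2 := h.abs_vertical_le hρ hi' hj hj' (floor_mul_le_add_one (by linarith))
      (floor_mul_le_add_one (by linarith))
    have := abs_sub_le (f (gridPoint n ⌊q.1 * 2 ^ n⌋₊ ⌊q.2 * 2 ^ n⌋))
      (f (gridPoint n ⌊q'.1 * 2 ^ n⌋₊ ⌊q.2 * 2 ^ n⌋))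
      (f (gridPoint n ⌊q'.1 * 2 ^ n⌋₊ ⌊q'.2 * 2 ^ n⌋))
    linarith
  have e4 : A * (2 + 4 * ρ / (1 - ρ)) * ρ ^ n
      = 2 * (A * ρ ^ n) + 2 * (2 * A * ρ * ρ ^ n / (1 - ρ)) := by ring
  rw [e4]
  rw [abs_sub_comm] at e1
  have t1 := abs_sub_le (gridLimit f q) (f (gridFloor n q)) (gridLimit f q')
  have t2 := abs_sub_le (f (gridFloor n q)) (f (gridFloor n q')) (gridLimit f q')
  linarith

lemma dist_gridFloor_le (n : ℕ) (q : ℝ≥0 × ℝ) :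
    ((gridFloor n q).1 : ℝ) ≤ q.1 ∧ (q.1 : ℝ) ≤ (gridFloor n q).1 + (2 ^ n)⁻¹ ∧
      (gridFloor n q).2 ≤ q.2 ∧ q.2 ≤ (gridFloor n q).2 + (2 ^ n)⁻¹ := by
  have hp : (0 : ℝ) < 2 ^ n := by positivity
  have h1 := Nat.floor_le (a := q.1 * 2 ^ n) zero_le
  have h2 := Nat.lt_floor_add_one (q.1 * 2 ^ n)
  have h3 := Int.floor_le (q.2 * 2 ^ n)
  have h4 := Int.lt_floor_add_one (q.2 * 2 ^ n)
  rw [← NNReal.coe_le_coe] at h1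
  rw [← NNReal.coe_lt_coe] at h2
  push_cast at h1 h2
  unfold gridFloor gridPoint
  push_cast
  refine ⟨?_, ?_, ?_, ?_⟩
  · rw [div_le_iff₀ hp]; exact h1
  · rw [← one_div, ← add_div, le_div_iff₀ hp]; exact h2.le
  · rw [div_le_iff₀ hp]; exact h3
  · rw [← one_div, ← add_div, le_div_iff₀ hp]; exact h4.le

lemma tendsto_gridFloor (q : ℝ≥0 × ℝ) : Tendsto (fun n => gridFloor n q) atTop (𝓝 q) := by
  have h0 : Tendsto (fun n : ℕ => ((2 : ℝ) ^ n)⁻¹) atTop (𝓝 0) := by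
    simp_rw [← inv_pow]
    exact tendsto_pow_atTop_nhds_zero_of_lt_one (by norm_num) (by norm_num)
  refine Prod.tendsto_iff _ _ |>.2 ⟨?_, ?_⟩
  · rw [← NNReal.tendsto_coe]
    refine tendsto_of_tendsto_of_tendsto_of_le_of_le (g := fun n : ℕ => (q.1 : ℝ) - (2 ^ n)⁻¹)
      (by simpa using tendsto_const_nhds.sub h0) tendsto_const_nhds (fun n => ?_)
      (fun n => (dist_gridFloor_le n q).1)
    have := (dist_gridFloor_le n q).2.1
    simp only
    linarith
  · refine tendsto_of_tendsto_of_tendsto_of_le_of_le (g := fun n : ℕ => q.2 - (2 ^ n)⁻¹)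
      (by simpa using tendsto_const_nhds.sub h0) tendsto_const_nhds (fun n => ?_)
      (fun n => (dist_gridFloor_le n q).2.2.1)
    have := (dist_gridFloor_le n q).2.2.2
    simp only
    linarith

lemma gridLimit_eq_of_continuous {f : ℝ≥0 × ℝ → ℝ} (hf : Continuous f) (q : ℝ≥0 × ℝ) :
    gridLimit f q = f q :=
  ((hf.tendsto q).comp (tendsto_gridFloor q)).limUnder_eq

lemma exists_fieldBox_nhds (q : ℝ≥0 × ℝ) : ∃ N : ℕ, fieldBox N ∈ 𝓝 q := by
  obtain ⟨N, hN⟩ := exists_nat_gt (max (q.1 : ℝ) |q.2|)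
  refine ⟨N, ?_⟩
  have h1 : ∀ᶠ r : ℝ≥0 × ℝ in 𝓝 q, (r.1 : ℝ) < N :=
    (NNReal.continuous_coe.comp continuous_fst).continuousAt.eventually_lt continuousAt_const
      ((le_max_left _ _).trans_lt hN)
  have h2 : ∀ᶠ r : ℝ≥0 × ℝ in 𝓝 q, |r.2| < N :=
    (continuous_abs.comp continuous_snd).continuousAt.eventually_lt continuousAt_const
      ((le_max_right _ _).trans_lt hN)
  filter_upwards [h1, h2] with r a b
  exact ⟨by exact_mod_cast a.le, b.le⟩

/-- Uniform neighbourhoods on which functions with a given grid modulus oscillate little. -/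
lemma exists_nhds_abs_gridLimit_sub_lt {N : ℕ} {q : ℝ≥0 × ℝ} (hN : fieldBox N ∈ 𝓝 q) {A ρ η : ℝ}
    (hρ : 0 < ρ) (hρ1 : ρ < 1) (hη : 0 < η) :
    ∀ᶠ r in 𝓝 q, ∀ f : ℝ≥0 × ℝ → ℝ, HasGridModulus f N A ρ →
      |gridLimit f q - gridLimit f r| < η := by
  have ht : Tendsto (fun n : ℕ => A * (2 + 4 * ρ / (1 - ρ)) * ρ ^ n) atTop
      (𝓝 (A * (2 + 4 * ρ / (1 - ρ)) * 0)) :=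
    (tendsto_pow_atTop_nhds_zero_of_lt_one hρ.le hρ1).const_mul _
  rw [mul_zero] at ht
  obtain ⟨n, hn⟩ := (ht.eventually_lt_const hη).exists
  have hp : (0 : ℝ) < (2 ^ n)⁻¹ := by positivity
  have h1 : ∀ᶠ r : ℝ≥0 × ℝ in 𝓝 q, |(q.1 : ℝ) - r.1| < (2 ^ n)⁻¹ := by
    refine ContinuousAt.eventually_lt (Continuous.continuousAt ?_) continuousAt_const
      (by simp)
    exact (continuous_const.sub (NNReal.continuous_coe.comp continuous_fst)).abs
  have h2 : ∀ᶠ r : ℝ≥0 × ℝ in 𝓝 q, |q.2 - r.2| < (2 ^ n)⁻¹ := by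
    refine ContinuousAt.eventually_lt (Continuous.continuousAt ?_) continuousAt_const
      (by simp)
    fun_prop
  filter_upwards [hN, h1, h2] with r hr a b f hf
  exact (hf.abs_gridLimit_sub_le hρ hρ1 (mem_of_mem_nhds hN) hr a.le b.le).trans_lt hn

/-- The constant may depend on the box because continuity is local; only the ratio `ρ` must be
common. -/
lemma continuous_gridLimit {f : ℝ≥0 × ℝ → ℝ} {ρ : ℝ} (hρ : 0 < ρ) (hρ1 : ρ < 1)
    (h : ∀ N : ℕ, ∃ A, HasGridModulus f N A ρ) : Continuous (gridLimit f) := by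
  refine continuous_iff_continuousAt.2 fun q => ?_
  obtain ⟨N, hN⟩ := exists_fieldBox_nhds q
  obtain ⟨A, hA⟩ := h N
  refine Metric.tendsto_nhds.2 fun η hη => ?_
  filter_upwards [exists_nhds_abs_gridLimit_sub_lt hN hρ hρ1 hη (A := A)] with r hr
  rw [dist_comm, Real.dist_eq]
  exact hr f hA

/-- A bound for functions with a given grid modulus that vanish at the origin. -/
lemma HasGridModulus.abs_gridLimit_sub_zero_le {f : ℝ≥0 × ℝ → ℝ} {N : ℕ} {A ρ : ℝ}
    (h : HasGridModulus f N A ρ) (hρ : 0 < ρ) (hρ1 : ρ < 1) {q : ℝ≥0 × ℝ} (hq : q ∈ fieldBox N)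
    (hN : 0 < N) : |gridLimit f q - gridLimit f (0, 0)| ≤ N * (A * (2 + 4 * ρ / (1 - ρ))) := by
  have hNpos : (0 : ℝ) < N := Nat.cast_pos.2 hN
  -- The segment from the origin to `q` is divided into `N` pieces with coordinate increments at
  -- most `1`, so the modulus of level `0` applies to each.
  set r : ℕ → ℝ≥0 × ℝ := fun k => ((k / N : ℝ≥0) * q.1, (k / N : ℝ) * q.2) with hr
  have hbox : ∀ k : ℕ, k ≤ N → r k ∈ fieldBox N := fun k hk => by
    have h1 : (k / N : ℝ) ≤ 1 := (div_le_one hNpos).2 (by exact_mod_cast hk)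
    have h1' : (k / N : ℝ≥0) ≤ 1 := by
      rw [← NNReal.coe_le_coe]; push_cast; exact h1
    constructor
    · exact (mul_le_of_le_one_left zero_le h1').trans hq.1
    · simp only [hr, abs_mul]
      rw [abs_of_nonneg (by positivity)]
      exact (mul_le_of_le_one_left (abs_nonneg _) h1).trans hq.2
  have key : ∀ k : ℕ, k ≤ N → |gridLimit f (r k) - gridLimit f (0, 0)|
      ≤ k * (A * (2 + 4 * ρ / (1 - ρ))) := by
    intro k
    induction k with
    | zero => intro _; simp [hr]
    | succ k ih =>
      intro hk
      have hstep := h.abs_gridLimit_sub_le hρ hρ1 (hbox (k + 1) hk) (hbox k (by omega)) (n := 0)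
        (by
          have e : ((r (k + 1)).1 : ℝ) - (r k).1 = q.1 / N := by
            simp only [hr]; push_cast; field_simp; ring
          rw [e, abs_of_nonneg (by positivity), pow_zero, inv_one, div_le_one hNpos]
          exact_mod_cast hq.1)
        (by
          have e : (r (k + 1)).2 - (r k).2 = q.2 / N := by
            simp only [hr]; push_cast; field_simp; ring
          rw [e, abs_div, abs_of_pos hNpos, pow_zero, inv_one, div_le_one hNpos]
          exact hq.2)
      rw [pow_zero, mul_one] at hstep
      have := abs_sub_le (gridLimit f (r (k + 1))) (gridLimit f (r k)) (gridLimit f (0, 0))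
      have ih' := ih (by omega)
      push_cast
      linarith
  have := key N le_rfl
  have e : r N = q := by
    have h1 : (N / N : ℝ≥0) = 1 := div_self (by exact_mod_cast hN.ne')
    have h2 : (N / N : ℝ) = 1 := div_self hNpos.ne'
    simp only [hr, h1, h2, one_mul]
  rwa [e] at this

end Chaining

/-! ### Mean energy of the dyadic increments. -/

section Kolmogorov

/-- The sum over all levels of the normalized `p`-th powers of the increments of `f` between
neighbouring points of the dyadic grid in the box `[0, N] × [-N, N]`. -/
noncomputable def gridEnergy (p : ℕ) (ρ : ℝ) (N : ℕ) (f : ℝ≥0 × ℝ → ℝ) : ℝ≥0∞ :=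
  ∑' n : ℕ, ∑ i ∈ Finset.range (N * 2 ^ n + 1),
    ∑ j ∈ Finset.Icc (-(N * 2 ^ n : ℤ)) (N * 2 ^ n),
      ENNReal.ofReal ((ρ ^ n) ^ p)⁻¹ *
        (ENNReal.ofReal (|f (gridPoint n (i + 1) j) - f (gridPoint n i j)| ^ p) +
          ENNReal.ofReal (|f (gridPoint n i (j + 1)) - f (gridPoint n i j)| ^ p))

/-- Every single term is bounded by the whole sum. The constant `1 + L` replaces the `p`-th root of
`L`, as `L ≤ (1 + L)^p`. -/
lemma hasGridModulus_of_gridEnergy_le {p : ℕ} (hp : p ≠ 0) {ρ : ℝ} (hρ : 0 < ρ) {N : ℕ}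
    {f : ℝ≥0 × ℝ → ℝ} {L : ℝ≥0∞} (hL : L ≠ ∞) (h : gridEnergy p ρ N f ≤ L) :
    HasGridModulus f N (1 + L.toReal) ρ := by
  intro n i j hi hj
  have hterm : ENNReal.ofReal ((ρ ^ n) ^ p)⁻¹ *
        (ENNReal.ofReal (|f (gridPoint n (i + 1) j) - f (gridPoint n i j)| ^ p) +
          ENNReal.ofReal (|f (gridPoint n i (j + 1)) - f (gridPoint n i j)| ^ p)) ≤ L := by
    refine le_trans ?_ h
    refine le_trans ?_ (ENNReal.le_tsum n)
    refine le_trans ?_ (Finset.single_le_sum (fun _ _ => zero_le)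
      (Finset.mem_range.2 (Nat.lt_succ_of_le hi)))
    exact Finset.single_le_sum (f := fun j : ℤ => ENNReal.ofReal ((ρ ^ n) ^ p)⁻¹ *
        (ENNReal.ofReal (|f (gridPoint n (i + 1) j) - f (gridPoint n i j)| ^ p) +
          ENNReal.ofReal (|f (gridPoint n i (j + 1)) - f (gridPoint n i j)| ^ p)))
      (fun _ _ => zero_le) (Finset.mem_Icc.2 (abs_le.1 hj))
  have key : ∀ d : ℝ, ENNReal.ofReal ((ρ ^ n) ^ p)⁻¹ * ENNReal.ofReal (|d| ^ p) ≤ L →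
      |d| ≤ (1 + L.toReal) * ρ ^ n := by
    intro d hd
    rw [← ENNReal.ofReal_mul (by positivity), ENNReal.ofReal_le_iff_le_toReal hL,
      inv_mul_le_iff₀ (by positivity)] at hd
    refine le_of_pow_le_pow_left₀ hp (by positivity) (hd.trans ?_)
    rw [mul_pow, mul_comm]
    gcongr
    calc L.toReal ≤ 1 + L.toReal := by linarith
      _ ≤ (1 + L.toReal) ^ p := le_self_pow₀ (by linarith [L.toReal_nonneg]) hp
  rw [mul_add] at hterm
  exact ⟨key _ (le_self_add.trans hterm), key _ (le_add_self.trans hterm)⟩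

variable {Ω : Type*} [mΩ : MeasurableSpace Ω] {P : Measure Ω}

/-- Kolmogorov's moment condition on the increments of a random field, in the two coordinate
directions. -/
structure HasFieldMomentBound (P : Measure Ω) (X : ℝ≥0 × ℝ → Ω → ℝ) (p : ℕ) (β : ℝ)
    (C : ℕ → ℝ) : Prop where
  measurable : ∀ q, Measurable (X q)
  time : ∀ (N : ℕ) (t t' : ℝ≥0) (x : ℝ), t ≤ N → t' ≤ N → |x| ≤ N → |(t : ℝ) - t'| ≤ 1 →
    ∫⁻ ω, ENNReal.ofReal (|X (t, x) ω - X (t', x) ω| ^ p) ∂P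
      ≤ ENNReal.ofReal (C N * |(t : ℝ) - t'| ^ β)
  space : ∀ (N : ℕ) (t : ℝ≥0) (x x' : ℝ), t ≤ N → |x| ≤ N → |x'| ≤ N → |x - x'| ≤ 1 →
    ∫⁻ ω, ENNReal.ofReal (|X (t, x) ω - X (t, x') ω| ^ p) ∂P
      ≤ ENNReal.ofReal (C N * |x - x'| ^ β)

lemma HasFieldMomentBound.congr {X Y : ℝ≥0 × ℝ → Ω → ℝ} {p : ℕ} {β : ℝ} {C : ℕ → ℝ}
    (h : HasFieldMomentBound P X p β C) (hY : ∀ q, Measurable (Y q)) (hXY : ∀ q, X q =ᵐ[P] Y q) :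
    HasFieldMomentBound P Y p β C where
  measurable := hY
  time N t t' x h1 h2 h3 h4 := by
    refine le_trans (le_of_eq ?_) (h.time N t t' x h1 h2 h3 h4)
    refine lintegral_congr_ae ?_
    filter_upwards [hXY (t, x), hXY (t', x)] with ω e1 e2
    rw [e1, e2]
  space N t x x' h1 h2 h3 h4 := by
    refine le_trans (le_of_eq ?_) (h.space N t x x' h1 h2 h3 h4)
    refine lintegral_congr_ae ?_
    filter_upwards [hXY (t, x), hXY (t, x')] with ω e1 e2
    rw [e1, e2]

lemma HasFieldMomentBound.measurable_gridEnergy {X : ℝ≥0 × ℝ → Ω → ℝ} {p : ℕ} {β : ℝ} {C : ℕ → ℝ}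
    (h : HasFieldMomentBound P X p β C) (ρ : ℝ) (N : ℕ) :
    Measurable (fun ω => gridEnergy p ρ N (fun q => X q ω)) := by
  have hm : ∀ q q' : ℝ≥0 × ℝ, Measurable (fun ω => ENNReal.ofReal (|X q ω - X q' ω| ^ p)) :=
    fun q q' => (((h.measurable q).sub (h.measurable q')).norm.pow_const p).ennreal_ofReal
  unfold gridEnergy
  refine Measurable.tsum fun n => ?_
  refine Finset.measurable_sum _ fun i _ => Finset.measurable_sum _ fun j _ => ?_
  exact ((hm _ _).add (hm _ _)).const_mul _

/-- The bound for the mean grid energy. -/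
noncomputable def gridConst (p : ℕ) (β : ℝ) (C : ℕ → ℝ) (ρ : ℝ) (N : ℕ) : ℝ≥0∞ :=
  ∑' n : ℕ, ENNReal.ofReal
    ((N + 1) * (2 * N + 1) * (2 * |C (N + 1)|) * (4 * 2 ^ (-β) / ρ ^ p) ^ n)

lemma gridConst_ne_top {p : ℕ} {β : ℝ} {C : ℕ → ℝ} {ρ : ℝ} (hρ : 0 < ρ)
    (h : 4 * 2 ^ (-β) < ρ ^ p) (N : ℕ) : gridConst p β C ρ N ≠ ∞ := by
  refine Summable.tsum_ofReal_ne_top ?_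
  refine (summable_geometric_of_lt_one (by positivity) ?_).mul_left _
  rwa [div_lt_one (by positivity)]

/-- Level `n` has of order `4^n` grid points, each increment contributes `2^{-βn}`, and
normalization costs `ρ^{-pn}`. The constant is taken at `N + 1` because neighbours of points in the
box may lie outside it. -/
lemma HasFieldMomentBound.lintegral_gridEnergy_le {X : ℝ≥0 × ℝ → Ω → ℝ} {p : ℕ} {β : ℝ}
    {C : ℕ → ℝ} (h : HasFieldMomentBound P X p β C) {ρ : ℝ} (hρ : 0 < ρ) (N : ℕ) :
    ∫⁻ ω, gridEnergy p ρ N (fun q => X q ω) ∂P ≤ gridConst p β C ρ N := by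
  have hm : ∀ q q' : ℝ≥0 × ℝ, Measurable (fun ω => ENNReal.ofReal (|X q ω - X q' ω| ^ p)) :=
    fun q q' => (((h.measurable q).sub (h.measurable q')).norm.pow_const p).ennreal_ofReal
  set c := |C (N + 1)| with hc
  have hc0 : 0 ≤ c := abs_nonneg _
  have hinc : ∀ (n i : ℕ) (j : ℤ), i ≤ N * 2 ^ n → |j| ≤ N * 2 ^ n →
      ∫⁻ ω, ENNReal.ofReal (|X (gridPoint n (i + 1) j) ω - X (gridPoint n i j) ω| ^ p) ∂P
        ≤ ENNReal.ofReal (c * (2 ^ (-β)) ^ n) ∧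
      ∫⁻ ω, ENNReal.ofReal (|X (gridPoint n i (j + 1)) ω - X (gridPoint n i j) ω| ^ p) ∂P
        ≤ ENNReal.ofReal (c * (2 ^ (-β)) ^ n) := by
    intro n i j hi hj
    have hp : (0 : ℝ) < 2 ^ n := by positivity
    have hp1 : (1 : ℝ) ≤ 2 ^ n := one_le_pow₀ (by norm_num)
    have hpow : |((2 : ℝ) ^ n)⁻¹| ^ β = (2 ^ (-β)) ^ n := by
      rw [abs_of_pos (by positivity), ← Real.rpow_natCast, ← Real.rpow_neg (by norm_num),
        ← Real.rpow_mul (by norm_num), ← Real.rpow_natCast, ← Real.rpow_mul (by norm_num)]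
      congr 1
      ring
    have hle : C (N + 1) * (2 ^ (-β)) ^ n ≤ c * (2 ^ (-β)) ^ n := by
      gcongr
      exact le_abs_self _
    have hiR : (i : ℝ) ≤ N * 2 ^ n := by exact_mod_cast hi
    have hjR : |(j : ℝ)| ≤ N * 2 ^ n := by exact_mod_cast hj
    have b1 : ∀ k : ℕ, k ≤ i + 1 → ((k : ℝ≥0) / 2 ^ n) ≤ ((N + 1 : ℕ) : ℝ≥0) := by
      intro k hk
      rw [← NNReal.coe_le_coe]
      push_cast
      have : (k : ℝ) ≤ i + 1 := by exact_mod_cast hk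
      rw [div_le_iff₀ hp]
      nlinarith
    have b2 : ∀ k : ℤ, |k - j| ≤ 1 → |(k : ℝ) / 2 ^ n| ≤ ((N + 1 : ℕ) : ℝ) := by
      intro k hk
      have : |(k : ℝ) - j| ≤ 1 := by exact_mod_cast hk
      have h3 : |(k : ℝ)| ≤ N * 2 ^ n + 1 := by
        have := abs_sub_abs_le_abs_sub (k : ℝ) j
        linarith
      push_cast
      rw [abs_div, abs_of_pos hp, div_le_iff₀ hp]
      nlinarith
    constructor
    · have e : (((i + 1 : ℕ) : ℝ≥0) / 2 ^ n : ℝ≥0) - (((i : ℝ≥0) / 2 ^ n : ℝ≥0) : ℝ)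
          = (2 ^ n)⁻¹ := by
        push_cast
        field_simp
        ring
      have := h.time (N + 1) (((i + 1 : ℕ) : ℝ≥0) / 2 ^ n) ((i : ℝ≥0) / 2 ^ n) ((j : ℝ) / 2 ^ n)
        (b1 _ le_rfl) (b1 _ (by omega)) (b2 _ (by simp)) (by
          rw [e, abs_of_pos (by positivity)]; exact inv_le_one_of_one_le₀ hp1)
      rw [e, hpow] at this
      exact this.trans (ENNReal.ofReal_le_ofReal hle)
    · have e : ((j + 1 : ℤ) : ℝ) / 2 ^ n - (j : ℝ) / 2 ^ n = (2 ^ n)⁻¹ := by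
        push_cast
        field_simp
        ring
      have := h.space (N + 1) ((i : ℝ≥0) / 2 ^ n) (((j + 1 : ℤ) : ℝ) / 2 ^ n) ((j : ℝ) / 2 ^ n)
        (b1 _ (by omega)) (b2 _ (by simp)) (b2 _ (by simp)) (by
          rw [e, abs_of_pos (by positivity)]; exact inv_le_one_of_one_le₀ hp1)
      rw [e, hpow] at this
      exact this.trans (ENNReal.ofReal_le_ofReal hle)
  unfold gridEnergy
  have hsm : ∀ (n i : ℕ) (j : ℤ), Measurable (fun ω => ENNReal.ofReal ((ρ ^ n) ^ p)⁻¹ *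
        (ENNReal.ofReal (|X (gridPoint n (i + 1) j) ω - X (gridPoint n i j) ω| ^ p) +
          ENNReal.ofReal (|X (gridPoint n i (j + 1)) ω - X (gridPoint n i j) ω| ^ p))) :=
    fun n i j => ((hm _ _).add (hm _ _)).const_mul _
  rw [lintegral_tsum fun n => (Finset.measurable_sum _ fun i _ =>
    Finset.measurable_sum _ fun j _ => hsm n i j).aemeasurable]
  refine ENNReal.tsum_le_tsum fun n => ?_
  rw [lintegral_finsetSum _ fun i _ => Finset.measurable_sum _ fun j _ => hsm n i j]
  have hterm : ∀ i ∈ Finset.range (N * 2 ^ n + 1),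
      ∀ j ∈ Finset.Icc (-(N * 2 ^ n : ℤ)) (N * 2 ^ n),
      ∫⁻ ω, ENNReal.ofReal ((ρ ^ n) ^ p)⁻¹ *
        (ENNReal.ofReal (|X (gridPoint n (i + 1) j) ω - X (gridPoint n i j) ω| ^ p) +
          ENNReal.ofReal (|X (gridPoint n i (j + 1)) ω - X (gridPoint n i j) ω| ^ p)) ∂P
      ≤ ENNReal.ofReal (2 * c * (2 ^ (-β) / ρ ^ p) ^ n) := by
    intro i hi j hj
    have hij := hinc n i j (Nat.lt_succ_iff.1 (Finset.mem_range.1 hi))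
      (abs_le.2 (Finset.mem_Icc.1 hj))
    have hadd : Measurable (fun ω =>
        ENNReal.ofReal (|X (gridPoint n (i + 1) j) ω - X (gridPoint n i j) ω| ^ p) +
          ENNReal.ofReal (|X (gridPoint n i (j + 1)) ω - X (gridPoint n i j) ω| ^ p)) :=
      (hm _ _).add (hm _ _)
    rw [lintegral_const_mul _ hadd, lintegral_add_left (hm _ _)]
    calc _ ≤ ENNReal.ofReal ((ρ ^ n) ^ p)⁻¹ * (ENNReal.ofReal (c * (2 ^ (-β)) ^ n)
          + ENNReal.ofReal (c * (2 ^ (-β)) ^ n)) := by gcongr; exacts [hij.1, hij.2]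
      _ = _ := by
          rw [← ENNReal.ofReal_add (by positivity) (by positivity),
            ← ENNReal.ofReal_mul (by positivity)]
          congr 1
          rw [div_pow, pow_right_comm]
          field_simp
          ring
  calc _ ≤ ∑ i ∈ Finset.range (N * 2 ^ n + 1), ∑ j ∈ Finset.Icc (-(N * 2 ^ n : ℤ)) (N * 2 ^ n),
        ENNReal.ofReal (2 * c * (2 ^ (-β) / ρ ^ p) ^ n) := by
        refine Finset.sum_le_sum fun i hi => ?_
        rw [lintegral_finsetSum _ fun j _ => hsm n i j]
        exact Finset.sum_le_sum fun j hj => hterm i hi j hj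
    _ = ENNReal.ofReal (((N * 2 ^ n + 1 : ℕ) : ℝ) * ((2 * (N * 2 ^ n) + 1 : ℕ) : ℝ)
          * (2 * c * (2 ^ (-β) / ρ ^ p) ^ n)) := by
        rw [Finset.sum_const, Finset.sum_const, Finset.card_range, Int.card_Icc, smul_smul,
          nsmul_eq_mul, ← ENNReal.ofReal_natCast, ← ENNReal.ofReal_mul (by positivity)]
        congr 2
        have e : ((N * 2 ^ n : ℤ) + 1 - -(N * 2 ^ n : ℤ)).toNat = 2 * (N * 2 ^ n) + 1 := by
          have : ((N * 2 ^ n : ℤ) + 1 - -(N * 2 ^ n : ℤ)) = ((2 * (N * 2 ^ n) + 1 : ℕ) : ℤ) := by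
            push_cast; ring
          rw [this, Int.toNat_natCast]
        rw [e]
        push_cast
        ring
    _ ≤ _ := by
        refine ENNReal.ofReal_le_ofReal ?_
        have hp1 : (1 : ℝ) ≤ 2 ^ n := one_le_pow₀ (by norm_num)
        have e : (4 * 2 ^ (-β) / ρ ^ p) ^ n = 2 ^ n * 2 ^ n * (2 ^ (-β) / ρ ^ p) ^ n := by
          rw [mul_div_assoc, mul_pow, ← mul_pow 2 2]
          norm_num
        rw [e]
        have h1 : ((N * 2 ^ n + 1 : ℕ) : ℝ) ≤ (N + 1) * 2 ^ n := by push_cast; nlinarith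
        have h2 : ((2 * (N * 2 ^ n) + 1 : ℕ) : ℝ) ≤ (2 * N + 1) * 2 ^ n := by push_cast; nlinarith
        calc _ ≤ ((N + 1) * 2 ^ n) * ((2 * N + 1) * 2 ^ n) * (2 * c * (2 ^ (-β) / ρ ^ p) ^ n) := by
              gcongr
          _ = _ := by ring

/-- This is where the dimension enters: `β > 2` says that the `4^n` points of level `n` are
outweighed by the decay `2^{-βn}`, leaving room for some `ρ < 1`. -/
lemma exists_grid_ratio (p : ℕ) {β : ℝ} (hβ : 2 < β) :
    ∃ ρ : ℝ, 0 < ρ ∧ ρ < 1 ∧ 4 * (2 : ℝ) ^ (-β) < ρ ^ p := by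
  have h4 : 4 * (2 : ℝ) ^ (-β) < 1 := by
    have : (2 : ℝ) ^ (-β) < (2 : ℝ) ^ (-(2 : ℝ)) :=
      Real.rpow_lt_rpow_of_exponent_lt (by norm_num) (by linarith)
    rw [Real.rpow_neg (by norm_num) 2] at this
    norm_num at this ⊢
    linarith
  have h1 : ∀ᶠ ρ in 𝓝[<] (1 : ℝ), 4 * (2 : ℝ) ^ (-β) < ρ ^ p := by
    have : Tendsto (fun ρ : ℝ => ρ ^ p) (𝓝[<] 1) (𝓝 (1 ^ p)) :=
      ((continuous_pow p).tendsto 1).mono_left nhdsWithin_le_nhds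
    rw [one_pow] at this
    exact this.eventually_const_lt h4
  have h2 : ∀ᶠ ρ in 𝓝[<] (1 : ℝ), ρ ∈ Ioo (0 : ℝ) 1 := Ioo_mem_nhdsLT zero_lt_one
  obtain ⟨ρ, h3, h5⟩ := (h1.and h2).exists
  exact ⟨ρ, h5.1, h5.2, h3⟩

end Kolmogorov

/-! ### Borel structure of the path space. -/

section FieldPath

/-- The restriction of a path to a countable dense set of points. -/
noncomputable def denseEval (w : FieldPath) (n : ℕ) : ℝ := w (TopologicalSpace.denseSeq (ℝ≥0 × ℝ) n)

lemma continuous_denseEval : Continuous denseEval :=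
  continuous_pi fun _ => continuous_eval_const _

lemma injective_denseEval : Function.Injective denseEval := by
  intro v w h
  refine DFunLike.coe_injective
    (Continuous.ext_on (TopologicalSpace.denseRange_denseSeq (ℝ≥0 × ℝ)) v.continuous w.continuous ?_)
  rintro _ ⟨n, rfl⟩
  exact congrFun h n

/-- The path space is Polish, so a continuous injection is a Borel embedding (Lusin–Souslin). Thus
measurability and laws of random paths are determined by countably many evaluations. -/
lemma measurableEmbedding_denseEval : MeasurableEmbedding denseEval :=
  continuous_denseEval.measurableEmbedding injective_denseEval

lemma measurable_fieldPath_apply (q : ℝ≥0 × ℝ) : Measurable (fun w : FieldPath => w q) :=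
  (continuous_eval_const q).measurable

variable {Ω : Type*} [mΩ : MeasurableSpace Ω] {P : Measure Ω}

lemma measurable_of_forall_apply {V : Ω → FieldPath} (h : ∀ q, Measurable (fun ω => V ω q)) :
    Measurable V :=
  measurableEmbedding_denseEval.measurable_comp_iff.1 (measurable_pi_iff.2 fun _ => h _)

end FieldPath

/-! ### Kolmogorov's continuity theorem. -/

section Version

variable {Ω : Type*} [mΩ : MeasurableSpace Ω] {P : Measure Ω}

/-- Random variables whose `p`-th moments decay geometrically tend to zero almost surely. -/
lemma ae_tendsto_zero_of_lintegral_pow_le {Y : ℕ → Ω → ℝ} (hY : ∀ n, Measurable (Y n)) {p : ℕ}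
    (hp : p ≠ 0) {C r : ℝ} (hr : 0 ≤ r) (hr1 : r < 1)
    (h : ∀ n, ∫⁻ ω, ENNReal.ofReal (|Y n ω| ^ p) ∂P ≤ ENNReal.ofReal (C * r ^ n)) :
    ∀ᵐ ω ∂P, Tendsto (fun n => Y n ω) atTop (𝓝 0) := by
  have hm : ∀ n, Measurable (fun ω => ENNReal.ofReal (|Y n ω| ^ p)) :=
    fun n => ((hY n).norm.pow_const p).ennreal_ofReal
  have hfin : ∫⁻ ω, ∑' n, ENNReal.ofReal (|Y n ω| ^ p) ∂P ≠ ∞ := by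
    rw [lintegral_tsum fun n => (hm n).aemeasurable]
    refine ne_top_of_le_ne_top ?_ (ENNReal.tsum_le_tsum h)
    have h2 : ∑' n : ℕ, ENNReal.ofReal (|C| * r ^ n) ≠ ∞ :=
      Summable.tsum_ofReal_ne_top ((summable_geometric_of_lt_one hr hr1).mul_left _)
    refine ne_top_of_le_ne_top h2 (ENNReal.tsum_le_tsum fun n => ENNReal.ofReal_le_ofReal ?_)
    gcongr
    exact le_abs_self C
  filter_upwards [ae_lt_top (Measurable.tsum hm) hfin] with ω hω
  have h1 := ENNReal.tendsto_atTop_zero_of_tsum_ne_top hω.ne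
  have h2 : Tendsto (fun n => |Y n ω| ^ p) atTop (𝓝 0) := by
    have := (ENNReal.tendsto_toReal ENNReal.zero_ne_top).comp h1
    refine this.congr fun n => ?_
    exact ENNReal.toReal_ofReal (by positivity)
  have h3 : Tendsto (fun n => (|Y n ω| ^ p) ^ ((p : ℝ)⁻¹)) atTop (𝓝 (0 ^ ((p : ℝ)⁻¹))) :=
    h2.rpow_const (Or.inr (by positivity))
  rw [Real.zero_rpow (by positivity)] at h3
  refine tendsto_zero_iff_abs_tendsto_zero _ |>.2 (h3.congr fun n => ?_)
  rw [Real.pow_rpow_inv_natCast (abs_nonneg _) hp]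
  rfl

/-- This identifies the chaining limit with the original variable. The path from `q` to its dyadic
corner is split into a time leg and a space leg, each with geometrically decaying moments. -/
lemma HasFieldMomentBound.ae_tendsto_gridFloor {X : ℝ≥0 × ℝ → Ω → ℝ} {p : ℕ} {β : ℝ} {C : ℕ → ℝ}
    (h : HasFieldMomentBound P X p β C) (hp : p ≠ 0) (hβ : 2 < β) (q : ℝ≥0 × ℝ) :
    ∀ᵐ ω ∂P, Tendsto (fun n => X (gridFloor n q) ω) atTop (𝓝 (X q ω)) := by
  -- Rounding down can increase `|q.2|` by up to `1`, but cannot increase the time coordinate.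
  obtain ⟨N, hN⟩ := exists_nat_ge (max (q.1 : ℝ) (|q.2| + 1))
  have hN1 : (q.1 : ℝ) ≤ N := (le_max_left _ _).trans hN
  have hN2 : |q.2| + 1 ≤ N := (le_max_right _ _).trans hN
  have hr1 : (2 : ℝ) ^ (-β) < 1 := Real.rpow_lt_one_of_one_lt_of_neg (by norm_num) (by linarith)
  have hpow : ∀ n : ℕ, ((2 : ℝ) ^ n)⁻¹ ^ β = (2 ^ (-β)) ^ n := by
    intro n
    rw [← Real.rpow_natCast, ← Real.rpow_neg (by norm_num),
      ← Real.rpow_mul (by norm_num), ← Real.rpow_natCast, ← Real.rpow_mul (by norm_num)]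
    congr 1
    ring
  have hle : ∀ n : ℕ, ∀ d : ℝ, |d| ≤ (2 ^ n)⁻¹ →
      ENNReal.ofReal (C N * |d| ^ β) ≤ ENNReal.ofReal (|C N| * (2 ^ (-β)) ^ n) := by
    intro n d hd
    refine ENNReal.ofReal_le_ofReal ?_
    rw [← hpow]
    calc C N * |d| ^ β ≤ |C N| * |d| ^ β := by gcongr; exact le_abs_self _
      _ ≤ _ := by gcongr
  have hone : ∀ n : ℕ, ((2 : ℝ) ^ n)⁻¹ ≤ 1 := fun n => inv_le_one_of_one_le₀ (one_le_pow₀ (by norm_num))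
  have hd1 : ∀ n : ℕ, |(q.1 : ℝ) - (gridFloor n q).1| ≤ (2 ^ n)⁻¹ := by
    intro n
    obtain ⟨a, b, -, -⟩ := dist_gridFloor_le n q
    rw [abs_le]
    constructor <;> linarith [inv_pos.2 (pow_pos (two_pos (α := ℝ)) n)]
  have hd2 : ∀ n : ℕ, |q.2 - (gridFloor n q).2| ≤ (2 ^ n)⁻¹ := by
    intro n
    obtain ⟨-, -, a, b⟩ := dist_gridFloor_le n q
    rw [abs_le]
    constructor <;> linarith [inv_pos.2 (pow_pos (two_pos (α := ℝ)) n)]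
  have hb1 : ∀ n : ℕ, (gridFloor n q).1 ≤ (N : ℝ≥0) := by
    intro n
    rw [← NNReal.coe_le_coe]
    exact (dist_gridFloor_le n q).1.trans hN1
  have hb2 : ∀ n : ℕ, |(gridFloor n q).2| ≤ (N : ℝ) := by
    intro n
    have := abs_sub_abs_le_abs_sub (gridFloor n q).2 q.2
    rw [abs_sub_comm] at this
    linarith [hd2 n, hone n]
  have hq1 : q.1 ≤ (N : ℝ≥0) := by rw [← NNReal.coe_le_coe]; exact hN1
  have a1 := ae_tendsto_zero_of_lintegral_pow_le (P := P)
    (Y := fun n ω => X (q.1, q.2) ω - X ((gridFloor n q).1, q.2) ω)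
    (fun n => (h.measurable _).sub (h.measurable _)) hp (by positivity) hr1
    (fun n => (h.time N _ _ _ hq1 (hb1 n) (by linarith) ((hd1 n).trans (hone n))).trans
      (hle n _ (hd1 n)))
  have a2 := ae_tendsto_zero_of_lintegral_pow_le (P := P)
    (Y := fun n ω => X ((gridFloor n q).1, q.2) ω - X ((gridFloor n q).1, (gridFloor n q).2) ω)
    (fun n => (h.measurable _).sub (h.measurable _)) hp (by positivity) hr1
    (fun n => (h.space N _ _ _ (hb1 n) (by linarith) (hb2 n) ((hd2 n).trans (hone n))).trans
      (hle n _ (hd2 n)))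
  filter_upwards [a1, a2] with ω b1 b2
  have := (tendsto_const_nhds (x := X q ω)).sub (b1.add b2)
  simpa using this

/-- The Kolmogorov continuity theorem for random fields on `ℝ₊ × ℝ`. -/
theorem HasFieldMomentBound.exists_version {X : ℝ≥0 × ℝ → Ω → ℝ} {p : ℕ} {β : ℝ} {C : ℕ → ℝ}
    (h : HasFieldMomentBound P X p β C) (hp : p ≠ 0) (hβ : 2 < β) :
    ∃ V : Ω → FieldPath, Measurable V ∧ ∀ q, (fun ω => V ω q) =ᵐ[P] X q := by
  classical
  obtain ⟨ρ, hρ, hρ1, hρβ⟩ := exists_grid_ratio p hβ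
  set G : Set Ω := {ω | ∀ N, gridEnergy p ρ N (fun q => X q ω) < ∞} with hG
  have hGm : MeasurableSet G := by
    rw [hG, Set.ofPred_forall]
    exact MeasurableSet.iInter fun N =>
      measurableSet_lt (h.measurable_gridEnergy ρ N) measurable_const
  have hGae : ∀ᵐ ω ∂P, ω ∈ G := by
    refine ae_all_iff.2 fun N => ae_lt_top (h.measurable_gridEnergy ρ N) ?_
    exact ne_top_of_le_ne_top (gridConst_ne_top hρ hρβ N) (h.lintegral_gridEnergy_le hρ N)
  have hmod : ∀ ω ∈ G, ∀ N, ∃ A, HasGridModulus (fun q => X q ω) N A ρ := fun ω hω N =>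
    ⟨_, hasGridModulus_of_gridEnergy_le hp hρ (hω N).ne le_rfl⟩
  -- Outside the event of finite energies the path is set to `0`; this keeps `V` measurable as a
  -- limit of indicator-cut evaluations.
  let V : Ω → FieldPath := fun ω =>
    if hω : ω ∈ G then ⟨gridLimit (fun q => X q ω), continuous_gridLimit hρ hρ1 (hmod ω hω)⟩ else 0
  have hV : ∀ ω ∈ G, ∀ q, Tendsto (fun n => X (gridFloor n q) ω) atTop (𝓝 (V ω q)) := by
    intro ω hω q
    obtain ⟨N, hN⟩ := exists_fieldBox_nhds q
    obtain ⟨A, hA⟩ := hmod ω hω N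
    simp only [V, hω, dite_true]
    exact hA.tendsto_gridLimit hρ hρ1 (mem_of_mem_nhds hN)
  refine ⟨V, measurable_of_forall_apply fun q => ?_, fun q => ?_⟩
  · refine measurable_of_tendsto_metrizable (f := fun n => G.indicator (X (gridFloor n q)))
      (fun n => (h.measurable _).indicator hGm) (tendsto_pi_nhds.2 fun ω => ?_)
    by_cases hω : ω ∈ G
    · simpa [hω] using hV ω hω q
    · simp [hω, V]
  · filter_upwards [hGae, h.ae_tendsto_gridFloor hp hβ q] with ω hω hlim
    exact tendsto_nhds_unique (hV ω hω q) hlim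

end Version

/-! ### Compact sets of paths and Kolmogorov's tightness criterion. -/

section Tightness

/-- Arzelà–Ascoli: bounded energies give a common grid modulus, hence equicontinuity; together with
the value `0` at the origin it also gives pointwise boundedness. -/
lemma isCompact_closure_gridEnergy_le {p : ℕ} (hp : p ≠ 0) {ρ : ℝ} (hρ : 0 < ρ) (hρ1 : ρ < 1)
    {L : ℕ → ℝ≥0∞} (hL : ∀ N, L N ≠ ∞) :
    IsCompact (closure {w : FieldPath | w (0, 0) = 0 ∧ ∀ N, gridEnergy p ρ N w ≤ L N}) := by
  have hmod : ∀ w ∈ {w : FieldPath | w (0, 0) = 0 ∧ ∀ N, gridEnergy p ρ N w ≤ L N}, ∀ N,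
      HasGridModulus w N (1 + (L N).toReal) ρ :=
    fun w hw N => hasGridModulus_of_gridEnergy_le hp hρ (hL N) (hw.2 N)
  have : T2Space (UniformOnFun (ℝ≥0 × ℝ) ℝ {K | IsCompact K}) :=
    UniformOnFun.t2Space_of_covering (eq_univ_iff_forall.2 fun q =>
      mem_sUnion_of_mem (mem_singleton q) isCompact_singleton)
  refine ArzelaAscoli.isCompact_closure_of_isClosedEmbedding (X := ℝ≥0 × ℝ) (α := ℝ)
    (F := fun w : FieldPath => (w : ℝ≥0 × ℝ → ℝ))
    (𝔖 := {K | IsCompact K}) (fun K hK => hK)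
    ContinuousMap.isUniformEmbedding_toUniformOnFunIsCompact.isClosedEmbedding ?_ ?_
  · refine fun K _ => Equicontinuous.equicontinuousOn (fun q => ?_) K
    refine Metric.equicontinuousAt_iff_right.2 fun η hη => ?_
    obtain ⟨N, hN⟩ := exists_fieldBox_nhds q
    filter_upwards [exists_nhds_abs_gridLimit_sub_lt hN hρ hρ1 hη (A := 1 + (L N).toReal)]
      with r hr w
    have := hr w.1 (hmod w.1 w.2 N)
    rwa [gridLimit_eq_of_continuous w.1.continuous, gridLimit_eq_of_continuous w.1.continuous]
      at this
  · intro K _ q _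
    obtain ⟨N, hN⟩ := exists_fieldBox_nhds q
    have hq : q ∈ fieldBox (N + 1) := by
      have := mem_of_mem_nhds hN
      refine ⟨this.1.trans ?_, this.2.trans ?_⟩ <;> push_cast
      · exact le_self_add
      · linarith
    refine ⟨_, isCompact_closedBall (0 : ℝ)
      ((N + 1 : ℕ) * ((1 + (L (N + 1)).toReal) * (2 + 4 * ρ / (1 - ρ)))), fun w hw => ?_⟩
    have := (hmod w hw (N + 1)).abs_gridLimit_sub_zero_le hρ hρ1 hq N.succ_pos
    rw [gridLimit_eq_of_continuous w.continuous, gridLimit_eq_of_continuous w.continuous, hw.1,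
      sub_zero] at this
    rwa [mem_closedBall_zero_iff, Real.norm_eq_abs]

variable {Ω : Type*} [mΩ : MeasurableSpace Ω] {P : Measure Ω}

/-- Kolmogorov's tightness criterion in `C(ℝ₊ × ℝ)`. -/
theorem isTightMeasureSet_of_hasFieldMomentBound {ι : Type*} {V : ι → Ω → FieldPath}
    (hV : ∀ i, Measurable (V i)) {p : ℕ} (hp : p ≠ 0) {β : ℝ} (hβ : 2 < β) {C : ℕ → ℝ}
    (h : ∀ i, HasFieldMomentBound P (fun q ω => V i ω q) p β C)
    (h0 : ∀ i, ∀ᵐ ω ∂P, V i ω (0, 0) = 0) :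
    IsTightMeasureSet (range fun i => P.map (V i)) := by
  obtain ⟨ρ, hρ, hρ1, hρβ⟩ := exists_grid_ratio p hβ
  rw [isTightMeasureSet_iff_exists_isCompact_measure_compl_le]
  intro δ hδ
  obtain ⟨δ', hδ'0, hδ'⟩ := ENNReal.exists_pos_sum_of_countable' hδ.ne' ℕ
  have hδ'top : ∀ N, δ' N ≠ ∞ := fun N => ne_top_of_lt
    ((ENNReal.le_tsum N).trans_lt (hδ'.trans_le le_top))
  have hgtop := gridConst_ne_top (C := C) hρ hρβ
  -- By Markov's inequality the energy of the box `N` reaches `L N` with probability at most `δ' N`.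
  -- The added `1` keeps the threshold nonzero.
  set L : ℕ → ℝ≥0∞ := fun N => (gridConst p β C ρ N + 1) / δ' N with hLdef
  have hL : ∀ N, L N ≠ ∞ := fun N =>
    ENNReal.div_ne_top (ENNReal.add_ne_top.2 ⟨hgtop N, ENNReal.one_ne_top⟩) (hδ'0 N).ne'
  have hL0 : ∀ N, L N ≠ 0 := fun N => (ENNReal.div_pos (by simp) (hδ'top N)).ne'
  refine ⟨_, isCompact_closure_gridEnergy_le hp hρ hρ1 hL, ?_⟩
  rintro _ ⟨i, rfl⟩
  rw [Measure.map_apply (hV i) isClosed_closure.measurableSet.compl]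
  have hsub : V i ⁻¹' (closure {w : FieldPath | w (0, 0) = 0 ∧ ∀ N, gridEnergy p ρ N w ≤ L N})ᶜ
      ⊆ {ω | V i ω (0, 0) ≠ 0} ∪ ⋃ N, {ω | L N ≤ gridEnergy p ρ N (fun q => V i ω q)} := by
    intro ω hω
    by_contra hcon
    simp only [mem_union, mem_iUnion, mem_ofPred_eq, not_or, not_exists, not_le, not_not] at hcon
    exact hω (subset_closure ⟨hcon.1, fun N => (hcon.2 N).le⟩)
  calc _ ≤ P {ω | V i ω (0, 0) ≠ 0}
        + P (⋃ N, {ω | L N ≤ gridEnergy p ρ N (fun q => V i ω q)}) :=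
        (measure_mono hsub).trans (measure_union_le _ _)
    _ ≤ 0 + ∑' N, δ' N := by
        refine add_le_add (le_of_eq (h0 i)) ((measure_iUnion_le _).trans
          (ENNReal.tsum_le_tsum fun N => ?_))
        refine (meas_ge_le_lintegral_div ((h i).measurable_gridEnergy ρ N).aemeasurable (hL0 N)
          (hL N)).trans ?_
        refine ENNReal.div_le_of_le_mul ?_
        rw [hLdef, ENNReal.mul_div_cancel (hδ'0 N).ne' (hδ'top N)]
        exact ((h i).lintegral_gridEnergy_le hρ N).trans le_self_add
    _ ≤ δ := by rw [zero_add]; exact hδ'.le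

end Tightness

/-! ### Uniform increment moments of the scaled fields. -/

section FieldMoments

variable {Ω : Type*} [mΩ : MeasurableSpace Ω] {P : Measure Ω} [IsProbabilityMeasure P]
  {c : ℝ≥0 → ℝ → Ω → ℝ}

/-- The moments of the spatial increments of `c` up to order `m` are those of a `θ`-Hölder
function with constant `κ`. -/
def HasIncrementMoments (P : Measure Ω) (c : ℝ≥0 → ℝ → Ω → ℝ) (θ : ℝ≥0) (κ : ℝ) (m : ℕ) : Prop :=
  ∀ j, 1 ≤ j → j ≤ m → ∀ (s : ℝ≥0) (y y' : ℝ), |y - y'| ≤ 1 →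
    ∫ ω, |c s y ω - c s y' ω| ^ j ∂P ≤ (κ * |y - y'| ^ (θ : ℝ)) ^ j

/-- The prefactor contributes `ε^q` and the length `(a' - a) / ε` contributes `ε^{-q}`; the
cancellation makes the bound uniform in `ε`. -/
lemma IsFieldProcess.lintegral_scaledIncrement_le {ξ : ℝ → Ω → ℝ} (h : IsFieldProcess P c ξ)
    {q : ℕ} {C b : ℝ} (hC : ∀ a, 0 ≤ a → ∀ T, 0 ≤ T →
      ∫ ω, |∫ s in a..a + T, ξ s ω| ^ (2 * q) ∂P ≤ C * b ^ (2 * q) * √T ^ (2 * q))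
    {ε a a' : ℝ} (hε : 0 < ε) (ha : 0 ≤ a) (haa : a ≤ a') :
    ∫⁻ ω, ENNReal.ofReal (|scaledIncrement ξ ε a a' ω| ^ (2 * q)) ∂P
      ≤ ENNReal.ofReal (C * b ^ (2 * q) * (a' - a) ^ q) := by
  have hd : 0 ≤ a' - a := sub_nonneg.2 haa
  have key := hC (a / ε) (by positivity) ((a' - a) / ε) (by positivity)
  rw [← add_div, add_sub_cancel] at key
  have e : ∀ ω, |scaledIncrement ξ ε a a' ω| ^ (2 * q)
      = ε ^ q * |∫ s in (a / ε)..(a' / ε), ξ s ω| ^ (2 * q) := by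
    intro ω
    unfold scaledIncrement
    rw [abs_mul, mul_pow, abs_of_nonneg (Real.sqrt_nonneg _), pow_mul √ε, Real.sq_sqrt hε.le]
  simp_rw [e]
  rw [← ofReal_integral_eq_lintegral_ofReal ((h.integrable_pow _ _ _).const_mul _)
    (Eventually.of_forall fun ω => by positivity), integral_const_mul]
  refine ENNReal.ofReal_le_ofReal ((mul_le_mul_of_nonneg_left key (by positivity)).trans
    (le_of_eq ?_))
  rw [pow_mul √((a' - a) / ε), Real.sq_sqrt (by positivity), div_pow]
  field_simp

/-- Kolmogorov's condition for the fields `W^ε`, uniformly in `ε`. -/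
lemma exists_hasFieldMomentBound_scaledIntegral (hc : IsBoundedStationaryField P c) {K : ℝ}
    (hK : ∀ r, 0 ≤ r → uniformMixing P c r ≤ K / (1 + r) ^ 2) {θ : ℝ≥0} {κ : ℝ} (hκ : 0 ≤ κ)
    {q : ℕ} (hq : 1 ≤ q) (hm : HasIncrementMoments P c θ κ (2 * q)) {β : ℝ}
    (hβ0 : 0 ≤ β) (hβ1 : β ≤ q) (hβ2 : β ≤ 2 * q * θ) :
    ∃ C : ℕ → ℝ, ∀ ε : ℝ, 0 < ε →
      HasFieldMomentBound P (fun z ω => scaledIntegral c ε z.1 z.2 ω) (2 * q) β C := by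
  obtain ⟨C, hC0, hC⟩ := exists_moment_bound hc hK (2 * q) (by omega)
  obtain ⟨M, hM⟩ := hc.bounded
  obtain ⟨ω₀⟩ : Nonempty Ω := nonempty_of_isProbabilityMeasure P
  have hM0 : 0 ≤ M := (abs_nonneg _).trans (hM 0 0 ω₀)
  have hmax : max (2 * q) 2 = 2 * q := max_eq_left (by omega)
  -- One constant serves both directions: time increments have `b = M`, space increments `b = κ |x -
  -- x'|^θ`, and `(1 + N)^q` bounds `t^q`. Distances are at most `1`, so the powers `q` and `2qθ`
  -- may be lowered to `β`.
  refine ⟨fun N => C * (M + κ) ^ (2 * q) * (1 + N) ^ q, fun ε hε => ⟨fun z => ?_, ?_, ?_⟩⟩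
  · have : (fun ω => scaledIntegral c ε z.1 z.2 ω)
        = scaledIncrement (fun s => c s.toNNReal z.2) ε 0 z.1 :=
      funext fun ω => scaledIntegral_eq_scaledIncrement hε z.1 z.2 ω
    rw [this]
    exact (hc.isFieldProcess_apply z.2).measurable_scaledIncrement _ _ _
  · intro N t t' x ht ht' hx hd
    wlog h : t' ≤ t generalizing t t'
    · simp_rw [abs_sub_comm (scaledIntegral c ε t x _)]
      rw [abs_sub_comm] at hd ⊢
      exact this t' t ht' ht hd (le_of_not_ge h)
    have hp := hc.isFieldProcess_apply x
    have e : ∀ ω, scaledIntegral c ε t x ω - scaledIntegral c ε t' x ω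
        = scaledIncrement (fun s => c s.toNNReal x) ε t' t ω := by
      intro ω
      rw [scaledIntegral_eq_scaledIncrement hε, scaledIntegral_eq_scaledIncrement hε,
        ← hp.scaledIncrement_add ε 0 t' t ω, add_sub_cancel_left]
    simp only [e]
    have hbd : ∀ j, 1 ≤ j → j ≤ max (2 * q) 2 → ∀ s : ℝ, 0 ≤ s →
        ∫ ω, |c s.toNNReal x ω| ^ j ∂P ≤ M ^ j := by
      intro j _ _ s _
      refine (integral_mono_of_nonneg (Eventually.of_forall fun ω => by positivity)
        (integrable_const (M ^ j)) (Eventually.of_forall fun ω => ?_)).trans (by simp)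
      exact pow_le_pow_left₀ (abs_nonneg _) (hM _ _ _) j
    have hd0 : (0 : ℝ) ≤ t - t' := sub_nonneg.2 (by exact_mod_cast h)
    refine (hp.lintegral_scaledIncrement_le (hC _ hp M hM0 hbd) hε t'.coe_nonneg (by exact_mod_cast h)).trans
      (ENNReal.ofReal_le_ofReal ?_)
    rw [abs_of_nonneg hd0] at hd ⊢
    calc C * M ^ (2 * q) * (t - t' : ℝ) ^ q
        ≤ C * (M + κ) ^ (2 * q) * (t - t' : ℝ) ^ β := by
          gcongr
          · linarith
          · rw [← Real.rpow_natCast]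
            rcases hd0.eq_or_lt with h0 | h0
            · rw [← h0, Real.zero_rpow (by positivity)]
              exact Real.rpow_nonneg le_rfl _
            · exact Real.rpow_le_rpow_of_exponent_ge h0 hd hβ1
      _ ≤ C * (M + κ) ^ (2 * q) * (1 + N) ^ q * (t - t' : ℝ) ^ β := by
          refine mul_le_mul_of_nonneg_right ?_ (Real.rpow_nonneg hd0 _)
          refine le_mul_of_one_le_right (by positivity) (one_le_pow₀ ?_)
          linarith [N.cast_nonneg (α := ℝ)]
  · intro N t x x' ht hx hx' hd
    have hp := hc.isFieldProcess_sub x x'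
    have e : ∀ ω, scaledIntegral c ε t x ω - scaledIntegral c ε t x' ω
        = scaledIncrement (fun s ω => c s.toNNReal x ω - c s.toNNReal x' ω) ε 0 t ω := by
      intro ω
      rw [scaledIntegral_eq_scaledIncrement hε, scaledIntegral_eq_scaledIncrement hε]
      unfold scaledIncrement
      rw [intervalIntegral.integral_sub ((hc.isFieldProcess_apply x).intervalIntegrable ω _ _)
        ((hc.isFieldProcess_apply x').intervalIntegrable ω _ _), mul_sub]
    simp only [e]
    have hbd : ∀ j, 1 ≤ j → j ≤ max (2 * q) 2 → ∀ s : ℝ, 0 ≤ s →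
        ∫ ω, |c s.toNNReal x ω - c s.toNNReal x' ω| ^ j ∂P ≤ (κ * |x - x'| ^ (θ : ℝ)) ^ j :=
      fun j hj1 hj2 s _ => hm j hj1 (hmax ▸ hj2) _ x x' hd
    refine (hp.lintegral_scaledIncrement_le (hC _ hp _ (by positivity) hbd) hε le_rfl t.coe_nonneg).trans
      (ENNReal.ofReal_le_ofReal ?_)
    have h1 : (|x - x'| ^ (θ : ℝ)) ^ (2 * q) ≤ |x - x'| ^ β := by
      rw [← Real.rpow_natCast, ← Real.rpow_mul (abs_nonneg _)]
      have e2 : (θ : ℝ) * (2 * q : ℕ) = 2 * q * θ := by push_cast; ring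
      rw [e2]
      rcases (abs_nonneg (x - x')).eq_or_lt with h0 | h0
      · rw [← h0]
        rcases hβ0.eq_or_lt with hb | hb
        · rw [← hb, Real.rpow_zero]
          exact Real.rpow_le_one le_rfl zero_le_one (by positivity)
        · rw [Real.zero_rpow (by linarith)]
          exact Real.rpow_nonneg le_rfl _
      · exact Real.rpow_le_rpow_of_exponent_ge h0 hd hβ2
    have ht' : (t : ℝ) ≤ N := by exact_mod_cast ht
    rw [mul_pow, sub_zero]
    calc C * (κ ^ (2 * q) * (|x - x'| ^ (θ : ℝ)) ^ (2 * q)) * (t : ℝ) ^ q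
        ≤ C * ((M + κ) ^ (2 * q) * |x - x'| ^ β) * (1 + N) ^ q := by
          gcongr
          · linarith
          · linarith
      _ = _ := by ring

lemma HasMixingOrder.exists_le {n : ℕ} (h : HasMixingOrder P c n) (hn : 2 ≤ n) :
    ∃ K, ∀ r, 0 ≤ r → uniformMixing P c r ≤ K / (1 + r) ^ 2 := by
  obtain ⟨δ, hδ, C, hC⟩ := h
  refine ⟨|C|, fun r hr => (hC r hr).trans ?_⟩
  have hn' : (2 : ℝ) ≤ n := by exact_mod_cast hn
  calc C * (1 + r) ^ (-((n : ℝ) + δ)) ≤ |C| * (1 + r) ^ (-((n : ℝ) + δ)) := by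
        gcongr
        exact le_abs_self C
    _ ≤ |C| * (1 + r) ^ (-(2 : ℝ)) := by
        gcongr
        · linarith
        · linarith
    _ = _ := by
        rw [Real.rpow_neg (by linarith), div_eq_mul_inv]
        norm_num

lemma three_le_mixingExponent {θ : ℝ≥0} (hθ : 0 < θ) : 3 ≤ mixingExponent θ := by
  unfold mixingExponent
  split_ifs with h
  · exact le_rfl
  · have : 2 ≤ ⌊1 / θ⌋₊ := by
      refine Nat.le_floor ?_
      rw [le_div_iff₀ hθ]
      push Not at h
      rw [le_div_iff₀ (by norm_num)] at h
      refine le_trans ?_ h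
      rw [mul_comm]
      gcongr
      norm_num
    omega

/-- This property of the exponent makes the spatial Kolmogorov exponent `2qθ` exceed `2`. -/
lemma one_lt_mixingExponent_mul {θ : ℝ≥0} (hθ : 0 < θ) : 1 < (mixingExponent θ : ℝ) * θ := by
  have : (1 : ℝ≥0) < mixingExponent θ * θ := by
    unfold mixingExponent
    split_ifs with h
    · rw [div_lt_iff₀ (by norm_num)] at h
      rw [mul_comm]
      exact_mod_cast h
    · have := Nat.lt_floor_add_one (1 / θ)
      rw [div_lt_iff₀ hθ] at this
      exact_mod_cast this
  exact_mod_cast this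

lemma HasHolderRealizations.exists_hasIncrementMoments {θ : ℝ≥0}
    (h : HasHolderRealizations P c θ) (m : ℕ) :
    ∃ κ, 0 ≤ κ ∧ HasIncrementMoments P c θ κ m := by
  obtain ⟨K, hK⟩ := h
  refine ⟨K, K.coe_nonneg, fun j _ _ s y y' _ => ?_⟩
  refine (integral_mono_of_nonneg (Eventually.of_forall fun ω => by positivity)
    (integrable_const ((K * |y - y'| ^ (θ : ℝ)) ^ j)) ?_).trans (by simp)
  filter_upwards [hK s] with ω hω
  have := hω.dist_le y y'
  rw [Real.dist_eq, Real.dist_eq] at this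
  exact pow_le_pow_left₀ (abs_nonneg _) this j

lemma abs_sub_le_of_holderNormUnitInterval_le {θ : ℝ≥0} {f : ℝ → ℝ} {K : ℝ}
    (h : holderNormUnitInterval θ f ≤ ENNReal.ofReal K) {y y' : ℝ} (hy : y ∈ Icc (0 : ℝ) 1)
    (hy' : y' ∈ Icc (0 : ℝ) 1) : |f y - f y'| ≤ |K| * |y - y'| ^ (θ : ℝ) := by
  have h1 : eHolderNorm θ (fun y : Icc (0 : ℝ) 1 => f y) ≤ ENNReal.ofReal K :=
    le_add_self.trans h
  have hmem : MemHolder θ (fun y : Icc (0 : ℝ) 1 => f y) := by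
    rw [← eHolderNorm_lt_top]
    exact h1.trans_lt ENNReal.ofReal_lt_top
  have h2 := hmem.holderWith.dist_le ⟨y, hy⟩ ⟨y', hy'⟩
  rw [Real.dist_eq, Subtype.dist_eq, Real.dist_eq] at h2
  refine h2.trans ?_
  gcongr
  rw [← ENNReal.ofReal_le_ofReal_iff (abs_nonneg _), ENNReal.ofReal_coe_nnreal,
    hmem.coe_nnHolderNorm_eq_eHolderNorm]
  exact h1.trans (ENNReal.ofReal_le_ofReal (le_abs_self K))

/-- Stationarity moves the two points to `0` and `y' - y` in `[0, 1]` and the time to `0`, so the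
single variable `K 0` controls all increments. -/
lemma HasHolderMoments.exists_hasIncrementMoments (hc : IsBoundedStationaryField P c) {θ : ℝ≥0}
    {m : ℕ} (h : HasHolderMoments P c θ m) : ∃ κ, 0 ≤ κ ∧ HasIncrementMoments P c θ κ m := by
  obtain ⟨K, hK⟩ := h
  obtain ⟨hL, hH⟩ := hK 0
  have hint : Integrable (fun ω => |K 0 ω| ^ m) P := by
    simpa using hL.integrable_norm_pow'
  set I := ∫ ω, |K 0 ω| ^ m ∂P with hI
  have hI0 : 0 ≤ I := integral_nonneg fun ω => by positivity
  -- All orders `1 ≤ j ≤ m` share this constant: `x^j ≤ 1 + x^m` for `x ≥ 0`, and `1 + I ≤ (1 +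
  -- I)^j`.
  refine ⟨1 + I, by positivity, fun j hj hjm s y y' hd => ?_⟩
  wlog hyy : y ≤ y' generalizing y y'
  · simp_rw [abs_sub_comm (c s y _)]
    rw [abs_sub_comm] at hd ⊢
    exact this y' y hd (le_of_not_ge hyy)
  have hshift := hc.integral_comp_shift (g := fun v : Fin 2 → ℝ => |v 0 - v 1| ^ j)
    (((measurable_pi_apply 0).sub (measurable_pi_apply 1)).norm.pow_const j)
    ![0, 0] ![0, y' - y] s y
  simp only [Matrix.cons_val_zero, Matrix.cons_val_one, zero_add, sub_add_cancel] at hshift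
  rw [hshift]
  have hd' : |y - y'| = y' - y := by rw [abs_sub_comm, abs_of_nonneg (by linarith)]
  rw [hd'] at hd ⊢
  have hle : ∀ x : ℝ, 0 ≤ x → x ^ j ≤ 1 + x ^ m := by
    intro x hx
    rcases le_total x 1 with h1 | h1
    · exact (pow_le_one₀ hx h1).trans (by linarith [pow_nonneg hx m])
    · exact (pow_le_pow_right₀ h1 hjm).trans (by linarith)
  calc ∫ ω, |c 0 0 ω - c 0 (y' - y) ω| ^ j ∂P
      ≤ ∫ ω, (1 + |K 0 ω| ^ m) * ((y' - y) ^ (θ : ℝ)) ^ j ∂P := by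
        refine integral_mono_of_nonneg (Eventually.of_forall fun ω => by positivity)
          (((integrable_const 1).add hint).mul_const _) ?_
        filter_upwards [hH] with ω hω
        have h1 := abs_sub_le_of_holderNormUnitInterval_le hω (y := 0) (y' := y' - y)
          ⟨le_rfl, zero_le_one⟩ ⟨by linarith, hd⟩
        rw [abs_sub_comm 0 (y' - y), sub_zero, abs_of_nonneg (a := y' - y) (by linarith)] at h1
        calc |c 0 0 ω - c 0 (y' - y) ω| ^ j ≤ (|K 0 ω| * (y' - y) ^ (θ : ℝ)) ^ j := by gcongr
          _ = |K 0 ω| ^ j * ((y' - y) ^ (θ : ℝ)) ^ j := mul_pow _ _ _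
          _ ≤ _ := by
              refine mul_le_mul_of_nonneg_right (hle _ (abs_nonneg _)) ?_
              exact pow_nonneg (Real.rpow_nonneg (by linarith) _) _
    _ = (1 + I) * ((y' - y) ^ (θ : ℝ)) ^ j := by
        rw [integral_mul_const, integral_add (integrable_const 1) hint]
        simp [hI]
    _ ≤ (1 + I) ^ j * ((y' - y) ^ (θ : ℝ)) ^ j := by
        refine mul_le_mul_of_nonneg_right (le_self_pow₀ (by linarith) (by omega)) ?_
        exact pow_nonneg (Real.rpow_nonneg (by linarith) _) _
    _ = _ := (mul_pow _ _ _).symm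

end FieldMoments

/-! ### Identification of the Gaussian limit. -/

section GaussianLimit

lemma measure_pi_ext_of_integral_expI {ι : Type*} [Fintype ι] {μ ν : Measure (ι → ℝ)}
    [IsFiniteMeasure μ] [IsFiniteMeasure ν]
    (h : ∀ u : ι → ℝ, ∫ x, expI (∑ i, u i * x i) ∂μ = ∫ x, expI (∑ i, u i * x i) ∂ν) : μ = ν := by
  classical
  refine Measure.ext_of_charFunDual (funext fun L => ?_)
  have e : ∀ x : ι → ℝ, Complex.exp (L x * Complex.I)
      = expI (∑ i, L (fun j => if i = j then 1 else 0) * x i) := by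
    intro x
    have := LinearMap.pi_apply_eq_sum_univ (L : (ι → ℝ) →ₗ[ℝ] ℝ) x
    simp only [ContinuousLinearMap.coe_coe, smul_eq_mul] at this
    rw [this, expI]
    simp_rw [mul_comm]
  rw [charFunDual_apply, charFunDual_apply]
  simp_rw [e]
  exact h _

/-- The measure `ν` on `C(ℝ₊ × ℝ)` has the characteristic functions of the centered Gaussian field
with covariance `(t ∧ t') R(x - x')`. -/
def HasLimitCharFun {Ω : Type*} [MeasurableSpace Ω] (P : Measure Ω) (c : ℝ≥0 → ℝ → Ω → ℝ)
    (ν : Measure FieldPath) : Prop :=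
  ∀ (ι : Type) [Fintype ι] (u : ι → ℝ) (t : ι → ℝ≥0) (x : ι → ℝ),
    ∫ w : FieldPath, expI (∑ j, u j * w (t j, x j)) ∂ν
      = (Real.exp (-(limitQuadraticForm P c u t x / 2)) : ℂ)

variable {Ω : Type*} [mΩ : MeasurableSpace Ω] {P : Measure Ω} {c : ℝ≥0 → ℝ → Ω → ℝ}

/-- Characteristic functions fix the finite marginals along a dense sequence of points, these fix
the law on `ℝ^ℕ`, and `denseEval` pulls it back to the path space. -/
lemma HasLimitCharFun.unique {μ ν : Measure FieldPath} [IsFiniteMeasure μ] [IsFiniteMeasure ν]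
    (hμ : HasLimitCharFun P c μ) (hν : HasLimitCharFun P c ν) : μ = ν := by
  rw [← measurableEmbedding_denseEval.comap_map μ, ← measurableEmbedding_denseEval.comap_map ν]
  congr 1
  have hm := measurableEmbedding_denseEval.measurable
  refine IsProjectiveLimit.unique (P := fun I : Finset ℕ => (μ.map denseEval).map I.restrict)
    (fun I => rfl) fun I => ?_
  have hI : Measurable (I.restrict (π := fun _ : ℕ => ℝ)) := Finset.measurable_restrict I
  refine measure_pi_ext_of_integral_expI fun u => ?_
  have key : ∀ κ : Measure FieldPath,
      ∫ x, expI (∑ i, u i * x i) ∂((κ.map denseEval).map I.restrict)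
      = ∫ w : FieldPath, expI (∑ i, u i * w
        ((TopologicalSpace.denseSeq (ℝ≥0 × ℝ) i).1, (TopologicalSpace.denseSeq (ℝ≥0 × ℝ) i).2)) ∂κ := by
    intro κ
    have hcont : Continuous fun x : I → ℝ => expI (∑ i, u i * x i) :=
      continuous_expI.comp (by fun_prop)
    rw [Measure.map_map hI hm,
      integral_map (hI.comp hm).aemeasurable hcont.aestronglyMeasurable]
    rfl
  rw [key, key, hμ, hν]

lemma limitQuadraticForm_const_mul {ι : Type*} [Fintype ι] (s : ℝ) (u : ι → ℝ) (t : ι → ℝ≥0)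
    (x : ι → ℝ) : limitQuadraticForm P c (fun i => s * u i) t x
      = s ^ 2 * limitQuadraticForm P c u t x := by
  unfold limitQuadraticForm
  simp_rw [Finset.mul_sum]
  refine Finset.sum_congr rfl fun i _ => Finset.sum_congr rfl fun j _ => ?_
  ring

variable {ν : Measure FieldPath} [IsProbabilityMeasure ν]

/-- A characteristic function has modulus at most `1`, so the exponent cannot be positive. -/
lemma HasLimitCharFun.limitQuadraticForm_nonneg (hν : HasLimitCharFun P c ν) {ι : Type} [Fintype ι]
    (u : ι → ℝ) (t : ι → ℝ≥0) (x : ι → ℝ) : 0 ≤ limitQuadraticForm P c u t x := by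
  have h1 : ‖∫ w : FieldPath, expI (∑ j, u j * w (t j, x j)) ∂ν‖ ≤ 1 := by
    refine (norm_integral_le_of_norm_le_const (C := 1)
      (Eventually.of_forall fun w => (norm_expI _).le)).trans ?_
    simp
  rw [hν, Complex.norm_real, Real.norm_eq_abs, Real.abs_exp, Real.exp_le_one_iff] at h1
  linarith

lemma measurable_linearComb {ι : Type*} [Fintype ι] (u : ι → ℝ) (t : ι → ℝ≥0) (x : ι → ℝ) :
    Measurable (fun w : FieldPath => ∑ j, u j * w (t j, x j)) :=
  Finset.measurable_sum _ fun _ _ => (measurable_fieldPath_apply _).const_mul _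

/-- Rescaling the weights by `s` evaluates the one-dimensional characteristic function at `s`, and
the quadratic form scales by `s²`. -/
lemma HasLimitCharFun.map_linearComb (hν : HasLimitCharFun P c ν) {ι : Type} [Fintype ι]
    (u : ι → ℝ) (t : ι → ℝ≥0) (x : ι → ℝ) :
    ν.map (fun w : FieldPath => ∑ j, u j * w (t j, x j))
      = gaussianReal 0 (limitQuadraticForm P c u t x).toNNReal := by
  have hm := measurable_linearComb u t x
  have : IsProbabilityMeasure (ν.map (fun w : FieldPath => ∑ j, u j * w (t j, x j))) :=
    Measure.isProbabilityMeasure_map hm.aemeasurable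
  refine Measure.ext_of_charFun (funext fun s => ?_)
  rw [charFun_gaussianReal, charFun_apply_real]
  have e : ∀ y : ℝ, Complex.exp (s * y * Complex.I) = expI (s * y) := by
    intro y
    simp [expI]
  simp_rw [e]
  have hcont : Continuous fun y : ℝ => expI (s * y) := continuous_expI.comp (by fun_prop)
  rw [integral_map hm.aemeasurable hcont.aestronglyMeasurable]
  simp_rw [Finset.mul_sum, ← mul_assoc]
  rw [hν ι (fun i => s * u i) t x, limitQuadraticForm_const_mul,
    Real.coe_toNNReal _ (hν.limitQuadraticForm_nonneg u t x)]
  push_cast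
  congr 1
  ring

lemma HasLimitCharFun.memLp_linearComb (hν : HasLimitCharFun P c ν) {ι : Type} [Fintype ι]
    (u : ι → ℝ) (t : ι → ℝ≥0) (x : ι → ℝ) :
    MemLp (fun w : FieldPath => ∑ j, u j * w (t j, x j)) 2 ν := by
  have h := memLp_id_gaussianReal (μ := 0) (v := (limitQuadraticForm P c u t x).toNNReal) 2
  rw [← hν.map_linearComb u t x] at h
  exact (memLp_map_measure_iff h.1 (measurable_linearComb u t x).aemeasurable).1 h

lemma HasLimitCharFun.integral_linearComb (hν : HasLimitCharFun P c ν) {ι : Type} [Fintype ι]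
    (u : ι → ℝ) (t : ι → ℝ≥0) (x : ι → ℝ) :
    ∫ w : FieldPath, ∑ j, u j * w (t j, x j) ∂ν = 0 := by
  have h := integral_id_gaussianReal (μ := 0) (v := (limitQuadraticForm P c u t x).toNNReal)
  rwa [← hν.map_linearComb u t x, integral_map (measurable_linearComb u t x).aemeasurable
    measurable_id'.aestronglyMeasurable] at h

lemma HasLimitCharFun.integral_linearComb_sq (hν : HasLimitCharFun P c ν) {ι : Type} [Fintype ι]
    (u : ι → ℝ) (t : ι → ℝ≥0) (x : ι → ℝ) :
    ∫ w : FieldPath, (∑ j, u j * w (t j, x j)) ^ 2 ∂ν = limitQuadraticForm P c u t x := by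
  have h := variance_fun_id_gaussianReal (μ := 0) (v := (limitQuadraticForm P c u t x).toNNReal)
  rw [variance_of_integral_eq_zero measurable_id'.aemeasurable integral_id_gaussianReal,
    ← hν.map_linearComb u t x, integral_map (measurable_linearComb u t x).aemeasurable
    (measurable_id'.pow_const 2).aestronglyMeasurable,
    Real.coe_toNNReal _ (hν.limitQuadraticForm_nonneg u t x)] at h
  exact h

lemma HasLimitCharFun.isGaussianProcess (hν : HasLimitCharFun P c ν) :
    IsGaussianProcess (fun (p : ℝ≥0 × ℝ) (w : FieldPath) => w p) ν := by
  classical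
  refine ⟨fun I => ⟨isGaussian_of_map_eq_gaussianReal fun L => ⟨0,
    (limitQuadraticForm P c (fun i : I => L (fun j => if i = j then 1 else 0))
      (fun i => i.1.1) (fun i => i.1.2)).toNNReal, ?_⟩⟩⟩
  · have hm : Measurable (fun w : FieldPath => I.restrict (fun p => w p)) :=
      measurable_pi_iff.2 fun _ => measurable_fieldPath_apply _
    rw [Measure.map_map L.continuous.measurable hm, ← hν.map_linearComb]
    congr 1
    ext w
    have := LinearMap.pi_apply_eq_sum_univ (L : (I → ℝ) →ₗ[ℝ] ℝ) (I.restrict (fun p => w p))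
    simp only [ContinuousLinearMap.coe_coe, smul_eq_mul] at this
    rw [Function.comp_apply, this]
    simp_rw [mul_comm]
    rfl

lemma HasLimitCharFun.isGaussianFieldLaw [IsProbabilityMeasure P]
    (hc : IsBoundedStationaryField P c) (hν : HasLimitCharFun P c ν) :
    IsGaussianFieldLaw (integratedCorrelation P c) ν where
  gaussian := hν.isGaussianProcess
  centered p := by
    simpa using hν.integral_linearComb (fun _ : Unit => 1) (fun _ => p.1) (fun _ => p.2)
  covariance t t' x x' := by
    have hL : ∀ (s : ℝ≥0) (y : ℝ), MemLp (fun w : FieldPath => w (s, y)) 2 ν := fun s y => by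
      simpa using hν.memLp_linearComb (fun _ : Unit => 1) (fun _ => s) (fun _ => y)
    have h1 := hν.integral_linearComb_sq ![1, 1] ![t, t'] ![x, x']
    have h2 := hν.integral_linearComb_sq ![1, -1] ![t, t'] ![x, x']
    have i1 := (hν.memLp_linearComb ![1, 1] ![t, t'] ![x, x']).integrable_sq
    have i2 := (hν.memLp_linearComb ![1, -1] ![t, t'] ![x, x']).integrable_sq
    -- Polarization: the covariance is recovered from the variances of the sum and the difference.
    have e : ∀ w : FieldPath, w (t, x) * w (t', x')
        = 1 / 4 * ((∑ j : Fin 2, ![(1 : ℝ), 1] j * w (![t, t'] j, ![x, x'] j)) ^ 2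
          - (∑ j : Fin 2, ![(1 : ℝ), -1] j * w (![t, t'] j, ![x, x'] j)) ^ 2) := by
      intro w
      simp only [Fin.sum_univ_two, Matrix.cons_val_zero, Matrix.cons_val_one]
      ring
    simp_rw [e]
    rw [integral_const_mul, integral_sub i1 i2, h1, h2]
    simp only [limitQuadraticForm, Fin.sum_univ_two, Matrix.cons_val_zero, Matrix.cons_val_one]
    rw [← hc.integratedCorrelation_neg (x' - x), neg_sub, min_comm t' t]
    ring

/-- Convergence in law from tightness and convergence of characteristic functions. -/
lemma exists_tendsto_of_isTightMeasureSet {V : ℝ → Ω → FieldPath} [IsProbabilityMeasure P]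
    (hV : ∀ ε, Measurable (V ε)) (htight : IsTightMeasureSet ((fun ε => P.map (V ε)) '' Ioi 0))
    (hchar : ∀ (ι : Type) [Fintype ι] (u : ι → ℝ) (t : ι → ℝ≥0) (x : ι → ℝ),
      Tendsto (fun ε => ∫ ω, expI (∑ j, u j * V ε ω (t j, x j)) ∂P) (𝓝[>] 0)
        (𝓝 (Real.exp (-(limitQuadraticForm P c u t x / 2)) : ℂ))) :
    ∃ (ν : Measure FieldPath) (_ : IsProbabilityMeasure ν), HasLimitCharFun P c ν ∧
      TendstoInDistribution V (𝓝[>] (0 : ℝ)) (id : FieldPath → FieldPath) (fun _ => P) ν := by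
  let μ : ℝ → ProbabilityMeasure FieldPath := fun ε =>
    ⟨P.map (V ε), Measure.isProbabilityMeasure_map (hV ε).aemeasurable⟩
  have hK : IsCompact (closure (μ '' Ioi 0)) := by
    refine isCompact_closure_of_isTightMeasureSet ?_
    convert htight using 1
    ext κ
    constructor
    · rintro ⟨_, ⟨ε, hε, rfl⟩, rfl⟩
      exact ⟨ε, hε, rfl⟩
    · rintro ⟨ε, hε, rfl⟩
      exact ⟨μ ε, ⟨ε, hε, rfl⟩, rfl⟩
  have hev : ∀ᶠ ε in 𝓝[>] (0 : ℝ), μ ε ∈ closure (μ '' Ioi 0) :=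
    eventually_mem_nhdsWithin.mono fun ε hε => subset_closure (mem_image_of_mem μ hε)
  -- Along the filter the integrals of the bounded continuous function `g` both converge to the
  -- prescribed value and cluster at the integral against `κ`; the two coincide because `ℂ` is
  -- Hausdorff.
  have hclu : ∀ κ : ProbabilityMeasure FieldPath, MapClusterPt κ (𝓝[>] 0) μ →
      HasLimitCharFun P c κ := by
    intro κ hκ ι _ u t x
    have hcont : Continuous (fun w : FieldPath => expI (∑ j, u j * w (t j, x j))) :=
      continuous_expI.comp (continuous_finsetSum _ fun j _ =>
        continuous_const.mul (continuous_eval_const _))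
    let g : BoundedContinuousFunction FieldPath ℂ :=
      BoundedContinuousFunction.ofNormedAddCommGroup _ hcont 1 fun w => (norm_expI _).le
    have h1 : Tendsto (fun κ : ProbabilityMeasure FieldPath => ∫ w, g w ∂(κ : Measure FieldPath))
        (𝓝 κ) (𝓝 (∫ w, g w ∂(κ : Measure FieldPath))) :=
      (ProbabilityMeasure.tendsto_iff_forall_integral_rclike_tendsto ℂ).1 tendsto_id g
    have h2 := hκ.tendsto_comp h1
    have h3 : Tendsto ((fun κ : ProbabilityMeasure FieldPath =>
        ∫ w, g w ∂(κ : Measure FieldPath)) ∘ μ) (𝓝[>] 0)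
        (𝓝 (Real.exp (-(limitQuadraticForm P c u t x / 2)) : ℂ)) := by
      refine (hchar ι u t x).congr fun ε => ?_
      exact (integral_map (hV ε).aemeasurable hcont.aestronglyMeasurable).symm
    have : NeBot (𝓝 (∫ w, g w ∂(κ : Measure FieldPath))
        ⊓ 𝓝 (Real.exp (-(limitQuadraticForm P c u t x / 2)) : ℂ)) :=
      ClusterPt.mono h2 h3
    exact eq_of_nhds_neBot this
  obtain ⟨ν, -, hν⟩ := hK.exists_mapClusterPt (f := 𝓝[>] (0 : ℝ)) (u := μ)
    (le_principal_iff.2 hev)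
  -- In a compact set, uniqueness of the cluster point implies convergence. The same compactness has
  -- just supplied `ν`, and with it the existence of the limiting law.
  have hlim : Tendsto μ (𝓝[>] 0) (𝓝 ν) :=
    hK.tendsto_nhds_of_unique_mapClusterPt hev fun κ _ hκ => by
      have hκ1 : IsProbabilityMeasure (κ : Measure FieldPath) := κ.2
      have hν1 : IsProbabilityMeasure (ν : Measure FieldPath) := ν.2
      exact Subtype.ext (HasLimitCharFun.unique (P := P) (c := c) (μ := (κ : Measure FieldPath))
        (ν := (ν : Measure FieldPath)) (hclu κ hκ) (hclu ν hν))
  have hν1 : IsProbabilityMeasure (ν : Measure FieldPath) := ν.2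
  refine ⟨ν, hν1, hclu ν hν, ⟨fun ε => (hV ε).aemeasurable, aemeasurable_id, ?_⟩⟩
  have hid : (⟨(ν : Measure FieldPath).map id,
      Measure.isProbabilityMeasure_map aemeasurable_id⟩ : ProbabilityMeasure FieldPath) = ν :=
    Subtype.ext Measure.map_id
  exact hlim.trans (by rw [hid])

end GaussianLimit

/-! ### Assembly of the convergence theorem. -/

section Main

variable {Ω : Type*} [mΩ : MeasurableSpace Ω] {P : Measure Ω} [IsProbabilityMeasure P]
  {c : ℝ≥0 → ℝ → Ω → ℝ}

lemma IsBoundedStationaryField.continuous_scaledIntegral (hc : IsBoundedStationaryField P c) {ε : ℝ}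
    (hε : 0 < ε) (x : ℝ) (ω : Ω) : Continuous (fun t : ℝ≥0 => scaledIntegral c ε t x ω) := by
  simp_rw [scaledIntegral_eq_scaledIncrement hε]
  unfold scaledIncrement
  have h := intervalIntegral.continuous_primitive
    ((hc.isFieldProcess_apply x).intervalIntegrable ω) (0 / ε)
  exact continuous_const.mul (h.comp (NNReal.continuous_coe.div_const ε))

/-- Versions with continuous paths agree with `W^ε` simultaneously for all times. -/
lemma isContinuousVersion_of_ae_eq (hc : IsBoundedStationaryField P c) {ε : ℝ} (hε : 0 < ε)
    {V : Ω → FieldPath} (h : ∀ q : ℝ≥0 × ℝ, (fun ω => V ω q) =ᵐ[P] scaledIntegral c ε q.1 q.2) :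
    IsContinuousVersion P c ε V := by
  intro x
  have h1 : ∀ᵐ ω ∂P, ∀ n : ℕ, V ω (TopologicalSpace.denseSeq ℝ≥0 n, x)
      = scaledIntegral c ε (TopologicalSpace.denseSeq ℝ≥0 n) x ω :=
    ae_all_iff.2 fun n => h (_, x)
  filter_upwards [h1] with ω hω t
  have hV : Continuous (fun t : ℝ≥0 => V ω (t, x)) :=
    (V ω).continuous.comp (continuous_id.prodMk continuous_const)
  refine congrFun (Continuous.ext_on (TopologicalSpace.denseRange_denseSeq ℝ≥0) hV
    (hc.continuous_scaledIntegral hε x ω) ?_) t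
  rintro _ ⟨n, rfl⟩
  exact hω n

theorem convergesToGaussianField_of_hasIncrementMoments (hc : IsBoundedStationaryField P c) {K : ℝ}
    (hK : ∀ r, 0 ≤ r → uniformMixing P c r ≤ K / (1 + r) ^ 2) {θ : ℝ≥0} {κ : ℝ} (hκ : 0 ≤ κ)
    {q : ℕ} (hq : 3 ≤ q) (hqθ : 1 < (q : ℝ) * θ) (hm : HasIncrementMoments P c θ κ (2 * q)) :
    ConvergesToGaussianField P c := by
  classical
  have hq' : (3 : ℝ) ≤ q := by exact_mod_cast hq
  -- The smaller of the time and space exponents; `q ≥ 3` and `qθ > 1` put both above the dimension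
  -- `2`.
  set β : ℝ := min q (2 * q * θ) with hβdef
  have hβ : 2 < β := lt_min (by linarith) (by linarith)
  obtain ⟨C, hC⟩ := exists_hasFieldMomentBound_scaledIntegral hc hK hκ (by omega) hm
    (by linarith) (min_le_left _ _) (min_le_right _ _)
  have hp : 2 * q ≠ 0 := by omega
  have hex : ∀ ε : ℝ, ∃ V : Ω → FieldPath, Measurable V ∧
      (0 < ε → ∀ z : ℝ≥0 × ℝ, (fun ω => V ω z) =ᵐ[P] scaledIntegral c ε z.1 z.2) := by
    intro ε
    by_cases hε : 0 < ε
    · obtain ⟨V, hV, hVe⟩ := (hC ε hε).exists_version hp hβ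
      exact ⟨V, hV, fun _ => hVe⟩
    · exact ⟨fun _ => 0, measurable_const, fun h => absurd h hε⟩
  choose V hV hVe using hex
  refine ⟨hc.integrable_correlation hK, V,
    fun ε hε => isContinuousVersion_of_ae_eq hc hε (hVe ε hε), ?_⟩
  have htight : IsTightMeasureSet ((fun ε => P.map (V ε)) '' Ioi 0) := by
    rw [image_eq_range]
    refine isTightMeasureSet_of_hasFieldMomentBound (V := fun ε : Ioi (0 : ℝ) => V ε)
      (fun ε => hV ε) hp hβ (fun ε => (hC ε ε.2).congr
        (fun z => (measurable_fieldPath_apply z).comp (hV ε)) fun z => (hVe ε ε.2 z).symm)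
      fun ε => ?_
    filter_upwards [hVe ε ε.2 (0, 0)] with ω hω
    rw [hω]
    simp [scaledIntegral]
  obtain ⟨ν, hν1, hν, hlim⟩ := exists_tendsto_of_isTightMeasureSet (c := c) hV htight
    fun ι _ u t x => by
      refine (tendsto_charFun_scaledIntegral hc hK u t x).congr' ?_
      filter_upwards [self_mem_nhdsWithin] with ε hε
      refine integral_congr_ae ?_
      filter_upwards [ae_all_iff.2 fun j => hVe ε hε (t j, x j)] with ω hω
      simp_rw [hω]
  exact ⟨ν, hν1, hν.isGaussianFieldLaw hc, hlim⟩

end Main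

theorem mainTheorem7 {Ω : Type*} [MeasurableSpace Ω] (P : Measure Ω) [IsProbabilityMeasure P]
    (c : ℝ≥0 → ℝ → Ω → ℝ) (hc : IsBoundedStationaryField P c) (θ : ℝ≥0) (hθ : 0 < θ) :
    (HasHolderRealizations P c θ → HasMixingOrder P c (mixingExponent θ) →
      ConvergesToGaussianField P c) ∧
    (HasHolderMoments P c θ (2 * (2 * mixingExponent θ - 1)) →
      HasMixingOrder P c (2 * mixingExponent θ) →
      ConvergesToGaussianField P c) := by
  have hq := three_le_mixingExponent hθ
  have hqθ := one_lt_mixingExponent_mul hθ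
  refine ⟨fun hH hmix => ?_, fun hH hmix => ?_⟩
  · obtain ⟨K, hK⟩ := hmix.exists_le (by omega)
    obtain ⟨κ, hκ, hm⟩ := hH.exists_hasIncrementMoments (2 * mixingExponent θ)
    exact convergesToGaussianField_of_hasIncrementMoments hc hK hκ hq hqθ hm
  · obtain ⟨K, hK⟩ := hmix.exists_le (by omega)
    obtain ⟨κ, hκ, hm⟩ := hH.exists_hasIncrementMoments hc
    refine convergesToGaussianField_of_hasIncrementMoments hc hK hκ hq hqθ fun j hj hj2 => ?_
    -- The tightness argument needs moments of order `2q`, and `2q ≤ 2 (2q - 1)`.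
    exact hm j hj (by omega)
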